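/- **Setting.** $M\ge1$ agents, each with a set of $K\ge1$ actions, act in time steps $t=1,\dots,T$. In every step, agent $m$ sees a context $x$ and picks an action $a$, where $(x,r)\sim\mathcal D_m$ (context and reward vector $r\in[0,1]^K$) is drawn independently over steps and agents, and it receives $r(a)$. The mean rewards are linear with a shared parameter, $\mathbb E[r(a)\mid x]=\mu_m(x,a)=\langle\omega^*,\phi_m(x,a)\rangle$, with known measurable features $\phi_m(x,a)\in\mathbb R^d$, $\|\phi_m(x,a)\|_2\le1$, and unknown $\omega^*\in\mathbb R^d$, $\|\omega^*\|_2\le1$, $d\ge1$. The regret is $$\mathrm{Reg}(T)=\mathbb E\Big[\sum_{m=1}^M\sum_{t=1}^T\big(\max_a\mu_m(x_{m,t},a)-\mu_m(x_{m,t},a_{m,t})\big)\Big].$$ **Algorithm (FedIGW).** Epoch $l\ge1$ consists of the steps $\tau^{l-1}<t\le\tau^l$, with $\tau^0=0$ and $\tau^l=2^l$; so $E^1=2$ and $E^l=2^{l-1}$ for $l\ge2$ are the epoch lengths. The estimate is $\widehat\omega^1=0$ in the first epoch. In epoch $l$, with $\widehat f(a)=\langle\widehat\omega^l,\phi_m(x,a)\rangle$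 and $\widehat a=\arg\max_a\widehat f(a)$, agent $m$ samples its action $a\neq\widehat a$ with probability $1/(K+\gamma^l(\widehat f(\widehat a)-\widehat f(a)))$, and $\widehat a$ with the remaining probability. The learning rate is $\gamma^l=\sqrt{K/\varepsilon(ME^{l-1})}$ for $l\ge2$, where $\varepsilon(n)=c\,d\,(1+\log n)^p/n$, and $\gamma^1=1$. At the end of epoch $l$ the $n=ME^l$ samples of that epoch (agent $m$ holds $(\phi_m^i,r_m^i)_{i\le E^l}$) are used to solve the ridge regression problem $$\min_{\omega\in\mathbb R^d}\ \frac1n\sum_{m=1}^M\sum_{i=1}^{E^l}\big(\langle\omega,\phi_m^i\rangle-r_m^i\big)^2+\lambda\|\omega\|_2^2,\qquad \lambda=\frac1n ,$$ by one of the following protocols between the agents and a server, whose output $\widehat\omega^{l+1}$ is sent to all agents: * *direct method*: in one round every agent sends $\sum_i\phi_m^i(\phi_m^i)^\top$ and $\sum_ir_m^i\phi_m^i$, and the server computes the exact minimizer; * *distributed AGD*: $\rho(n,d)$ rounds of Nesterov's accelerated gradient method (constant step scheme for the smoothness constant $L=2(1+\lambda)$ and the strong convexity constant $\mu=2\lambda$,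 started at $x_0=y_0=0$). With $q=\mu/L$ the iterates are $x_{k+1}=y_k-\frac1L\nabla F(y_k)$ and $y_{k+1}=x_{k+1}+\frac{\alpha_k(1-\alpha_k)}{\alpha_k^2+\alpha_{k+1}}(x_{k+1}-x_k)$, where $F$ is the objective, $\alpha_{k+1}>0$, $\alpha_{k+1}^2=(1-\alpha_{k+1})\alpha_k^2+q\,\alpha_{k+1}$, and $\alpha_0>0$, $\alpha_0^2=(1-\alpha_0)+q\,\alpha_0$. In each round the server sends $y_k\in\mathbb R^d$ to all agents and every agent returns the gradient of its local loss at $y_k$. **Theorem.** There are universal constants $C,c>0$, $p,q_0\in\mathbb N$ and a choice of the number of rounds $\rho(n,d)$ (a function of $n$ and $d$ only) such that, for all $M,K,d,T\ge1$ and all environments as above: 1. with either protocol the regret is well defined and $$\mathrm{Reg}(T)\le 2M+C\sqrt{MKdT}\,\big(1+\log(MT)\big)^{q_0},$$ so that $\mathrm{Reg}(T)=\tilde O(\sqrt{MKdT})$ as soon as $M\le KdT$ (the term $2M$ is the cost $ME^1$ of the first epoch); 2. the number of reals communicated up to time $T$ (in both directions, summed over all agents, rounds and completed epochs) is at most $C\,Md^2\log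 T$ with the direct method; 3. with distributed AGD it is at most $C\,d\log(d+1)\sqrt{M^3T}$. -/

import Mathlib

open MeasureTheory ProbabilityTheory

noncomputable section

namespace FedIGW

/-! ### Distributed protocols for the federated regression problem -/

/-- The feature / parameter space `ℝᵈ` with its Euclidean norm. -/
abbrev Vec (d : ℕ) : Type := EuclideanSpace ℝ (Fin d)

/-- The local dataset of one agent: `E` pairs (feature of the played action, observed reward). -/
abbrev LocalData (d E : ℕ) : Type := Fin E → Vec d × ℝ

/-- A synchronous server / agents protocol with `M` agents holding `E` samples each.  In each of the
`rounds` communication rounds the server sends the reals `broadcast s` (indexed by `Down`) to every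
agent, every agent answers with the reals `reply S msg` (indexed by `Up`), which depend only on its
own local dataset `S` and on the message received, and the server updates its state.  At the end the
server sends the output parameter (`d` reals) to every agent. -/
structure FLProtocol (M d E : ℕ) where
  Down : Type
  Up : Type
  fintypeDown : Fintype Down
  fintypeUp : Fintype Up
  State : Type
  rounds : ℕ
  init : State
  broadcast : State → Down → ℝ
  reply : LocalData d E → (Down → ℝ) → Up → ℝ
  update : State → (Fin M → Up → ℝ) → State
  output : State → Vec d

/-- The state of the server after `k` rounds of communication on the datasets `S`. -/
def FLProtocol.stateAfter {M d E : ℕ} (P : FLProtocol M d E) (S : Fin M → LocalData d E) :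
    ℕ → P.State
  | 0 => P.init
  | k + 1 => P.update (P.stateAfter S k) fun m => P.reply (S m) (P.broadcast (P.stateAfter S k))

/-- The parameter returned by the protocol on the datasets `S`. -/
def FLProtocol.run {M d E : ℕ} (P : FLProtocol M d E) (S : Fin M → LocalData d E) : Vec d :=
  P.output (P.stateAfter S P.rounds)

/-- The number of reals communicated in one execution: in each round `|Down|` reals to and `|Up|`
reals from each of the `M` agents, and finally the `d` coordinates of the output to each agent. -/
def FLProtocol.realsCommunicated {M d E : ℕ} (P : FLProtocol M d E) : ℕ :=
  P.rounds * (M * (@Fintype.card P.Down P.fintypeDown + @Fintype.card P.Up P.fintypeUp)) + M * d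

/-- The regularization parameter `λ = 1 / n`, where `n = M E` is the total number of samples. -/
def ridgeParam (M E : ℕ) : ℝ := 1 / ((M : ℝ) * E)

/-- The local loss
`(1 / E) ∑ᵢ ((⟨θ, φᵢ⟩ - rᵢ)² + λ ‖θ‖²)` of an agent.  The global objective of the ridge regression
is the average of the local losses of the `M` agents. -/
def localLoss {d E : ℕ} (lam : ℝ) (S : LocalData d E) (θ : Vec d) : ℝ :=
  (1 / (E : ℝ)) * ∑ i, ((inner ℝ θ (S i).1 - (S i).2) ^ 2 + lam * ‖θ‖ ^ 2)

/-- The direct method: in a single round every agent sends its matrix `∑ᵢ φᵢ φᵢᵀ` and its vector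
`∑ᵢ rᵢ φᵢ`, and the server computes the exact minimizer of the ridge regression objective,
`((1/n) ∑ₘ ∑ᵢ φᵢ φᵢᵀ + λ I)⁻¹ ((1/n) ∑ₘ ∑ᵢ rᵢ φᵢ)`. -/
def directMethod (M d E : ℕ) : FLProtocol M d E where
  Down := Empty
  Up := (Fin d × Fin d) ⊕ Fin d
  fintypeDown := inferInstance
  fintypeUp := inferInstance
  State := Vec d
  rounds := 1
  init := 0
  broadcast := fun _ e => e.elim
  reply := fun S _ => Sum.elim
    (fun jk => ∑ i, (S i).1 jk.1 * (S i).1 jk.2)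
    (fun j => ∑ i, (S i).2 * (S i).1 j)
  update := fun _ msg =>
    let n : ℝ := (M : ℝ) * E
    let A : Matrix (Fin d) (Fin d) ℝ :=
      Matrix.of (fun j k => (1 / n) * ∑ m, msg m (Sum.inl (j, k))) + ridgeParam M E • 1
    let b : Fin d → ℝ := fun j => (1 / n) * ∑ m, msg m (Sum.inr j)
    WithLp.toLp 2 (A⁻¹.mulVec b)
  output := fun θ => θ

/-- The coefficient recursion of Nesterov's accelerated method with inverse condition number `q`:
the positive root `z` of `z² = (1 - z) a² + q z`. -/
def nesterovCoeff (q a : ℝ) : ℝ :=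
  ((q - a ^ 2) + Real.sqrt ((a ^ 2 - q) ^ 2 + 4 * a ^ 2)) / 2

/-- Distributed accelerated gradient descent, run for `ρ` rounds from `0`: Nesterov's constant step
scheme for an `L`-smooth and `μ`-strongly convex objective, with `L = 2 (1 + λ)` and `μ = 2 λ`
(the ridge regression objective has these properties as features have norm at most one):
`xₖ₊₁ = yₖ - (1/L) ∇F(yₖ)`, `αₖ₊₁² = (1 - αₖ₊₁) αₖ² + (μ/L) αₖ₊₁`,
`yₖ₊₁ = xₖ₊₁ + βₖ (xₖ₊₁ - xₖ)` with `βₖ = αₖ (1 - αₖ) / (αₖ² + αₖ₊₁)`.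
In each round the server sends `yₖ`, every agent answers with the gradient of its local loss at
`yₖ`, and the server averages these gradients.  The state is `(xₖ, yₖ, αₖ)`. -/
def distributedAGD (ρ M d E : ℕ) : FLProtocol M d E where
  Down := Fin d
  Up := Fin d
  fintypeDown := inferInstance
  fintypeUp := inferInstance
  State := Vec d × Vec d × ℝ
  rounds := ρ
  init := (0, 0, nesterovCoeff (ridgeParam M E / (1 + ridgeParam M E)) 1)
  broadcast := fun s j => s.2.1 j
  reply := fun S msg j => (gradient (localLoss (ridgeParam M E) S) (WithLp.toLp 2 msg)) j
  update := fun s msg =>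
    let lam : ℝ := ridgeParam M E
    let L : ℝ := 2 * (1 + lam)
    let q : ℝ := lam / (1 + lam)
    let g : Vec d := (1 / (M : ℝ)) • ∑ m, WithLp.toLp 2 (msg m)
    let x' : Vec d := s.2.1 - (1 / L) • g
    let α : ℝ := s.2.2
    let α' : ℝ := nesterovCoeff q α
    let β : ℝ := α * (1 - α) / (α ^ 2 + α')
    (x', x' + β • (x' - s.1), α')
  output := fun s => s.1

/-! ### Inverse gap weighting -/

/-- The least element of a set of actions (action `0` if the set is empty). -/
def firstOf {K : ℕ} [NeZero K] (s : Finset (Fin K)) : Fin K :=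
  if h : s.Nonempty then s.min' h else 0

/-- `argmaxₐ f a` (the least maximizer). -/
def argmaxArm {K : ℕ} [NeZero K] (f : Fin K → ℝ) : Fin K :=
  firstOf (Finset.univ.filter fun a => ∀ b, f b ≤ f a)

/-- The inverse gap weighting distribution with learning rate `γ` for estimated rewards `f`. -/
def igwProb {K : ℕ} [NeZero K] (γ : ℝ) (f : Fin K → ℝ) (a : Fin K) : ℝ :=
  if a = argmaxArm f then
    1 - ∑ b ∈ Finset.univ.erase (argmaxArm f), 1 / ((K : ℝ) + γ * (f (argmaxArm f) - f b))
  else 1 / ((K : ℝ) + γ * (f (argmaxArm f) - f a))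

/-- The action drawn from the distribution `p` by inversion of the distribution function at `u`;
if `u` is uniform on `[0, 1]` then action `a` has probability `p a`. -/
def sampleArm {K : ℕ} [NeZero K] (p : Fin K → ℝ) (u : ℝ) : Fin K :=
  firstOf (Finset.univ.filter fun a => u ≤ ∑ b ∈ Finset.Iic a, p b)

/-! ### The environment -/

/-- A federated linear contextual bandit with `M` agents, `K` actions per agent, context spaces
`𝒳 m`, and a `d`-dimensional linear reward model whose parameter is shared by the agents. -/
structure LinearEnv {M : ℕ} (K d : ℕ) (𝒳 : Fin M → Type*) [∀ m, MeasurableSpace (𝒳 m)] where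
  /-- The joint law of context and reward vector of agent `m`. -/
  law : ∀ m, Measure (𝒳 m × (Fin K → ℝ))
  isProb : ∀ m, IsProbabilityMeasure (law m)
  reward_mem : ∀ m, ∀ᵐ z ∂(law m), ∀ a, z.2 a ∈ Set.Icc (0 : ℝ) 1
  /-- The known feature map. -/
  feature : ∀ m, 𝒳 m → Fin K → Vec d
  measurable_feature : ∀ m a, Measurable fun x => feature m x a
  norm_feature_le : ∀ m x a, ‖feature m x a‖ ≤ 1
  /-- The unknown system parameter, shared by all agents. -/
  trueParam : Vec d
  norm_trueParam_le : ‖trueParam‖ ≤ 1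
  /-- The conditional mean of the reward of action `a` given the context is linear. -/
  condExp_reward : ∀ m a,
    (law m)[fun z => z.2 a | MeasurableSpace.comap Prod.fst inferInstance]
      =ᵐ[law m] fun z => inner ℝ trueParam (feature m z.1 a)

/-- The mean reward of agent `m` for action `a` in context `x`. -/
def LinearEnv.mean {M K d : ℕ} {𝒳 : Fin M → Type*} [∀ m, MeasurableSpace (𝒳 m)]
    (env : LinearEnv K d 𝒳) (m : Fin M) (x : 𝒳 m) (a : Fin K) : ℝ :=
  inner ℝ env.trueParam (env.feature m x a)

/-- What is drawn for agent `m` in one time step: the context and the reward vector, and the random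
seed that the agent uses to sample its action. -/
abbrev Draw {M : ℕ} (K : ℕ) (𝒳 : Fin M → Type*) (m : Fin M) : Type _ :=
  (𝒳 m × (Fin K → ℝ)) × ℝ

/-- The draws `W m t` are independent over agents `m` and times `t`; context and reward vector
of agent `m` follow its law, and the seed is uniform on `[0, 1]` and independent of them. -/
structure IsInteraction {M K d : ℕ} {𝒳 : Fin M → Type*} [∀ m, MeasurableSpace (𝒳 m)]
    (env : LinearEnv K d 𝒳) {Ω : Type*} [MeasurableSpace Ω] (P : Measure Ω)
    (W : ∀ m : Fin M, ℕ → Ω → Draw K 𝒳 m) : Prop where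
  measurable : ∀ m t, Measurable (W m t)
  law_eq : ∀ m t, P.map (W m t) = (env.law m).prod (volume.restrict (Set.Icc (0 : ℝ) 1))
  indep : iIndepFun (fun j : Fin M × ℕ => W j.1 j.2) P

/-! ### The algorithm -/

/-- The last time step `τˡ = 2ˡ` of epoch `l ≥ 1`, with `τ⁰ = 0`. -/
def epochEnd (l : ℕ) : ℕ := if l = 0 then 0 else 2 ^ l

/-- The length `τˡ - τˡ⁻¹` of epoch `l`. -/
def epochLength (l : ℕ) : ℕ := epochEnd l - epochEnd (l - 1)

/-- The epoch that the time step `t` belongs to. -/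
def epochOf (t : ℕ) : ℕ := sInf {l : ℕ | t ≤ epochEnd l}

/-- The learning rate `γˡ = √(K / ε(n))`, where `n` is the total number of samples of epoch `l - 1`
and `ε(n) = c d (1 + log n)ᵖ / n`; the first epoch, in which the estimate is zero, has rate `1`. -/
def learningRate (c : ℝ) (p M K d l : ℕ) : ℝ :=
  if l ≤ 1 then 1
  else
    let n : ℝ := (M : ℝ) * epochLength (l - 1)
    Real.sqrt (K / (c * d * (1 + Real.log n) ^ p / n))

/-- The action of an agent with feature map `φ` in context `x` with seed `u`, when the learning rate
is `γ` and the estimated reward function is `(x, a) ↦ ⟨θ, φ x a⟩`. -/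
def chooseArm {X : Type*} {K d : ℕ} [NeZero K] (φ : X → Fin K → Vec d) (γ : ℝ) (θ : Vec d)
    (x : X) (u : ℝ) : Fin K :=
  sampleArm (igwProb γ fun a => inner ℝ θ (φ x a)) u

/-- The parameter of the reward estimate used in epoch `l`: zero in the first epoch, and in epoch
`l + 1` the output of the protocol `FL` on the samples collected in epoch `l`. -/
def estimate {M K d : ℕ} [NeZero K] {𝒳 : Fin M → Type*} (φ : ∀ m, 𝒳 m → Fin K → Vec d)
    (γ : ℕ → ℝ) (FL : ∀ E, FLProtocol M d E) (w : ∀ m : Fin M, ℕ → Draw K 𝒳 m) : ℕ → Vec d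
  | 0 => 0
  | 1 => 0
  | l + 2 => (FL (epochLength (l + 1))).run fun m i =>
      let z := w m (epochEnd l + 1 + i)
      let a := chooseArm (φ m) (γ (l + 1)) (estimate φ γ FL w (l + 1)) z.1.1 z.2
      (φ m z.1.1 a, z.1.2 a)

/-- The action of agent `m` at time `t`. -/
def action {M K d : ℕ} [NeZero K] {𝒳 : Fin M → Type*} (φ : ∀ m, 𝒳 m → Fin K → Vec d)
    (γ : ℕ → ℝ) (FL : ∀ E, FLProtocol M d E) (w : ∀ m : Fin M, ℕ → Draw K 𝒳 m)
    (m : Fin M) (t : ℕ) : Fin K :=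
  chooseArm (φ m) (γ (epochOf t)) (estimate φ γ FL w (epochOf t)) (w m t).1.1 (w m t).2

/-- The regret accumulated by all agents up to time `T` for the outcome `w` of the draws. -/
def pathRegret {M K d : ℕ} [NeZero K] {𝒳 : Fin M → Type*} [∀ m, MeasurableSpace (𝒳 m)]
    (env : LinearEnv K d 𝒳) (γ : ℕ → ℝ) (FL : ∀ E, FLProtocol M d E) (T : ℕ)
    (w : ∀ m : Fin M, ℕ → Draw K 𝒳 m) : ℝ :=
  ∑ m, ∑ t ∈ Finset.Icc 1 T,
    (env.mean m (w m t).1.1 (argmaxArm (env.mean m (w m t).1.1))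
      - env.mean m (w m t).1.1 (action env.feature γ FL w m t))

/-- The number of reals communicated by FedIGW up to time `T`: the protocol is executed at the end
of every epoch that is completed by time `T`. -/
def totalRealsCommunicated {M d : ℕ} (FL : ∀ E, FLProtocol M d E) (T : ℕ) : ℕ :=
  ∑ l ∈ (Finset.Icc 1 T).filter (fun l => epochEnd l ≤ T),
    (FL (epochLength l)).realsCommunicated

end FedIGW

end

noncomputable section

namespace FedIGW

/-! ### Nesterov's accelerated gradient method -/

section Nesterov

/-! The regret bound is an induction over epochs, carried out in expectation. Two reward functions
are `RegretClose` with error `B` when every policy has the same regret under both, up to a factor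
`2` and `B`. Inverse gap weighting for an estimate `h` plays each action with probability at least
`1 / (K + γ * gap)`. The squared error of the next estimate under this exploration therefore
controls its error under any policy, at a price given by the policy's `h`-regret (`deviation_le`).
If the true rewards are close to `h`, that price can be paid with true regret, so closeness passes
to the next estimate with the old error divided by three (`RegretClose.step`). With `γ² = K M E / d`
the errors stay of order `M K / γ`. The regret of one step is then of order `√(M K d / t)`, and
summing over `t` gives `√(M K d T)`. Only expectations are used, so there is no union bound; this is
why `c = 1` and `p = q = 0` suffice.

The statistical input is an out-of-sample bound for ridge regression on independent samples whose
laws differ between agents (`sum_integral_prediction_error_le`). Bias, noise and optimization error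
at a fresh feature `ψ` are all controlled by the leverage `⟨ψ, G⁻¹ψ⟩`, where `G` is the Gram
operator. For in-sample features the leverages add up to at most `d`, being a trace. Exchanging one
sample with an independent copy preserves the law and changes a leverage by at most a factor `2`, so
the same bound holds out of sample up to this factor.

The optimization error only has to be small in the energy norm of `G`, relative to `(1 + ‖ridge‖²) /
d`. The direct method has no error. Accelerated gradient descent gets a factor `4 / n` from about
`√n` rounds of the sublinear rate and a factor `1 / d` from about `√n log d` rounds of the linear
rate (`rateSeq_agdRounds_le`). No `log n` appears, so the cost per epoch is of order `√n`, and the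
geometric sum over epochs gives the communication bound. -/

lemma nesterovCoeff_eq (q a : ℝ) :
    nesterovCoeff q a ^ 2 = (1 - nesterovCoeff q a) * a ^ 2 + q * nesterovCoeff q a := by
  have h := Real.sq_sqrt (show 0 ≤ (a ^ 2 - q) ^ 2 + 4 * a ^ 2 by positivity)
  unfold nesterovCoeff
  nlinarith

lemma nesterovCoeff_pos (q : ℝ) {a : ℝ} (ha : 0 < a) : 0 < nesterovCoeff q a := by
  have h : |a ^ 2 - q| < Real.sqrt ((a ^ 2 - q) ^ 2 + 4 * a ^ 2) := by
    rw [← Real.sqrt_sq_eq_abs]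
    exact Real.sqrt_lt_sqrt (sq_nonneg _) (by nlinarith [pow_pos ha 2])
  unfold nesterovCoeff
  linarith [le_abs_self (a ^ 2 - q)]

/-- If the root `α` were at least `1`, then `a² ≥ q` would give `α² = (1 - α) a² + q α ≤ q < 1`. -/
lemma nesterovCoeff_lt_one {q a : ℝ} (hq0 : 0 < q) (hq : q < 1) (ha : 0 < a) (haq : q ≤ a ^ 2) :
    nesterovCoeff q a < 1 := by
  have h1 := nesterovCoeff_eq q a
  have h2 := nesterovCoeff_pos q ha
  by_contra! h
  nlinarith [mul_nonneg (sub_nonneg.2 h) (sub_nonneg.2 haq)]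

lemma le_nesterovCoeff_sq {q a : ℝ} (hq0 : 0 < q) (hq : q < 1) (ha : 0 < a) (haq : q ≤ a ^ 2) :
    q ≤ nesterovCoeff q a ^ 2 := by
  have h1 := nesterovCoeff_eq q a
  have h2 := nesterovCoeff_lt_one hq0 hq ha haq
  nlinarith [mul_nonneg (sub_nonneg.2 h2.le) (sub_nonneg.2 haq)]

/-- The coefficients of the accelerated method, shifted by one: `coeffSeq q 0 = 1`. -/
def coeffSeq (q : ℝ) : ℕ → ℝ
  | 0 => 1
  | k + 1 => nesterovCoeff q (coeffSeq q k)

/-- The contraction factor of the first `k` steps of the accelerated method. -/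
def rateSeq (q : ℝ) : ℕ → ℝ
  | 0 => 1
  | k + 1 => (1 - coeffSeq q (k + 1)) * rateSeq q k

variable {q : ℝ}

lemma coeffSeq_spec (hq0 : 0 < q) (hq : q < 1) (k : ℕ) :
    0 < coeffSeq q k ∧ q ≤ coeffSeq q k ^ 2 := by
  induction k with
  | zero => simp [coeffSeq, hq.le]
  | succ k ih => exact ⟨nesterovCoeff_pos q ih.1, le_nesterovCoeff_sq hq0 hq ih.1 ih.2⟩

lemma coeffSeq_succ_lt_one (hq0 : 0 < q) (hq : q < 1) (k : ℕ) : coeffSeq q (k + 1) < 1 :=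
  nesterovCoeff_lt_one hq0 hq (coeffSeq_spec hq0 hq k).1 (coeffSeq_spec hq0 hq k).2

lemma rateSeq_pos (hq0 : 0 < q) (hq : q < 1) (k : ℕ) : 0 < rateSeq q k := by
  induction k with
  | zero => simp [rateSeq]
  | succ k ih => exact mul_pos (by linarith [coeffSeq_succ_lt_one hq0 hq k]) ih

/-- Both sequences start at `1` and are multiplied by `1 - αₖ₊₁`, but the squared coefficient also
gains `q αₖ₊₁ > 0`. -/
lemma rateSeq_le_coeffSeq_sq (hq0 : 0 < q) (hq : q < 1) (k : ℕ) :
    rateSeq q k ≤ coeffSeq q k ^ 2 := by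
  induction k with
  | zero => simp [rateSeq, coeffSeq]
  | succ k ih =>
    have h1 : coeffSeq q (k + 1) ^ 2
        = (1 - coeffSeq q (k + 1)) * coeffSeq q k ^ 2 + q * coeffSeq q (k + 1) :=
      nesterovCoeff_eq q _
    have h2 := coeffSeq_succ_lt_one hq0 hq k
    have h3 := mul_pos hq0 (coeffSeq_spec hq0 hq (k + 1)).1
    have h4 := mul_le_mul_of_nonneg_left ih (sub_nonneg.2 h2.le)
    rw [h1, rateSeq]
    linarith

/-- The root `s` of the next rate is at most the next coefficient, whence `s² ≤ (1 - s) (2 / (k +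
2))²`. If `s > 2 / (k + 3)`, then `2 - s < s (k + 2)` and squaring gives `(2 - s)² < 4 - 4 s`, which
is absurd. -/
lemma rateSeq_le_sublinear (hq0 : 0 < q) (hq : q < 1) (k : ℕ) :
    rateSeq q k ≤ (2 / ((k : ℝ) + 2)) ^ 2 := by
  induction k with
  | zero => simp [rateSeq]
  | succ k ih =>
    have hp := rateSeq_pos hq0 hq (k + 1)
    set s := Real.sqrt (rateSeq q (k + 1)) with hs
    have hs0 : 0 < s := Real.sqrt_pos.2 hp
    have hs2 : s ^ 2 = rateSeq q (k + 1) := Real.sq_sqrt hp.le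
    have ha : s ≤ coeffSeq q (k + 1) :=
      Real.sqrt_le_iff.2 ⟨(coeffSeq_spec hq0 hq _).1.le, rateSeq_le_coeffSeq_sq hq0 hq _⟩
    have h1 : s ^ 2 ≤ (1 - s) * (2 / ((k : ℝ) + 2)) ^ 2 := by
      rw [hs2, rateSeq]
      have h3 := coeffSeq_succ_lt_one hq0 hq k
      calc _ ≤ (1 - coeffSeq q (k + 1)) * (2 / ((k : ℝ) + 2)) ^ 2 :=
            mul_le_mul_of_nonneg_left ih (by linarith)
        _ ≤ _ := mul_le_mul_of_nonneg_right (by linarith) (sq_nonneg _)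
    rw [← hs2]
    have hk : (0 : ℝ) ≤ k := Nat.cast_nonneg k
    have h2 : s ≤ 2 / ((k : ℝ) + 1 + 2) := by
      rw [le_div_iff₀ (by positivity)]
      by_contra! h
      have h4 : s ^ 2 * ((k : ℝ) + 2) ^ 2 ≤ (1 - s) * 4 := by
        have : (1 - s) * (2 / ((k : ℝ) + 2)) ^ 2 * ((k : ℝ) + 2) ^ 2 = (1 - s) * 4 := by
          field_simp; norm_num
        rw [← this]
        exact mul_le_mul_of_nonneg_right h1 (by positivity)
      have h5 : 2 - s < s * (k + 2) := by linarith
      have h6 : s < 1 := by nlinarith [pow_pos hs0 2, pow_pos (show (0 : ℝ) < k + 2 by positivity) 2]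
      nlinarith [mul_pos hs0 (show (0 : ℝ) < k + 2 by positivity)]
    push_cast
    exact pow_le_pow_left₀ hs0.le h2 2

/-- Every coefficient is at least `√q`. Splitting off the first `k` steps allows the sublinear rate
there and the linear rate afterwards. -/
lemma rateSeq_add_le (hq0 : 0 < q) (hq : q < 1) (k j : ℕ) :
    rateSeq q (k + j) ≤ rateSeq q k * (1 - Real.sqrt q) ^ j := by
  induction j with
  | zero => simp
  | succ j ih =>
    have h1 : Real.sqrt q ≤ coeffSeq q (k + j + 1) :=
      Real.sqrt_le_iff.2 ⟨(coeffSeq_spec hq0 hq _).1.le, (coeffSeq_spec hq0 hq _).2⟩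
    have h2 := coeffSeq_succ_lt_one hq0 hq (k + j)
    calc rateSeq q (k + j + 1) = (1 - coeffSeq q (k + j + 1)) * rateSeq q (k + j) := rfl
      _ ≤ (1 - Real.sqrt q) * (rateSeq q k * (1 - Real.sqrt q) ^ j) :=
        mul_le_mul (by linarith) ih (rateSeq_pos hq0 hq _).le (by linarith)
      _ = _ := by ring

variable {V : Type*} [NormedAddCommGroup V] [InnerProductSpace ℝ V]

/-- One step of the accelerated method contracts the Lyapunov function. -/
lemma nesterov_step {F : V → ℝ} {L q a α : ℝ} {x v y g z : V} (hL : 0 < L) (hα : 0 < α)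
    (hα1 : α ≤ 1) (hq : 0 ≤ q) (hαa : α ^ 2 = (1 - α) * a ^ 2 + q * α)
    (hy : (α + a ^ 2) • y = a ^ 2 • v + α • x)
    (hdesc : F (y - (1 / L) • g) ≤ F y - ‖g‖ ^ 2 / (2 * L))
    (hx : F y + inner ℝ g (x - y) ≤ F x)
    (hz : F y + inner ℝ g (z - y) + q * L / 2 * ‖z - y‖ ^ 2 ≤ F z) :
    F (y - (1 / L) • g) - F z
        + L * α ^ 2 / 2 * ‖x + (1 / α) • (y - (1 / L) • g - x) - z‖ ^ 2
      ≤ (1 - α) * (F x - F z + L * a ^ 2 / 2 * ‖v - z‖ ^ 2) := by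
  set A := (1 - α) * a ^ 2 with hA
  set B := q * α with hB
  have hA0 : 0 ≤ A := mul_nonneg (by linarith) (sq_nonneg _)
  have hB0 : 0 ≤ B := mul_nonneg hq hα.le
  -- `u` is the convex combination of `v - z` and `y - z` with weights `A / α²`, `B / α²`
  set u : V := (1 / α) • (y - (1 - α) • x) - z with hu
  have hv' : x + (1 / α) • (y - (1 / L) • g - x) - z = u - (1 / (α * L)) • g := by
    rw [hu]
    have : (1 / α) • (y - (1 / L) • g - x) = (1 / α) • (y - (1 - α) • x) - (1 / (α * L)) • g - x := by
      have e : (1 / α) • ((1 - α) • x) = (1 / α) • x - x := by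
        rw [smul_smul]
        have : 1 / α * (1 - α) = 1 / α - 1 := by field_simp
        rw [this, sub_smul, one_smul]
      have e2 : (1 / α) • ((1 / L) • g) = (1 / (α * L)) • g := by
        rw [smul_smul]; congr 1; field_simp
      rw [smul_sub, smul_sub, smul_sub, e, e2]; abel
    rw [this]; abel
  have huc : α ^ 2 • u = A • (v - z) + B • (y - z) := by
    have e1 : α ^ 2 • u = α • y - (α * (1 - α)) • x - α ^ 2 • z := by
      rw [hu, smul_sub, smul_smul, smul_sub, smul_smul]
      congr 2
      · congr 1; field_simp
      · congr 1; field_simp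
    have e2 : a ^ 2 • v = (α + a ^ 2) • y - α • x := by rw [hy]; abel
    have e3 : A • v = ((1 - α) * (α + a ^ 2)) • y - ((1 - α) * α) • x := by
      rw [hA, mul_smul, e2, smul_sub, smul_smul, smul_smul]
    rw [e1, smul_sub, smul_sub, e3]
    have e4 : α = (1 - α) * (α + a ^ 2) + B := by rw [hB]; linarith
    have e5 : α • y = ((1 - α) * (α + a ^ 2)) • y + B • y := by rw [← add_smul, ← e4]
    have e6 : α ^ 2 • z = A • z + B • z := by rw [← add_smul, hαa]
    rw [e5, e6, mul_comm α (1 - α)]; abel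
  -- Convexity of the squared norm, using `A + B = α²`; this is where the recursion for the
  -- coefficients enters.
  have hconv : α ^ 2 * ‖u‖ ^ 2 ≤ A * ‖v - z‖ ^ 2 + B * ‖y - z‖ ^ 2 := by
    have h1 : α ^ 2 * ‖u‖ ^ 2 = A * inner ℝ u (v - z) + B * inner ℝ u (y - z) := by
      rw [← real_inner_self_eq_norm_sq, ← inner_smul_right, huc, inner_add_right,
        inner_smul_right, inner_smul_right]
    have key : ∀ w : V, inner ℝ u w ≤ (‖u‖ ^ 2 + ‖w‖ ^ 2) / 2 := fun w => by
      have := real_inner_le_norm u w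
      nlinarith [sq_nonneg (‖u‖ - ‖w‖)]
    have h2 := mul_le_mul_of_nonneg_left (key (v - z)) hA0
    have h3 := mul_le_mul_of_nonneg_left (key (y - z)) hB0
    have h4 : α ^ 2 * ‖u‖ ^ 2 = A * ‖u‖ ^ 2 + B * ‖u‖ ^ 2 := by rw [hαa]; ring
    linarith
  have hexp : L * α ^ 2 / 2 * ‖u - (1 / (α * L)) • g‖ ^ 2
      = L / 2 * (α ^ 2 * ‖u‖ ^ 2) - α * inner ℝ g u + ‖g‖ ^ 2 / (2 * L) := by
    rw [norm_sub_sq_real, inner_smul_right, norm_smul, mul_pow, Real.norm_eq_abs, sq_abs,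
      real_inner_comm g u]
    field_simp
  -- The linear term is exactly the one produced by weighting the lower bounds `hx` and `hz` with `1
  -- - α` and `α`, so it cancels.
  have hcomb : -(α * inner ℝ g u) = (1 - α) * inner ℝ g (x - y) + α * inner ℝ g (z - y) := by
    have : α • u = (α - 1) • (x - y) + α • (y - z) := by
      rw [hu, smul_sub, smul_smul, mul_one_div_cancel hα.ne', one_smul, smul_sub, smul_sub,
        sub_smul, sub_smul, sub_smul, one_smul, one_smul]
      abel
    rw [← inner_smul_right, this, inner_add_right, inner_smul_right, inner_smul_right,
      ← neg_sub z y, inner_neg_right]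
    ring
  rw [hv', hexp]
  have h1 := mul_le_mul_of_nonneg_left hx (show 0 ≤ 1 - α by linarith)
  have h2 := mul_le_mul_of_nonneg_left hz hα.le
  have h3 := mul_le_mul_of_nonneg_left hconv (show 0 ≤ L / 2 by positivity)
  rw [norm_sub_rev z y] at h2
  rw [hA, hB] at h3
  linarith

/-- The extrapolation step of the accelerated method keeps `y` on the segment between the iterate
and the momentum point. -/
lemma nesterov_extrapolation {a α : ℝ} {x x' : V} (ha : 0 < a) (hα : 0 < α) :
    (α + a ^ 2) • (x' + (a * (1 - a) / (a ^ 2 + α)) • (x' - x))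
      = a ^ 2 • (x + (1 / a) • (x' - x)) + α • x' := by
  have h1 : (α + a ^ 2) • ((a * (1 - a) / (a ^ 2 + α)) • (x' - x)) = (a * (1 - a)) • (x' - x) := by
    rw [smul_smul]; congr 1
    have : a ^ 2 + α ≠ 0 := by positivity
    field_simp; ring
  have h2 : a ^ 2 • ((1 / a) • (x' - x)) = a • (x' - x) := by
    rw [smul_smul]; congr 1; field_simp
  have h3 : (a * (1 - a)) • (x' - x) = a • (x' - x) - a ^ 2 • (x' - x) := by
    rw [← sub_smul]; congr 1; ring
  rw [smul_add, h1, smul_add (a ^ 2), h2, h3, add_smul, smul_sub (a ^ 2)]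
  abel

end Nesterov

/-! ### Ridge regression -/

section Ridge

variable {d : ℕ} {ι : Type*} [Fintype ι]

/-- The regularized Gram operator `v ↦ v + ∑ᵢ ⟨φᵢ, v⟩ φᵢ`. -/
def gram (S : ι → Vec d × ℝ) : Vec d →L[ℝ] Vec d :=
  1 + ∑ i, (innerSL ℝ (S i).1).smulRight (S i).1

/-- The inverse of the regularized Gram operator. -/
def gramInv (S : ι → Vec d × ℝ) : Vec d →L[ℝ] Vec d := Ring.inverse (gram S)

/-- The leverage of the vector `ψ`. -/
def leverage (S : ι → Vec d × ℝ) (ψ : Vec d) : ℝ := inner ℝ ψ (gramInv S ψ)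

/-- The ridge regression estimate. -/
def ridge (S : ι → Vec d × ℝ) : Vec d := gramInv S (∑ i, (S i).2 • (S i).1)

lemma gram_apply (S : ι → Vec d × ℝ) (v : Vec d) :
    gram S v = v + ∑ i, (inner ℝ (S i).1 v : ℝ) • (S i).1 := by
  simp [gram]

lemma inner_gram (S : ι → Vec d × ℝ) (v w : Vec d) :
    inner ℝ (gram S v) w = inner ℝ v w + ∑ i, inner ℝ (S i).1 v * inner ℝ (S i).1 w := by
  rw [gram_apply, inner_add_left, sum_inner]
  simp [inner_smul_left]

lemma inner_gram_self (S : ι → Vec d × ℝ) (v : Vec d) :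
    inner ℝ (gram S v) v = ‖v‖ ^ 2 + ∑ i, (inner ℝ (S i).1 v : ℝ) ^ 2 := by
  rw [inner_gram, real_inner_self_eq_norm_sq]
  simp [sq]

lemma norm_sq_le_inner_gram (S : ι → Vec d × ℝ) (v : Vec d) :
    ‖v‖ ^ 2 ≤ inner ℝ (gram S v) v := by
  rw [inner_gram_self]
  have : 0 ≤ ∑ i, (inner ℝ (S i).1 v : ℝ) ^ 2 := Finset.sum_nonneg fun i _ => sq_nonneg _
  linarith

lemma inner_gram_comm (S : ι → Vec d × ℝ) (v w : Vec d) :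
    inner ℝ (gram S v) w = inner ℝ v (gram S w) := by
  rw [inner_gram, ← real_inner_comm v (gram S w), inner_gram, real_inner_comm v w]
  simp [mul_comm]

lemma isUnit_gram (S : ι → Vec d × ℝ) : IsUnit (gram S) := by
  rw [ContinuousLinearMap.isUnit_iff_bijective]
  have h : Function.Injective (gram S) := by
    rw [injective_iff_map_eq_zero]
    intro v hv
    have := norm_sq_le_inner_gram S v
    rw [hv, inner_zero_left] at this
    exact norm_eq_zero.1 (pow_eq_zero_iff two_ne_zero |>.1 (le_antisymm this (sq_nonneg _)))
  exact ⟨h, (LinearMap.injective_iff_surjective (f := (gram S : Vec d →ₗ[ℝ] Vec d))).1 h⟩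

lemma gram_gramInv (S : ι → Vec d × ℝ) (v : Vec d) : gram S (gramInv S v) = v := by
  have := Ring.mul_inverse_cancel _ (isUnit_gram S)
  exact congrArg (fun f : Vec d →L[ℝ] Vec d => f v) this

lemma gramInv_gram (S : ι → Vec d × ℝ) (v : Vec d) : gramInv S (gram S v) = v := by
  have := Ring.inverse_mul_cancel _ (isUnit_gram S)
  exact congrArg (fun f : Vec d →L[ℝ] Vec d => f v) this

lemma inner_gramInv_comm (S : ι → Vec d × ℝ) (v w : Vec d) :
    inner ℝ (gramInv S v) w = inner ℝ v (gramInv S w) := by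
  conv_lhs => rw [← gram_gramInv S w]
  rw [← inner_gram_comm, gram_gramInv]

lemma leverage_eq (S : ι → Vec d × ℝ) (ψ : Vec d) :
    leverage S ψ = inner ℝ (gram S (gramInv S ψ)) (gramInv S ψ) := by
  rw [gram_gramInv, leverage]

lemma leverage_nonneg (S : ι → Vec d × ℝ) (ψ : Vec d) : 0 ≤ leverage S ψ := by
  rw [leverage_eq]
  exact (sq_nonneg _).trans (norm_sq_le_inner_gram _ _)

lemma inner_gram_sq_le (S : ι → Vec d × ℝ) (v w : Vec d) :
    (inner ℝ (gram S v) w : ℝ) ^ 2 ≤ inner ℝ (gram S v) v * inner ℝ (gram S w) w := by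
  have h : ∀ t : ℝ, 0 ≤ inner ℝ (gram S w) w * (t * t) + 2 * inner ℝ (gram S v) w * t
      + inner ℝ (gram S v) v := fun t => by
    have h1 := (sq_nonneg _).trans (norm_sq_le_inner_gram S (v + t • w))
    rw [map_add, map_smul, inner_add_left, inner_add_right, inner_add_right, inner_smul_left,
      inner_smul_left, inner_smul_right, inner_smul_right, inner_gram_comm S w v,
      real_inner_comm (gram S v) w] at h1
    simp only [conj_trivial] at h1
    linarith
  have := discrim_le_zero h
  rw [discrim] at this
  nlinarith

/-- Cauchy–Schwarz for the form of `gram S`, with `gramInv S ψ` as second vector. It turns a bound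
on the energy of a parameter error into a bound on the prediction error at `ψ`. -/
lemma inner_sq_le_leverage (S : ι → Vec d × ℝ) (v ψ : Vec d) :
    (inner ℝ v ψ : ℝ) ^ 2 ≤ inner ℝ (gram S v) v * leverage S ψ := by
  have h := inner_gram_sq_le S v (gramInv S ψ)
  rwa [← leverage_eq, inner_gram_comm, gram_gramInv] at h

lemma norm_gramInv_le (S : ι → Vec d × ℝ) (v : Vec d) : ‖gramInv S v‖ ≤ ‖v‖ := by
  have h1 := norm_sq_le_inner_gram S (gramInv S v)
  rw [gram_gramInv] at h1
  have h2 := real_inner_le_norm v (gramInv S v)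
  by_contra! h
  nlinarith [norm_nonneg v]

lemma leverage_le (S : ι → Vec d × ℝ) (ψ : Vec d) : leverage S ψ ≤ ‖ψ‖ ^ 2 := by
  have h2 := real_inner_le_norm ψ (gramInv S ψ)
  have h3 := mul_le_mul_of_nonneg_left (norm_gramInv_le S ψ) (norm_nonneg ψ)
  rw [leverage]; nlinarith

lemma sum_inner_gramInv_sq_le (S : ι → Vec d × ℝ) (ψ : Vec d) :
    ∑ i, (inner ℝ (S i).1 (gramInv S ψ) : ℝ) ^ 2 ≤ leverage S ψ := by
  rw [leverage_eq, inner_gram_self]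
  linarith [sq_nonneg ‖gramInv S ψ‖]

/-- With `G` the Gram operator, the sum is `tr (G⁻¹ (G - 1)) = d - tr G⁻¹`, computed in the standard
basis. -/
lemma sum_leverage_le (S : ι → Vec d × ℝ) : ∑ i, leverage S (S i).1 ≤ d := by
  let e := EuclideanSpace.basisFun (Fin d) ℝ
  have h1 : ∀ i, leverage S (S i).1
      = ∑ k, inner ℝ (S i).1 (e k) * inner ℝ (S i).1 (gramInv S (e k)) := fun i => by
    rw [leverage, ← inner_gramInv_comm, ← e.sum_inner_mul_inner (gramInv S (S i).1) (S i).1]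
    refine Finset.sum_congr rfl fun k _ => ?_
    rw [inner_gramInv_comm, real_inner_comm (e k), mul_comm]
  have h2 : ∀ k, ∑ i, inner ℝ (S i).1 (e k) * inner ℝ (S i).1 (gramInv S (e k))
      = 1 - inner ℝ (e k) (gramInv S (e k)) := fun k => by
    have := inner_gram S (e k) (gramInv S (e k))
    rw [inner_gram_comm, gram_gramInv, real_inner_self_eq_norm_sq, e.norm_eq_one] at this
    linarith
  simp_rw [h1]
  rw [Finset.sum_comm]
  simp_rw [h2]
  have h3 : ∀ k, 1 - inner ℝ (e k) (gramInv S (e k)) ≤ (1 : ℝ) := fun k => by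
    have := leverage_nonneg S (e k)
    rw [leverage] at this; linarith
  calc _ ≤ ∑ _k : Fin d, (1 : ℝ) := Finset.sum_le_sum fun k _ => h3 k
    _ = d := by simp

lemma continuous_gram : Continuous (gram : (ι → Vec d × ℝ) → _) := by
  unfold gram
  refine continuous_const.add (continuous_finsetSum _ fun i _ => ?_)
  have h : Continuous fun S : ι → Vec d × ℝ => (S i).1 := by fun_prop
  have h2 : Continuous fun S : ι → Vec d × ℝ => innerSL ℝ (S i).1 :=
    (innerSL ℝ).continuous.comp h
  exact (((ContinuousLinearMap.smulRightL ℝ (Vec d) (Vec d)).continuous.comp h2).clm_apply h)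

/-- Inversion is continuous at units and every Gram operator is a unit. This supplies the
measurability needed for Fubini and for the estimates as random variables. -/
lemma continuous_gramInv : Continuous (gramInv : (ι → Vec d × ℝ) → _) := by
  rw [continuous_iff_continuousAt]
  intro S
  obtain ⟨u, hu⟩ := isUnit_gram S
  have h := NormedRing.inverse_continuousAt u
  rw [hu] at h
  exact ContinuousAt.comp (f := gram) h continuous_gram.continuousAt

lemma continuous_leverage : Continuous fun p : (ι → Vec d × ℝ) × Vec d => leverage p.1 p.2 :=
  continuous_snd.inner ((continuous_gramInv.comp continuous_fst).clm_apply continuous_snd)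

lemma continuous_ridge : Continuous (ridge : (ι → Vec d × ℝ) → _) :=
  continuous_gramInv.clm_apply (by fun_prop)

lemma gram_ridge (S : ι → Vec d × ℝ) : gram S (ridge S) = ∑ i, (S i).2 • (S i).1 :=
  gram_gramInv _ _

/-- Samples with features in the unit ball and rewards in the unit interval. -/
def goodSample (d : ℕ) : Set (Vec d × ℝ) := {z | ‖z.1‖ ≤ 1 ∧ z.2 ∈ Set.Icc (0 : ℝ) 1}

lemma norm_ridge_le {S : ι → Vec d × ℝ} (hS : ∀ i, S i ∈ goodSample d) :
    ‖ridge S‖ ≤ Fintype.card ι := by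
  refine (norm_gramInv_le _ _).trans ((norm_sum_le _ _).trans ?_)
  calc _ ≤ ∑ _i : ι, (1 : ℝ) := Finset.sum_le_sum fun i _ => by
        rw [norm_smul, Real.norm_eq_abs, abs_of_nonneg (hS i).2.1]
        exact mul_le_one₀ (hS i).2.2 (norm_nonneg _) (hS i).1
    _ = _ := by simp

variable [DecidableEq ι]

/-- The new Gram operator dominates the identity, hence also the rank-one term of the removed
sample, so the old form is at most twice the new one. Cauchy–Schwarz for the old form at `w =
gramInv S' ψ` transfers this to the inverses. -/
lemma leverage_update_le {S : ι → Vec d × ℝ} {i : ι} (hi : ‖(S i).1‖ ≤ 1) (z : Vec d × ℝ)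
    (ψ : Vec d) : leverage (Function.update S i z) ψ ≤ 2 * leverage S ψ := by
  set S' := Function.update S i z
  set w := gramInv S' ψ with hw
  have h1 : inner ℝ (gram S w) w ≤ 2 * inner ℝ (gram S' w) w := by
    rw [inner_gram_self, inner_gram_self, ← Finset.add_sum_erase _ _ (Finset.mem_univ i),
      ← Finset.add_sum_erase _ (fun j => (inner ℝ (S' j).1 w : ℝ) ^ 2) (Finset.mem_univ i)]
    have h2 : ∑ j ∈ Finset.univ.erase i, (inner ℝ (S' j).1 w : ℝ) ^ 2
        = ∑ j ∈ Finset.univ.erase i, (inner ℝ (S j).1 w : ℝ) ^ 2 :=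
      Finset.sum_congr rfl fun j hj => by
        rw [show S' j = S j from Function.update_of_ne (Finset.ne_of_mem_erase hj) _ _]
    have h3 : (inner ℝ (S i).1 w : ℝ) ^ 2 ≤ ‖w‖ ^ 2 := by
      have h4 := abs_real_inner_le_norm (S i).1 w
      rw [← sq_abs]
      exact pow_le_pow_left₀ (abs_nonneg _)
        (h4.trans (mul_le_of_le_one_left (norm_nonneg _) hi)) 2
    have h5 : 0 ≤ ∑ j ∈ Finset.univ.erase i, (inner ℝ (S j).1 w : ℝ) ^ 2 :=
      Finset.sum_nonneg fun j _ => sq_nonneg _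
    rw [h2]
    nlinarith [sq_nonneg (inner ℝ (S' i).1 w : ℝ)]
  have h2 := inner_sq_le_leverage S w ψ
  rw [← leverage_eq] at h1
  have h3 : (inner ℝ w ψ : ℝ) = leverage S' ψ := real_inner_comm _ _
  rw [h3] at h2
  have h4 := leverage_nonneg S ψ
  have h5 := leverage_nonneg S' ψ
  have h6 := mul_le_mul_of_nonneg_right h1 h4
  by_contra! h
  nlinarith

/-- Applied to the difference of the two estimates, the new Gram operator leaves only the residual
terms of the two exchanged samples. Each has norm at most `1 + ‖ridge S‖`, and the inverse Gram
operator is a contraction. -/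
lemma norm_ridge_update_le {S : ι → Vec d × ℝ} {i : ι} {z : Vec d × ℝ} (hi : S i ∈ goodSample d)
    (hz : z ∈ goodSample d) : ‖ridge (Function.update S i z)‖ ≤ 2 + 3 * ‖ridge S‖ := by
  set S' := Function.update S i z with hS'
  have hsum : ∀ f : Vec d × ℝ → Vec d, ∑ j, f (S' j) = ∑ j, f (S j) - f (S i) + f z := fun f => by
    rw [← Finset.add_sum_erase _ _ (Finset.mem_univ i),
      ← Finset.add_sum_erase _ (fun j => f (S j)) (Finset.mem_univ i)]
    have h2 : ∑ j ∈ Finset.univ.erase i, f (S' j) = ∑ j ∈ Finset.univ.erase i, f (S j) :=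
      Finset.sum_congr rfl fun j hj => by
        rw [show S' j = S j from Function.update_of_ne (Finset.ne_of_mem_erase hj) _ _]
    rw [h2, show S' i = z from Function.update_self _ _ _]
    abel
  have key : gram S' (ridge S' - ridge S)
      = (z.2 - inner ℝ z.1 (ridge S)) • z.1
        - ((S i).2 - inner ℝ (S i).1 (ridge S)) • (S i).1 := by
    have h1 := gram_ridge S
    rw [gram_apply] at h1
    rw [map_sub, gram_ridge, gram_apply, hsum (fun s => s.2 • s.1),
      hsum (fun s => (inner ℝ s.1 (ridge S) : ℝ) • s.1), ← h1, sub_smul, sub_smul]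
    abel
  have hb : ∀ s ∈ goodSample d, ‖(s.2 - inner ℝ s.1 (ridge S)) • s.1‖ ≤ 1 + ‖ridge S‖ := by
    intro s hs
    rw [norm_smul, Real.norm_eq_abs]
    have h4 := (abs_real_inner_le_norm s.1 (ridge S)).trans
      (mul_le_of_le_one_left (norm_nonneg _) hs.1)
    have h5 : |s.2 - inner ℝ s.1 (ridge S)| ≤ 1 + ‖ridge S‖ := by
      rw [abs_le] at *
      constructor <;> linarith [hs.2.1, hs.2.2, h4.1, h4.2]
    calc _ ≤ (1 + ‖ridge S‖) * 1 :=
          mul_le_mul h5 hs.1 (norm_nonneg _) (by positivity)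
      _ = _ := mul_one _
  have h1 : ‖ridge S' - ridge S‖ ≤ 2 + 2 * ‖ridge S‖ := by
    rw [← gramInv_gram S' (ridge S' - ridge S), key]
    refine (norm_gramInv_le _ _).trans ((norm_sub_le _ _).trans ?_)
    linarith [hb z hz, hb (S i) hi]
  have h2 := norm_add_le (ridge S' - ridge S) (ridge S)
  rw [sub_add_cancel] at h2
  linarith

end Ridge

/-! ### Resampling one coordinate of a product measure -/

section Resample

variable {ι : Type*} [Fintype ι] [DecidableEq ι] {α : Type*} [MeasurableSpace α]
  (ρ : ι → Measure α) [∀ i, IsProbabilityMeasure (ρ i)]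

lemma measurePreserving_update (i : ι) :
    MeasurePreserving (fun p : (ι → α) × α => Function.update p.1 i p.2)
      ((Measure.pi ρ).prod (ρ i)) (Measure.pi ρ) := by
  refine ⟨measurable_update', (Measure.pi_eq fun s hs => ?_).symm⟩
  rw [Measure.map_apply measurable_update' (MeasurableSet.univ_pi hs)]
  have : (fun p : (ι → α) × α => Function.update p.1 i p.2) ⁻¹' (Set.univ.pi s)
      = (Set.univ.pi (Function.update s i Set.univ)) ×ˢ (s i) := by
    ext p
    simp only [Set.mem_preimage, Set.mem_univ_pi, Set.mem_prod]
    constructor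
    · intro h
      refine ⟨fun j => ?_, by simpa using h i⟩
      rcases eq_or_ne j i with rfl | hj
      · simp
      · simpa [Function.update_of_ne hj] using h j
    · rintro ⟨h1, h2⟩ j
      rcases eq_or_ne j i with rfl | hj
      · simpa using h2
      · simpa [Function.update_of_ne hj] using h1 j
  rw [this, Measure.prod_prod, Measure.pi_pi, ← Finset.mul_prod_erase _ _ (Finset.mem_univ i),
    ← Finset.mul_prod_erase _ (fun j => ρ j (s j)) (Finset.mem_univ i)]
  have h2 : ∏ j ∈ Finset.univ.erase i, ρ j (Function.update s i Set.univ j)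
      = ∏ j ∈ Finset.univ.erase i, ρ j (s j) :=
    Finset.prod_congr rfl fun j hj => by
      rw [Function.update_of_ne (Finset.ne_of_mem_erase hj)]
  rw [h2, Function.update_self, measure_univ, one_mul, mul_comm]

/-- Exchanging the `i`-th coordinate with an independent copy preserves the law. -/
lemma measurePreserving_exchange (i : ι) :
    MeasurePreserving (fun p : (ι → α) × α => (Function.update p.1 i p.2, p.1 i))
      ((Measure.pi ρ).prod (ρ i)) ((Measure.pi ρ).prod (ρ i)) := by
  set μ := Measure.pi ρ
  have hT : Measurable fun p : (ι → α) × α => (Function.update p.1 i p.2, p.1 i) :=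
    measurable_update'.prodMk ((measurable_pi_apply i).comp measurable_fst)
  have hR : MeasurePreserving
      (Prod.map (fun p : (ι → α) × α => Function.update p.1 i p.2) (id : α → α))
      ((μ.prod (ρ i)).prod (ρ i)) (μ.prod (ρ i)) :=
    (measurePreserving_update ρ i).prod (MeasurePreserving.id _)
  have hswap : MeasurePreserving
      (fun p : ((ι → α) × α) × α => ((p.1.1, p.2), p.1.2))
      ((μ.prod (ρ i)).prod (ρ i)) ((μ.prod (ρ i)).prod (ρ i)) := by
    have h1 := measurePreserving_prodAssoc μ (ρ i) (ρ i)
    have h2 : MeasurePreserving (Prod.map (id : (ι → α) → _) (Prod.swap : α × α → α × α))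
        (μ.prod ((ρ i).prod (ρ i))) (μ.prod ((ρ i).prod (ρ i))) :=
      (MeasurePreserving.id _).prod Measure.measurePreserving_swap
    have h3 := (h1.symm).comp (h2.comp h1)
    exact h3
  refine ⟨hT, ?_⟩
  -- When the family is itself written as an update by an independent `i`-th coordinate, the
  -- exchange becomes the swap of two independent copies.
  have hcomp : (fun p : (ι → α) × α => (Function.update p.1 i p.2, p.1 i)) ∘
      (Prod.map (fun p : (ι → α) × α => Function.update p.1 i p.2) (id : α → α))
      = (Prod.map (fun p : (ι → α) × α => Function.update p.1 i p.2) (id : α → α)) ∘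
        (fun p : ((ι → α) × α) × α => ((p.1.1, p.2), p.1.2)) := by
    ext p <;> simp
  calc _ = Measure.map _ (Measure.map _ ((μ.prod (ρ i)).prod (ρ i))) := by rw [hR.map_eq]
    _ = _ := by
      rw [Measure.map_map hT hR.measurable, hcomp, ← Measure.map_map hR.measurable
        hswap.measurable, hswap.map_eq, hR.map_eq]

lemma integral_exchange (i : ι) {G : (ι → α) × α → ℝ} (hG : Measurable G) :
    ∫ p, G p ∂((Measure.pi ρ).prod (ρ i))
      = ∫ p, G (Function.update p.1 i p.2, p.1 i) ∂((Measure.pi ρ).prod (ρ i)) := by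
  have h := measurePreserving_exchange ρ i
  conv_lhs => rw [← h.map_eq]
  exact integral_map h.measurable.aemeasurable hG.aestronglyMeasurable

end Resample

/-! ### The expected prediction error of ridge regression -/

section Statistics

variable {d : ℕ}

/-- The law of a sample `(φ, r)` from a linear model with parameter `ω`. -/
structure IsLinearSample (ω : Vec d) (ρ : Measure (Vec d × ℝ)) : Prop where
  ae_good : ∀ᵐ z ∂ρ, z ∈ goodSample d
  noise : ∀ g : Vec d → ℝ, Measurable g → (∃ C, ∀ x, |g x| ≤ C) →
    ∫ z, (z.2 - inner ℝ ω z.1) * g z.1 ∂ρ = 0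

/-- The vector `∑ᵢ (rᵢ - ⟨ω, φᵢ⟩) φᵢ` after multiplication with the inverse Gram operator. -/
def noiseVec {ι : Type*} [Fintype ι] (ω : Vec d) (S : ι → Vec d × ℝ) : Vec d :=
  gramInv S (∑ i, ((S i).2 - inner ℝ ω (S i).1) • (S i).1)

variable {ι : Type*} [Fintype ι]

/-- Splitting each reward into mean and residual gives truth, regularization bias and noise. The
bias is `G⁻¹ω` because the regularizer in the Gram operator `G` is the identity. -/
lemma ridge_eq (ω : Vec d) (S : ι → Vec d × ℝ) :
    ridge S = ω - gramInv S ω + noiseVec ω S := by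
  have h : gram S (ridge S) = gram S (ω - gramInv S ω + noiseVec ω S) := by
    rw [gram_ridge, map_add, map_sub, gram_gramInv, noiseVec, gram_gramInv, gram_apply]
    simp only [sub_smul, Finset.sum_sub_distrib, real_inner_comm ω]
    abel
  have := congrArg (gramInv S) h
  rwa [gramInv_gram, gramInv_gram] at this

lemma continuous_noiseVec (ω : Vec d) : Continuous (noiseVec ω : (ι → Vec d × ℝ) → _) :=
  continuous_gramInv.clm_apply (by fun_prop)

/-- Independence of the rewards is what lets the noise of one sample be averaged out with the Gram
operator held fixed. -/
lemma gram_congr {S S' : ι → Vec d × ℝ} (h : ∀ i, (S i).1 = (S' i).1) : gram S = gram S' := by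
  simp only [gram, h]

lemma abs_inner_gramInv_le (S : ι → Vec d × ℝ) (i : ι) (ψ : Vec d) :
    |inner ℝ (S i).1 (gramInv S ψ)| ≤ ‖ψ‖ := by
  have h1 : (inner ℝ (S i).1 (gramInv S ψ) : ℝ) ^ 2 ≤ ‖ψ‖ ^ 2 :=
    (Finset.single_le_sum (f := fun i => (inner ℝ (S i).1 (gramInv S ψ) : ℝ) ^ 2)
      (fun j _ => sq_nonneg _) (Finset.mem_univ i)).trans
      ((sum_inner_gramInv_sq_le S ψ).trans (leverage_le S ψ))
  exact abs_le_of_sq_le_sq h1 (norm_nonneg _)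

lemma abs_residual_le {ω : Vec d} (hω : ‖ω‖ ≤ 1) {z : Vec d × ℝ} (hz : z ∈ goodSample d) :
    |z.2 - inner ℝ ω z.1| ≤ 2 := by
  have h := (abs_real_inner_le_norm ω z.1).trans
    (mul_le_one₀ hω (norm_nonneg _) hz.1)
  rw [abs_le] at *
  constructor <;> linarith [hz.2.1, hz.2.2, h.1, h.2]

variable {ω : Vec d} {ρ : ι → Measure (Vec d × ℝ)}
  [∀ i, IsProbabilityMeasure (ρ i)]

lemma ae_pi_good (hρ : ∀ i, IsLinearSample ω (ρ i)) :
    ∀ᵐ S ∂(Measure.pi ρ), ∀ i, S i ∈ goodSample d := by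
  rw [ae_all_iff]
  exact fun i => (Measure.quasiMeasurePreserving_eval ρ i).ae (hρ i).ae_good

lemma ae_prod_good (hρ : ∀ i, IsLinearSample ω (ρ i)) (i : ι) :
    ∀ᵐ p ∂((Measure.pi ρ).prod (ρ i)), (∀ j, p.1 j ∈ goodSample d) ∧ p.2 ∈ goodSample d :=
  (Measure.quasiMeasurePreserving_fst.ae (ae_pi_good hρ)).and
    (Measure.quasiMeasurePreserving_snd.ae (hρ i).ae_good)

variable [DecidableEq ι]

/-- With all samples but the `i`-th fixed, everything except the `i`-th residual is a function of
the `i`-th feature alone, so `IsLinearSample.noise` applies. -/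
lemma integral_noise_cross (hρ : ∀ i, IsLinearSample ω (ρ i)) (hω : ‖ω‖ ≤ 1) (ψ : Vec d) {i j : ι}
    (hij : i ≠ j) :
    ∫ S, (((S i).2 - inner ℝ ω (S i).1) * inner ℝ (S i).1 (gramInv S ψ))
      * (((S j).2 - inner ℝ ω (S j).1) * inner ℝ (S j).1 (gramInv S ψ)) ∂(Measure.pi ρ) = 0 := by
  have hB : Continuous fun S : ι → Vec d × ℝ => gramInv S ψ :=
    continuous_gramInv.clm_apply continuous_const
  set F : (ι → Vec d × ℝ) → ℝ := fun S =>
    (((S i).2 - inner ℝ ω (S i).1) * inner ℝ (S i).1 (gramInv S ψ))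
      * (((S j).2 - inner ℝ ω (S j).1) * inner ℝ (S j).1 (gramInv S ψ)) with hF
  have hFc : Continuous F := by fun_prop
  have hFi : Integrable F (Measure.pi ρ) := by
    refine Integrable.of_bound hFc.aestronglyMeasurable ((2 * ‖ψ‖) * (2 * ‖ψ‖)) ?_
    filter_upwards [ae_pi_good hρ] with S hS
    rw [hF, Real.norm_eq_abs, abs_mul, abs_mul, abs_mul]
    have := abs_residual_le hω (hS i)
    have := abs_residual_le hω (hS j)
    have := abs_inner_gramInv_le S i ψ
    have := abs_inner_gramInv_le S j ψ
    gcongr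
  have hmp := measurePreserving_update ρ i
  have hFi' : Integrable (fun p : (ι → Vec d × ℝ) × (Vec d × ℝ) => F (Function.update p.1 i p.2))
      ((Measure.pi ρ).prod (ρ i)) := hmp.integrable_comp_of_integrable hFi
  change ∫ S, F S ∂(Measure.pi ρ) = 0
  rw [← hmp.map_eq, integral_map hmp.measurable.aemeasurable hFc.aestronglyMeasurable,
    integral_prod _ hFi']
  refine integral_eq_zero_of_ae (ae_of_all _ fun S => ?_)
  set S' : Vec d → ι → Vec d × ℝ := fun φ => Function.update S i (φ, 0) with hS'
  have hS'c : Continuous S' := by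
    rw [hS']; fun_prop
  have hB' : Continuous fun φ => gramInv (S' φ) ψ := hB.comp hS'c
  have key := (hρ i).noise (fun φ => inner ℝ φ (gramInv (S' φ) ψ)
    * (((S j).2 - inner ℝ ω (S j).1) * inner ℝ (S j).1 (gramInv (S' φ) ψ)))
    (Continuous.measurable (by fun_prop))
    ⟨‖ψ‖ * (|(S j).2 - inner ℝ ω (S j).1| * ‖ψ‖), fun φ => by
      rw [abs_mul, abs_mul]
      have h1 : |inner ℝ φ (gramInv (S' φ) ψ)| ≤ ‖ψ‖ := by
        have := abs_inner_gramInv_le (S' φ) i ψ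
        simpa [hS'] using this
      have h2 : |inner ℝ (S j).1 (gramInv (S' φ) ψ)| ≤ ‖ψ‖ := by
        have := abs_inner_gramInv_le (S' φ) j ψ
        simpa [hS', Function.update_of_ne hij.symm] using this
      gcongr⟩
  refine Eq.trans ?_ key
  refine integral_congr_ae (ae_of_all _ fun z => ?_)
  have hg : gramInv (Function.update S i z) = gramInv (S' z.1) := by
    rw [gramInv, gramInv, gram_congr]
    intro k
    rcases eq_or_ne k i with rfl | hk
    · simp [hS']
    · simp [hS', Function.update_of_ne hk]
  simp only [hF, Function.update_self, Function.update_of_ne hij.symm, hg]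
  ring

/-- The noise part of the ridge estimate is, on average, at most the leverage. -/
lemma integral_inner_noiseVec_sq_le (hρ : ∀ i, IsLinearSample ω (ρ i)) (hω : ‖ω‖ ≤ 1)
    (ψ : Vec d) :
    ∫ S, (inner ℝ (noiseVec ω S) ψ : ℝ) ^ 2 ∂(Measure.pi ρ)
      ≤ 4 * ∫ S, leverage S ψ ∂(Measure.pi ρ) := by
  have hB : Continuous fun S : ι → Vec d × ℝ => gramInv S ψ :=
    continuous_gramInv.clm_apply continuous_const
  set f : ι → (ι → Vec d × ℝ) → ℝ := fun i S =>
    ((S i).2 - inner ℝ ω (S i).1) * inner ℝ (S i).1 (gramInv S ψ) with hf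
  have hfc : ∀ i, Continuous (f i) := fun i => by simp only [hf]; fun_prop
  have hsum : ∀ S, (inner ℝ (noiseVec ω S) ψ : ℝ) = ∑ i, f i S := fun S => by
    rw [noiseVec, inner_gramInv_comm, sum_inner]
    simp [hf, inner_smul_left]
  have hi : ∀ i j, Integrable (fun S => f i S * f j S) (Measure.pi ρ) := fun i j => by
    refine Integrable.of_bound ((hfc i).mul (hfc j)).aestronglyMeasurable
      ((2 * ‖ψ‖) * (2 * ‖ψ‖)) ?_
    filter_upwards [ae_pi_good hρ] with S hS
    rw [Real.norm_eq_abs, abs_mul, hf, abs_mul, abs_mul]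
    have := abs_residual_le hω (hS i)
    have := abs_residual_le hω (hS j)
    have := abs_inner_gramInv_le S i ψ
    have := abs_inner_gramInv_le S j ψ
    gcongr
  have hlev : Integrable (fun S : ι → Vec d × ℝ => leverage S ψ) (Measure.pi ρ) := by
    refine Integrable.of_bound (continuous_leverage.comp
      (Continuous.prodMk continuous_id continuous_const)).aestronglyMeasurable (‖ψ‖ ^ 2)
      (ae_of_all _ fun S => ?_)
    rw [Real.norm_eq_abs, abs_of_nonneg (leverage_nonneg S ψ)]
    exact leverage_le S ψ
  calc ∫ S, (inner ℝ (noiseVec ω S) ψ : ℝ) ^ 2 ∂(Measure.pi ρ)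
      = ∑ i, ∑ j, ∫ S, f i S * f j S ∂(Measure.pi ρ) := by
        simp_rw [hsum, sq, Finset.sum_mul_sum]
        rw [integral_finsetSum _ fun i _ => integrable_finsetSum _ fun j _ => hi i j]
        exact Finset.sum_congr rfl fun i _ => integral_finsetSum _ fun j _ => hi i j
    _ = ∑ i, ∫ S, f i S * f i S ∂(Measure.pi ρ) := by
        refine Finset.sum_congr rfl fun i _ => Finset.sum_eq_single i (fun j _ hj => ?_) (by simp)
        exact integral_noise_cross hρ hω ψ hj.symm
    _ = ∫ S, ∑ i, f i S * f i S ∂(Measure.pi ρ) := (integral_finsetSum _ fun i _ => hi i i).symm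
    _ ≤ ∫ S, 4 * leverage S ψ ∂(Measure.pi ρ) := by
        refine integral_mono_ae (integrable_finsetSum _ fun i _ => hi i i) (hlev.const_mul 4) ?_
        filter_upwards [ae_pi_good hρ] with S hS
        calc ∑ i, f i S * f i S ≤ ∑ i, 4 * (inner ℝ (S i).1 (gramInv S ψ) : ℝ) ^ 2 := by
              refine Finset.sum_le_sum fun i _ => ?_
              have h1 := abs_residual_le hω (hS i)
              have h2 : ((S i).2 - inner ℝ ω (S i).1) ^ 2 ≤ 4 := by
                rw [← sq_abs]; nlinarith [abs_nonneg ((S i).2 - inner ℝ ω (S i).1)]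
              calc f i S * f i S = ((S i).2 - inner ℝ ω (S i).1) ^ 2
                    * (inner ℝ (S i).1 (gramInv S ψ) : ℝ) ^ 2 := by simp only [hf]; ring
                _ ≤ _ := mul_le_mul_of_nonneg_right h2 (sq_nonneg _)
          _ ≤ 4 * leverage S ψ := by
              rw [← Finset.mul_sum]
              exact mul_le_mul_of_nonneg_left (sum_inner_gramInv_sq_le S ψ) (by norm_num)
    _ = _ := integral_const_mul _ _

end Statistics

/-! ### Out-of-sample error by exchange with a fresh sample. -/

section PredictionError

variable {d : ℕ} {ι : Type*} [Fintype ι] {ω : Vec d} {ρ : ι → Measure (Vec d × ℝ)}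
  [∀ i, IsProbabilityMeasure (ρ i)]

lemma integrable_of_bound_good (hρ : ∀ i, IsLinearSample ω (ρ i)) {f : (ι → Vec d × ℝ) → ℝ}
    (hf : Measurable f) (C : ℝ) (h : ∀ S, (∀ i, S i ∈ goodSample d) → |f S| ≤ C) :
    Integrable f (Measure.pi ρ) :=
  Integrable.of_bound hf.aestronglyMeasurable C (by
    filter_upwards [ae_pi_good hρ] with S hS using h S hS)

lemma integrable_prod_of_bound_good (hρ : ∀ i, IsLinearSample ω (ρ i)) (i : ι)
    {f : (ι → Vec d × ℝ) × (Vec d × ℝ) → ℝ} (hf : Measurable f) (C : ℝ)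
    (h : ∀ S z, (∀ i, S i ∈ goodSample d) → z ∈ goodSample d → |f (S, z)| ≤ C) :
    Integrable f ((Measure.pi ρ).prod (ρ i)) :=
  Integrable.of_bound hf.aestronglyMeasurable C (by
    filter_upwards [ae_prod_good hρ i] with p hp using h p.1 p.2 hp.1 hp.2)

lemma norm_ridge_sq_le (hω : ‖ω‖ ≤ 1) (S : ι → Vec d × ℝ) :
    ‖ridge S‖ ^ 2 ≤ 8 + 2 * ‖noiseVec ω S‖ ^ 2 := by
  have h1 : ‖ridge S‖ ≤ 2 + ‖noiseVec ω S‖ := by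
    rw [ridge_eq ω S]
    refine (norm_add_le _ _).trans (add_le_add_left ((norm_sub_le _ _).trans ?_) _)
    linarith [norm_gramInv_le S ω]
  nlinarith [norm_nonneg (ridge S), norm_nonneg (noiseVec ω S), sq_nonneg (‖noiseVec ω S‖ - 2)]

lemma continuous_leverage_prod :
    Continuous fun p : (ι → Vec d × ℝ) × (Vec d × ℝ) => leverage p.1 p.2.1 :=
  continuous_leverage.comp (f := fun p : (ι → Vec d × ℝ) × (Vec d × ℝ) => (p.1, p.2.1))
    (by fun_prop)

lemma continuous_leverage_self (i : ι) :
    Continuous fun S : ι → Vec d × ℝ => leverage S (S i).1 :=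
  continuous_leverage.comp (f := fun S : ι → Vec d × ℝ => (S, (S i).1)) (by fun_prop)

lemma leverage_le_one (S : ι → Vec d × ℝ) {ψ : Vec d} (h : ‖ψ‖ ≤ 1) : leverage S ψ ≤ 1 :=
  (leverage_le S ψ).trans (pow_le_one₀ (norm_nonneg _) h)

variable [DecidableEq ι]

/-- Each basis direction contributes at most four times its leverage, which is at most `1`. Hence
the ridge estimate has mean squared norm of order `d`, whereas the deterministic bound
`norm_ridge_le` grows with the number of samples. -/
lemma integral_norm_noiseVec_sq_le (hρ : ∀ i, IsLinearSample ω (ρ i)) (hω : ‖ω‖ ≤ 1) :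
    Integrable (fun S => ‖noiseVec ω S‖ ^ 2) (Measure.pi ρ) ∧
    ∫ S, ‖noiseVec ω S‖ ^ 2 ∂(Measure.pi ρ) ≤ 4 * d := by
  let e := EuclideanSpace.basisFun (Fin d) ℝ
  have h1 : ∀ S : ι → Vec d × ℝ, ‖noiseVec ω S‖ ^ 2
      = ∑ k, (inner ℝ (noiseVec ω S) (e k) : ℝ) ^ 2 := fun S => by
    rw [← real_inner_self_eq_norm_sq, ← e.sum_inner_mul_inner]
    refine Finset.sum_congr rfl fun k _ => ?_
    rw [real_inner_comm (noiseVec ω S) (e k), sq]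
  have hi : ∀ k, Integrable (fun S => (inner ℝ (noiseVec ω S) (e k) : ℝ) ^ 2) (Measure.pi ρ) := by
    intro k
    refine integrable_of_bound_good hρ
      (((continuous_noiseVec ω).inner continuous_const).pow 2).measurable
      ((Fintype.card ι * 2) ^ 2) fun S hS => ?_
    rw [abs_of_nonneg (sq_nonneg _), ← sq_abs]
    refine pow_le_pow_left₀ (abs_nonneg _) ((abs_real_inner_le_norm _ _).trans ?_) 2
    rw [e.norm_eq_one, mul_one]
    refine (norm_gramInv_le _ _).trans ((norm_sum_le _ _).trans ?_)
    calc _ ≤ ∑ _i : ι, (2 : ℝ) := Finset.sum_le_sum fun i _ => by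
          rw [norm_smul, Real.norm_eq_abs]
          have := abs_residual_le hω (hS i)
          nlinarith [(hS i).1, norm_nonneg (S i).1,
            abs_nonneg ((S i).2 - inner ℝ ω (S i).1)]
      _ = _ := by simp
  simp_rw [h1]
  refine ⟨integrable_finsetSum _ fun k _ => hi k, ?_⟩
  rw [integral_finsetSum _ fun k _ => hi k]
  calc _ ≤ ∑ _k : Fin d, (4 : ℝ) := by
        refine Finset.sum_le_sum fun k _ => (integral_inner_noiseVec_sq_le hρ hω (e k)).trans ?_
        have : ∫ S, leverage S (e k) ∂(Measure.pi ρ) ≤ ∫ _S, (1 : ℝ) ∂(Measure.pi ρ) := by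
          refine integral_mono_of_nonneg (ae_of_all _ fun S => leverage_nonneg _ _)
            (integrable_const _) (ae_of_all _ fun S => leverage_le_one S (e.norm_eq_one k).le)
        simp only [integral_const, probReal_univ, smul_eq_mul, mul_one] at this
        linarith
    _ = _ := by simp [mul_comm]

/-- The leverage of a fresh sample, summed over the coordinates. -/
lemma sum_integral_leverage_le (hρ : ∀ i, IsLinearSample ω (ρ i)) :
    ∑ i, ∫ p, leverage p.1 p.2.1 ∂((Measure.pi ρ).prod (ρ i)) ≤ 2 * d := by
  have hi : ∀ i, Integrable (fun S => 2 * leverage S (S i).1) (Measure.pi ρ) := fun i =>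
    integrable_of_bound_good hρ (continuous_const.mul (continuous_leverage_self i)).measurable 2
      fun S hS => by
        rw [abs_of_nonneg (by linarith [leverage_nonneg S (S i).1])]
        linarith [leverage_le_one S (hS i).1]
  have h1 : ∀ i, ∫ p, leverage p.1 p.2.1 ∂((Measure.pi ρ).prod (ρ i))
      ≤ ∫ S, 2 * leverage S (S i).1 ∂(Measure.pi ρ) := fun i => by
    -- After the exchange the tested feature is the original `i`-th one while the Gram operator
    -- contains the fresh sample; undoing this replacement costs the factor `2`.
    rw [integral_exchange ρ i (G := fun p => leverage p.1 p.2.1) continuous_leverage_prod.measurable]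
    have h2 : ∫ S, 2 * leverage S (S i).1 ∂(Measure.pi ρ)
        = ∫ p, 2 * leverage p.1 (p.1 i).1 ∂((Measure.pi ρ).prod (ρ i)) := by
      rw [integral_prod _ ((hi i).comp_fst (ρ i))]
      simp
    rw [h2]
    refine integral_mono_of_nonneg (ae_of_all _ fun p => leverage_nonneg _ _)
      ((hi i).comp_fst (ρ i)) ?_
    filter_upwards [ae_prod_good hρ i] with p hp
    exact leverage_update_le (hp.1 i).1 _ _
  calc _ ≤ ∑ i, ∫ S, 2 * leverage S (S i).1 ∂(Measure.pi ρ) := Finset.sum_le_sum fun i _ => h1 i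
    _ = ∫ S, ∑ i, 2 * leverage S (S i).1 ∂(Measure.pi ρ) :=
        (integral_finsetSum _ fun i _ => hi i).symm
    _ ≤ ∫ _S, 2 * (d : ℝ) ∂(Measure.pi ρ) := by
        refine integral_mono (integrable_finsetSum _ fun i _ => hi i) (integrable_const _)
          fun S => ?_
        change ∑ i, 2 * leverage S (S i).1 ≤ 2 * (d : ℝ)
        rw [← Finset.mul_sum]
        linarith [sum_leverage_le S]
    _ = 2 * d := by simp

/-- The leverage of a fresh sample, weighted by the squared norm of the ridge estimate. -/
lemma sum_integral_norm_ridge_leverage_le (hρ : ∀ i, IsLinearSample ω (ρ i)) (hω : ‖ω‖ ≤ 1)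
    (hd : 1 ≤ d) :
    ∑ i, ∫ p, (1 + ‖ridge p.1‖ ^ 2) * leverage p.1 p.2.1 ∂((Measure.pi ρ).prod (ρ i))
      ≤ 612 * (d : ℝ) ^ 2 := by
  have hRc : Continuous fun S : ι → Vec d × ℝ => 1 + ‖ridge S‖ ^ 2 :=
    continuous_const.add (continuous_ridge.norm.pow 2)
  have hi : ∀ i, Integrable (fun S => 36 * ((1 + ‖ridge S‖ ^ 2) * leverage S (S i).1))
      (Measure.pi ρ) := fun i =>
    integrable_of_bound_good hρ
      (continuous_const.mul (hRc.mul (continuous_leverage_self i))).measurable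
      (36 * ((1 + (Fintype.card ι : ℝ) ^ 2) * 1)) fun S hS => by
        have h1 := leverage_nonneg S (S i).1
        rw [abs_of_nonneg (by positivity)]
        have h2 := norm_ridge_le hS
        have h3 := leverage_le_one S (hS i).1
        gcongr
  have h1 : ∀ i, ∫ p, (1 + ‖ridge p.1‖ ^ 2) * leverage p.1 p.2.1 ∂((Measure.pi ρ).prod (ρ i))
      ≤ ∫ S, 36 * ((1 + ‖ridge S‖ ^ 2) * leverage S (S i).1) ∂(Measure.pi ρ) := fun i => by
    rw [integral_exchange ρ i (G := fun p => (1 + ‖ridge p.1‖ ^ 2) * leverage p.1 p.2.1)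
      ((hRc.comp continuous_fst).mul continuous_leverage_prod).measurable]
    have h2 : ∫ S, 36 * ((1 + ‖ridge S‖ ^ 2) * leverage S (S i).1) ∂(Measure.pi ρ)
        = ∫ p, 36 * ((1 + ‖ridge p.1‖ ^ 2) * leverage p.1 (p.1 i).1)
          ∂((Measure.pi ρ).prod (ρ i)) := by
      rw [integral_prod _ ((hi i).comp_fst (ρ i))]
      simp
    rw [h2]
    refine integral_mono_of_nonneg (ae_of_all _ fun p =>
      mul_nonneg (by positivity) (leverage_nonneg _ _)) ((hi i).comp_fst (ρ i)) ?_
    filter_upwards [ae_prod_good hρ i] with p hp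
    have h3 := leverage_update_le (hp.1 i).1 p.2 (p.1 i).1
    have h4 := norm_ridge_update_le (hp.1 i) hp.2
    -- From `(2 + 3 r)² ≤ 8 + 18 r²`. Together with the factor `2` of the leverage this makes `36`.
    have h5 : 1 + ‖ridge (Function.update p.1 i p.2)‖ ^ 2 ≤ 18 * (1 + ‖ridge p.1‖ ^ 2) := by
      nlinarith [norm_nonneg (ridge (Function.update p.1 i p.2)), norm_nonneg (ridge p.1),
        sq_nonneg (3 * ‖ridge p.1‖ - 2)]
    calc _ ≤ (18 * (1 + ‖ridge p.1‖ ^ 2)) * (2 * leverage p.1 (p.1 i).1) :=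
          mul_le_mul h5 h3 (leverage_nonneg _ _) (by positivity)
      _ = _ := by ring
  obtain ⟨hNi, hN⟩ := integral_norm_noiseVec_sq_le hρ hω
  have hd' : (1 : ℝ) ≤ d := by exact_mod_cast hd
  calc _ ≤ ∑ i, ∫ S, 36 * ((1 + ‖ridge S‖ ^ 2) * leverage S (S i).1) ∂(Measure.pi ρ) :=
        Finset.sum_le_sum fun i _ => h1 i
    _ = ∫ S, ∑ i, 36 * ((1 + ‖ridge S‖ ^ 2) * leverage S (S i).1) ∂(Measure.pi ρ) :=
        (integral_finsetSum _ fun i _ => hi i).symm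
    _ ≤ ∫ S, 36 * d * (9 + 2 * ‖noiseVec ω S‖ ^ 2) ∂(Measure.pi ρ) := by
        refine integral_mono (integrable_finsetSum _ fun i _ => hi i)
          (((integrable_const _).add (hNi.const_mul 2)).const_mul _) fun S => ?_
        change ∑ i, 36 * ((1 + ‖ridge S‖ ^ 2) * leverage S (S i).1)
          ≤ 36 * d * (9 + 2 * ‖noiseVec ω S‖ ^ 2)
        rw [← Finset.mul_sum, ← Finset.mul_sum]
        calc _ ≤ 36 * ((9 + 2 * ‖noiseVec ω S‖ ^ 2) * d) := by
              refine mul_le_mul_of_nonneg_left (mul_le_mul ?_ (sum_leverage_le S)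
                (Finset.sum_nonneg fun i _ => leverage_nonneg _ _) (by positivity)) (by norm_num)
              linarith [norm_ridge_sq_le hω S]
          _ = _ := by ring
    _ = 36 * d * (9 + 2 * ∫ S, ‖noiseVec ω S‖ ^ 2 ∂(Measure.pi ρ)) := by
        rw [integral_const_mul, integral_add (integrable_const _) (hNi.const_mul 2),
          integral_const_mul]
        simp
    _ ≤ 36 * d * (9 + 2 * (4 * d)) := by gcongr
    _ ≤ _ := by nlinarith

/-- The expected prediction error of an approximate ridge regression estimate on independent,
not necessarily identically distributed samples, summed over the laws of the samples. -/
theorem sum_integral_prediction_error_le (hρ : ∀ i, IsLinearSample ω (ρ i)) (hω : ‖ω‖ ≤ 1)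
    (hd : 1 ≤ d) {c₀ : ℝ} (hc₀ : 0 ≤ c₀) {out : (ι → Vec d × ℝ) → Vec d} (hout : Measurable out)
    (happ : ∀ S, (∀ i, S i ∈ goodSample d) →
      inner ℝ (gram S (out S - ridge S)) (out S - ridge S) * d ≤ c₀ * (1 + ‖ridge S‖ ^ 2)) :
    (∀ i, Integrable (fun p : (ι → Vec d × ℝ) × (Vec d × ℝ) =>
      (inner ℝ (out p.1 - ω) p.2.1 : ℝ) ^ 2) ((Measure.pi ρ).prod (ρ i))) ∧
    ∑ i, ∫ p, (inner ℝ (out p.1 - ω) p.2.1 : ℝ) ^ 2 ∂((Measure.pi ρ).prod (ρ i))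
      ≤ (1224 * c₀ + 40) * d := by
  have hd' : (1 : ℝ) ≤ d := by exact_mod_cast hd
  have hd0 : (0 : ℝ) < d := by linarith
  -- The prediction error splits into optimization error, noise and bias. The first and the last are
  -- bounded pointwise by leverage, the noise only after integration.
  have hpt : ∀ S : ι → Vec d × ℝ, (∀ i, S i ∈ goodSample d) → ∀ ψ : Vec d,
      (inner ℝ (out S - ω) ψ : ℝ) ^ 2 ≤ 2 * (c₀ / d) * ((1 + ‖ridge S‖ ^ 2) * leverage S ψ)
        + 4 * (inner ℝ (noiseVec ω S) ψ : ℝ) ^ 2 + 4 * leverage S ψ := fun S hS ψ => by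
    have e1 : (inner ℝ (out S - ω) ψ : ℝ) = inner ℝ (out S - ridge S) ψ
        + inner ℝ (noiseVec ω S) ψ - inner ℝ (gramInv S ω) ψ := by
      rw [← inner_add_left, ← inner_sub_left]
      congr 1
      rw [ridge_eq ω S]; abel
    have h1 := inner_sq_le_leverage S (out S - ridge S) ψ
    have h2 : inner ℝ (gram S (out S - ridge S)) (out S - ridge S)
        ≤ c₀ / d * (1 + ‖ridge S‖ ^ 2) := by
      rw [div_mul_eq_mul_div, le_div_iff₀ hd0]; exact happ S hS
    have h3 : (inner ℝ (gramInv S ω) ψ : ℝ) ^ 2 ≤ leverage S ψ := by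
      have h4 := inner_sq_le_leverage S (gramInv S ω) ψ
      rw [← leverage_eq] at h4
      exact h4.trans (mul_le_of_le_one_left (leverage_nonneg _ _) (leverage_le_one S hω))
    have h5 := h1.trans (mul_le_mul_of_nonneg_right h2 (leverage_nonneg S ψ))
    rw [e1]
    nlinarith [sq_nonneg ((inner ℝ (out S - ridge S) ψ : ℝ)
        - (inner ℝ (noiseVec ω S) ψ - inner ℝ (gramInv S ω) ψ)),
      sq_nonneg ((inner ℝ (noiseVec ω S) ψ : ℝ) + inner ℝ (gramInv S ω) ψ)]
  have hm : Measurable fun p : (ι → Vec d × ℝ) × (Vec d × ℝ) =>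
      (inner ℝ (out p.1 - ω) p.2.1 : ℝ) ^ 2 :=
    (((hout.comp measurable_fst).sub_const ω).inner measurable_snd.fst).pow_const 2
  have hnm : Continuous fun p : (ι → Vec d × ℝ) × (Vec d × ℝ) =>
      (inner ℝ (noiseVec ω p.1) p.2.1 : ℝ) ^ 2 :=
    (((continuous_noiseVec ω).comp continuous_fst).inner continuous_snd.fst).pow 2
  have hRc : Continuous fun p : (ι → Vec d × ℝ) × (Vec d × ℝ) => 1 + ‖ridge p.1‖ ^ 2 :=
    continuous_const.add ((continuous_ridge.comp continuous_fst).norm.pow 2)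
  have hnb : ∀ S : ι → Vec d × ℝ, (∀ i, S i ∈ goodSample d) → ∀ z ∈ goodSample d,
      (inner ℝ (noiseVec ω S) z.1 : ℝ) ^ 2 ≤ (Fintype.card ι + 2) ^ 2 := fun S hS z hz => by
    rw [← sq_abs]
    refine pow_le_pow_left₀ (abs_nonneg _) ((abs_real_inner_le_norm _ _).trans ?_) 2
    have h1 : noiseVec ω S = ridge S - ω + gramInv S ω := by rw [ridge_eq ω S]; abel
    have h2 : ‖noiseVec ω S‖ ≤ Fintype.card ι + 2 := by
      rw [h1]
      have := norm_add_le (ridge S - ω) (gramInv S ω)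
      have := norm_sub_le (ridge S) ω
      have := norm_gramInv_le S ω
      have := norm_ridge_le hS
      linarith
    exact (mul_le_of_le_one_right (norm_nonneg _) hz.1).trans h2
  have hiL : ∀ i, Integrable (fun p : (ι → Vec d × ℝ) × (Vec d × ℝ) => leverage p.1 p.2.1)
      ((Measure.pi ρ).prod (ρ i)) := fun i =>
    integrable_prod_of_bound_good hρ i continuous_leverage_prod.measurable 1 fun S z _ hz => by
      rw [abs_of_nonneg (leverage_nonneg _ _)]; exact leverage_le_one S hz.1
  have hiN : ∀ i, Integrable (fun p : (ι → Vec d × ℝ) × (Vec d × ℝ) =>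
      (inner ℝ (noiseVec ω p.1) p.2.1 : ℝ) ^ 2) ((Measure.pi ρ).prod (ρ i)) := fun i =>
    integrable_prod_of_bound_good hρ i hnm.measurable ((Fintype.card ι + 2) ^ 2)
      fun S z hS hz => by
      rw [abs_of_nonneg (sq_nonneg _)]; exact hnb S hS z hz
  have hiR : ∀ i, Integrable (fun p : (ι → Vec d × ℝ) × (Vec d × ℝ) =>
      (1 + ‖ridge p.1‖ ^ 2) * leverage p.1 p.2.1) ((Measure.pi ρ).prod (ρ i)) := fun i =>
    integrable_prod_of_bound_good hρ i (hRc.mul continuous_leverage_prod).measurable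
      ((1 + (Fintype.card ι : ℝ) ^ 2) * 1) fun S z hS hz => by
      have h1 := leverage_nonneg S z.1
      rw [abs_of_nonneg (mul_nonneg (by positivity) h1)]
      have h2 := norm_ridge_le hS
      have h3 := leverage_le_one S hz.1
      gcongr
  have hiB : ∀ i, Integrable (fun p : (ι → Vec d × ℝ) × (Vec d × ℝ) =>
      2 * (c₀ / d) * ((1 + ‖ridge p.1‖ ^ 2) * leverage p.1 p.2.1)
        + 4 * (inner ℝ (noiseVec ω p.1) p.2.1 : ℝ) ^ 2 + 4 * leverage p.1 p.2.1)
      ((Measure.pi ρ).prod (ρ i)) := fun i =>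
    (((hiR i).const_mul _).add ((hiN i).const_mul 4)).add ((hiL i).const_mul 4)
  have hle : ∀ i, ∀ᵐ p ∂((Measure.pi ρ).prod (ρ i)), (inner ℝ (out p.1 - ω) p.2.1 : ℝ) ^ 2 ≤
      2 * (c₀ / d) * ((1 + ‖ridge p.1‖ ^ 2) * leverage p.1 p.2.1)
        + 4 * (inner ℝ (noiseVec ω p.1) p.2.1 : ℝ) ^ 2 + 4 * leverage p.1 p.2.1 := fun i => by
    filter_upwards [ae_prod_good hρ i] with p hp using hpt p.1 hp.1 p.2.1
  have hi : ∀ i, Integrable (fun p : (ι → Vec d × ℝ) × (Vec d × ℝ) =>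
      (inner ℝ (out p.1 - ω) p.2.1 : ℝ) ^ 2) ((Measure.pi ρ).prod (ρ i)) := fun i =>
    (hiB i).mono' hm.aestronglyMeasurable (by
      filter_upwards [hle i] with p hp
      rwa [Real.norm_eq_abs, abs_of_nonneg (sq_nonneg _)])
  refine ⟨hi, ?_⟩
  -- The samples are integrated first, with the fresh feature fixed, since the noise bound holds for
  -- a deterministic `ψ`. The `4 · 4` from the noise and the `4` from the bias give the factor `20`
  -- below.
  have hN : ∀ i, ∫ p, (inner ℝ (noiseVec ω p.1) p.2.1 : ℝ) ^ 2 ∂((Measure.pi ρ).prod (ρ i))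
      ≤ 4 * ∫ p, leverage p.1 p.2.1 ∂((Measure.pi ρ).prod (ρ i)) := fun i => by
    rw [integral_prod_symm _ (hiN i), integral_prod_symm _ (hiL i), ← integral_const_mul]
    exact integral_mono (hiN i).integral_prod_right ((hiL i).integral_prod_right.const_mul 4)
      fun z => integral_inner_noiseVec_sq_le hρ hω z.1
  have hone : ∀ i, ∫ p, (inner ℝ (out p.1 - ω) p.2.1 : ℝ) ^ 2 ∂((Measure.pi ρ).prod (ρ i))
      ≤ 2 * (c₀ / d) * ∫ p, (1 + ‖ridge p.1‖ ^ 2) * leverage p.1 p.2.1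
          ∂((Measure.pi ρ).prod (ρ i))
        + 20 * ∫ p, leverage p.1 p.2.1 ∂((Measure.pi ρ).prod (ρ i)) := fun i => by
    refine (integral_mono_ae (hi i) (hiB i) (hle i)).trans ?_
    have h1 := integral_add (((hiR i).const_mul (2 * (c₀ / d))).add ((hiN i).const_mul 4))
      ((hiL i).const_mul 4)
    simp only [Pi.add_apply] at h1
    rw [h1, integral_add ((hiR i).const_mul _) ((hiN i).const_mul 4), integral_const_mul,
      integral_const_mul, integral_const_mul]
    linarith [hN i]
  refine (Finset.sum_le_sum fun i _ => hone i).trans ?_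
  rw [Finset.sum_add_distrib, ← Finset.mul_sum, ← Finset.mul_sum]
  have h1 := mul_le_mul_of_nonneg_left (sum_integral_norm_ridge_leverage_le hρ hω hd)
    (show 0 ≤ 2 * (c₀ / d) by positivity)
  have h2 := sum_integral_leverage_le hρ
  have h3 : 2 * (c₀ / d) * (612 * (d : ℝ) ^ 2) = 1224 * c₀ * d := by field_simp; ring
  linarith

end PredictionError

/-! ### The output of the protocols -/

section Protocols

variable {M d E : ℕ}

/-- The protocol `P` measurably computes the ridge regression estimate up to an error which is
small in the norm of the Gram operator. -/
def FLProtocol.ApproxRidge (P : FLProtocol M d E) (c₀ : ℝ) : Prop :=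
  Measurable (fun S : Fin M × Fin E → Vec d × ℝ => P.run fun m i => S (m, i)) ∧
  ∀ S : Fin M × Fin E → Vec d × ℝ, (∀ j, S j ∈ goodSample d) →
    inner ℝ (gram S (P.run (fun m i => S (m, i)) - ridge S))
      (P.run (fun m i => S (m, i)) - ridge S) * d ≤ c₀ * (1 + ‖ridge S‖ ^ 2)

lemma directMethod_run (hM : 1 ≤ M) (hE : 1 ≤ E) (S : Fin M × Fin E → Vec d × ℝ) :
    (directMethod M d E).run (fun m i => S (m, i)) = ridge S := by
  set n : ℝ := (M : ℝ) * E with hn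
  have hn0 : 0 < n := by
    have : (1 : ℝ) ≤ M := by exact_mod_cast hM
    have : (1 : ℝ) ≤ E := by exact_mod_cast hE
    positivity
  set A : Matrix (Fin d) (Fin d) ℝ :=
    Matrix.of (fun j k => (1 / n) * ∑ m, ∑ i, (S (m, i)).1 j * (S (m, i)).1 k)
      + ridgeParam M E • 1 with hA
  set b : Fin d → ℝ := fun j => (1 / n) * ∑ m, ∑ i, (S (m, i)).2 * (S (m, i)).1 j with hb
  have hrun : (directMethod M d E).run (fun m i => S (m, i)) = WithLp.toLp 2 (A⁻¹.mulVec b) := rfl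
  -- Because the regularization is `1 / n`, the server's matrix is the Gram operator divided by `n`;
  -- its invertibility and its solution are read off from `gram`.
  have hAx : ∀ v : Vec d, A.mulVec v.ofLp = (1 / n) • (gram S v).ofLp := fun v => by
    ext j
    have h1 : (gram S v).ofLp j = v j + ∑ i, inner ℝ (S i).1 v * (S i).1 j := by
      rw [gram_apply]; simp
    rw [Pi.smul_apply, h1, hA, Matrix.add_mulVec, Matrix.smul_mulVec, Matrix.one_mulVec,
      Pi.add_apply, Pi.smul_apply, Fintype.sum_prod_type]
    have h2 : (Matrix.of (fun j k => (1 / n) * ∑ m, ∑ i, (S (m, i)).1 j * (S (m, i)).1 k)).mulVec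
        v.ofLp j = (1 / n) * ∑ m, ∑ i, inner ℝ (S (m, i)).1 v * (S (m, i)).1 j := by
      simp only [Matrix.mulVec, dotProduct, Matrix.of_apply, mul_assoc]
      rw [← Finset.mul_sum]
      congr 1
      simp only [Finset.sum_mul]
      rw [Finset.sum_comm]
      refine Finset.sum_congr rfl fun m _ => ?_
      rw [Finset.sum_comm]
      refine Finset.sum_congr rfl fun i _ => ?_
      rw [PiLp.inner_apply, Finset.sum_mul]
      refine Finset.sum_congr rfl fun k _ => ?_
      simp; ring
    rw [h2, ridgeParam]
    simp only [smul_eq_mul]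
    ring
  have hunit : IsUnit A := by
    rw [← Matrix.mulVec_injective_iff_isUnit]
    intro v w hvw
    have h3 := hAx (WithLp.toLp 2 (v - w))
    rw [show A.mulVec (WithLp.toLp 2 (v - w)).ofLp = 0 by
      change A.mulVec (v - w) = 0
      rw [Matrix.mulVec_sub]; exact sub_eq_zero.2 hvw] at h3
    have h4 : gram S (WithLp.toLp 2 (v - w)) = 0 := by
      have h5 : (gram S (WithLp.toLp 2 (v - w))).ofLp = 0 :=
        (smul_eq_zero.1 h3.symm).resolve_left (by positivity)
      ext j; exact congrFun h5 j
    have h5 := gramInv_gram S (WithLp.toLp 2 (v - w))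
    rw [h4, map_zero] at h5
    have h6 : v - w = 0 := by
      funext j; exact (congrArg (fun u : Vec d => u j) h5).symm
    exact sub_eq_zero.1 h6
  have hg : gram S (WithLp.toLp 2 (A⁻¹.mulVec b)) = ∑ i, (S i).2 • (S i).1 := by
    have h3 := hAx (WithLp.toLp 2 (A⁻¹.mulVec b))
    change A.mulVec (A⁻¹.mulVec b) = _ at h3
    rw [Matrix.mulVec_mulVec, Matrix.mul_nonsing_inv _ ((Matrix.isUnit_iff_isUnit_det A).1 hunit),
      Matrix.one_mulVec] at h3
    ext j
    have h4 := congrFun h3 j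
    rw [Pi.smul_apply, smul_eq_mul, hb] at h4
    have h5 := mul_left_cancel₀ (show (1 / n) ≠ 0 by positivity) h4
    rw [← h5, ← Fintype.sum_prod_type (f := fun i => (S i).2 * (S i).1 j)]
    simp
  rw [hrun, ← gramInv_gram S (WithLp.toLp 2 (A⁻¹.mulVec b)), hg, ridge]

lemma directMethod_approxRidge (hM : 1 ≤ M) (hE : 1 ≤ E) {c₀ : ℝ} (hc₀ : 0 ≤ c₀) :
    (directMethod M d E).ApproxRidge c₀ := by
  constructor
  · simp_rw [directMethod_run hM hE]
    exact continuous_ridge.measurable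
  · intro S _
    rw [directMethod_run hM hE]
    simp only [sub_self, inner_zero_right, zero_mul]
    positivity

lemma gradient_localLoss (lam : ℝ) (hE : 1 ≤ E) (S : LocalData d E) (y : Vec d) :
    gradient (localLoss lam S) y
      = (2 / (E : ℝ)) • ∑ i, (inner ℝ y (S i).1 - (S i).2) • (S i).1 + (2 * lam) • y := by
  have hE0 : (E : ℝ) ≠ 0 := by positivity
  refine HasGradientAt.gradient ?_
  rw [hasGradientAt_iff_hasFDerivAt]
  have h1 : ∀ i, HasFDerivAt (fun θ : Vec d => (inner ℝ θ (S i).1 - (S i).2) ^ 2 + lam * ‖θ‖ ^ 2)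
      ((2 * (inner ℝ y (S i).1 - (S i).2)) • innerSL ℝ (S i).1 + lam • (2 • innerSL ℝ y)) y := by
    intro i
    have h2 : HasFDerivAt (fun θ : Vec d => (inner ℝ θ (S i).1 : ℝ) - (S i).2)
        (innerSL ℝ (S i).1) y := by
      have := ((innerSL ℝ (S i).1).hasFDerivAt (x := y)).sub_const (S i).2
      refine this.congr_of_eventuallyEq (Filter.Eventually.of_forall fun θ => ?_)
      change _ = inner ℝ (S i).1 θ - _
      rw [real_inner_comm]
    have h3 := h2.pow 2
    have h4 := ((hasStrictFDerivAt_norm_sq y).hasFDerivAt).const_mul lam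
    refine (h3.add h4).congr_fderiv ?_
    ext v
    simp
  have h5 := (HasFDerivAt.fun_sum fun i (_ : i ∈ Finset.univ) => h1 i).const_mul (1 / (E : ℝ))
  refine h5.congr_fderiv ?_
  ext v
  simp only [smul_apply, add_apply,
    InnerProductSpace.toDual_apply_apply, inner_add_left, inner_smul_left, sum_inner,
    Finset.sum_add_distrib, Finset.sum_const, Finset.card_univ, Fintype.card_fin]
  simp [mul_assoc, ← Finset.mul_sum]
  field_simp

/-- The average of the gradients of the local losses. -/
lemma average_gradient_localLoss (hM : 1 ≤ M) (hE : 1 ≤ E) (S : Fin M × Fin E → Vec d × ℝ)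
    (y : Vec d) :
    (1 / (M : ℝ)) • ∑ m, gradient (localLoss (ridgeParam M E) fun i => S (m, i)) y
      = (2 * ridgeParam M E) • (gram S (y - ridge S)) := by
  have hM0 : (M : ℝ) ≠ 0 := by positivity
  have hE0 : (E : ℝ) ≠ 0 := by positivity
  rw [map_sub, gram_ridge, gram_apply, Finset.sum_congr rfl fun m _ =>
    gradient_localLoss (ridgeParam M E) hE (fun i => S (m, i)) y]
  rw [Finset.sum_add_distrib, ← Finset.smul_sum, Finset.sum_const, Finset.card_univ,
    Fintype.card_fin, add_sub_assoc, ← Finset.sum_sub_distrib, Fintype.sum_prod_type,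
    ← Nat.cast_smul_eq_nsmul ℝ, smul_add, smul_smul, smul_smul, smul_smul, smul_add, add_comm]
  congr 1
  · congr 1; field_simp
  · congr 1
    · rw [ridgeParam]; field_simp
    · refine Finset.sum_congr rfl fun m _ => Finset.sum_congr rfl fun i _ => ?_
      rw [← sub_smul, real_inner_comm]

/-- The iterates `(xₖ, yₖ)` of the accelerated method for the ridge regression objective. -/
def agdIter {ι : Type*} [Fintype ι] (lam : ℝ) (S : ι → Vec d × ℝ) : ℕ → Vec d × Vec d
  | 0 => (0, 0)
  | k + 1 =>
    let q := lam / (1 + lam)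
    let s := agdIter lam S k
    let a := coeffSeq q (k + 1)
    let x' := s.2 - (1 / (2 * (1 + lam))) • ((2 * lam) • gram S (s.2 - ridge S))
    (x', x' + (a * (1 - a) / (a ^ 2 + coeffSeq q (k + 2))) • (x' - s.1))

/-- The averaged gradient is that of the global objective. The coefficient index is shifted by one
because `init` already applies `nesterovCoeff` to `1`. -/
lemma distributedAGD_stateAfter (ρ : ℕ) (hM : 1 ≤ M) (hE : 1 ≤ E)
    (S : Fin M × Fin E → Vec d × ℝ) (k : ℕ) :
    (distributedAGD ρ M d E).stateAfter (fun m i => S (m, i)) k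
      = ((agdIter (ridgeParam M E) S k).1, (agdIter (ridgeParam M E) S k).2,
        coeffSeq (ridgeParam M E / (1 + ridgeParam M E)) (k + 1)) := by
  induction k with
  | zero => rfl
  | succ k ih =>
    set lam := ridgeParam M E
    set s := agdIter lam S k with hs
    set a := coeffSeq (lam / (1 + lam)) (k + 1) with ha
    set x₁ := s.2 - (1 / (2 * (1 + lam))) • ((1 / (M : ℝ)) • ∑ m,
      gradient (localLoss lam fun i => S (m, i)) s.2) with hx₁
    have hx : x₁ = (agdIter lam S (k + 1)).1 := by
      rw [hx₁, average_gradient_localLoss hM hE]; rfl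
    have h2 : (agdIter lam S (k + 1)).2 = x₁ + (a * (1 - a) / (a ^ 2 + nesterovCoeff
        (lam / (1 + lam)) a)) • (x₁ - s.1) := by
      rw [hx]; rfl
    rw [h2, ← hx, FLProtocol.stateAfter, ih]
    rfl

lemma continuous_agdIter {ι : Type*} [Fintype ι] (lam : ℝ) (k : ℕ) :
    Continuous fun S : ι → Vec d × ℝ => agdIter lam S k := by
  induction k with
  | zero => exact continuous_const
  | succ k ih =>
    have h1 := ih.fst
    have h2 := ih.snd
    have hg : Continuous fun S : ι → Vec d × ℝ => gram S ((agdIter lam S k).2 - ridge S) :=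
      continuous_gram.clm_apply (Continuous.fun_sub h2 continuous_ridge)
    have hx : Continuous fun S : ι → Vec d × ℝ => (agdIter lam S k).2
        - (1 / (2 * (1 + lam))) • ((2 * lam) • gram S ((agdIter lam S k).2 - ridge S)) := by
      fun_prop
    exact hx.prodMk (by fun_prop)

lemma inner_gram_add (S : Fin M × Fin E → Vec d × ℝ) (u v : Vec d) :
    inner ℝ (gram S (u + v)) (u + v)
      = inner ℝ (gram S u) u + 2 * inner ℝ (gram S u) v + inner ℝ (gram S v) v := by
  rw [map_add, inner_add_left, inner_add_right, inner_add_right, inner_gram_comm S v u,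
    real_inner_comm (gram S u) v]
  ring

lemma inner_gram_self_le {S : Fin M × Fin E → Vec d × ℝ} (hS : ∀ j, S j ∈ goodSample d)
    (v : Vec d) : inner ℝ (gram S v) v ≤ (1 + (M : ℝ) * E) * ‖v‖ ^ 2 := by
  rw [inner_gram_self]
  have : ∑ i, (inner ℝ (S i).1 v : ℝ) ^ 2 ≤ ∑ _i : Fin M × Fin E, ‖v‖ ^ 2 := by
    refine Finset.sum_le_sum fun i _ => ?_
    rw [← sq_abs]
    exact pow_le_pow_left₀ (abs_nonneg _) ((abs_real_inner_le_norm _ _).trans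
      (mul_le_of_le_one_left (norm_nonneg _) (hS i).1)) 2
  simp only [Finset.sum_const, Finset.card_univ, Fintype.card_prod, Fintype.card_fin,
    nsmul_eq_mul, Nat.cast_mul] at this
  linarith

/-- The excess of the ridge objective over its minimum is `λ` times the energy of the parameter
error. It is `2 λ`-strongly convex since the Gram operator dominates the identity, and `2 (1 +
λ)`-smooth since `λ (1 + n) = 1 + λ`, so `nesterov_step` can be iterated. -/
lemma agdIter_error (hM : 1 ≤ M) (hE : 1 ≤ E) {S : Fin M × Fin E → Vec d × ℝ}
    (hS : ∀ j, S j ∈ goodSample d) (k : ℕ) :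
    let lam := ridgeParam M E
    lam * inner ℝ (gram S ((agdIter lam S k).1 - ridge S)) ((agdIter lam S k).1 - ridge S)
      ≤ rateSeq (lam / (1 + lam)) k * (2 * (1 + lam) * ‖ridge S‖ ^ 2) := by
  intro lam
  have hn : 0 < (M : ℝ) * E := by positivity
  have hlam : lam = 1 / ((M : ℝ) * E) := rfl
  have hlam0 : 0 < lam := by rw [hlam]; positivity
  have hlamn : lam * (1 + (M : ℝ) * E) = 1 + lam := by rw [hlam]; field_simp; ring
  set q := lam / (1 + lam) with hq
  have hq0 : 0 < q := by positivity
  have hq1 : q < 1 := by rw [hq, div_lt_one (by positivity)]; linarith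
  set L := 2 * (1 + lam) with hL
  have hL0 : 0 < L := by positivity
  have hqL : q * L / 2 = lam := by rw [hq, hL]; field_simp
  set z := ridge S with hz
  set F : Vec d → ℝ := fun x => lam * inner ℝ (gram S (x - z)) (x - z) with hF
  have hup : ∀ v, lam * inner ℝ (gram S v) v ≤ L / 2 * ‖v‖ ^ 2 := fun v => by
    have := mul_le_mul_of_nonneg_left (inner_gram_self_le hS v) hlam0.le
    rw [← mul_assoc, hlamn] at this
    rw [hL]; linarith
  have hFexp : ∀ x y, F x = F y + inner ℝ ((2 * lam) • gram S (y - z)) (x - y)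
      + lam * inner ℝ (gram S (x - y)) (x - y) := fun x y => by
    simp only [hF]
    rw [show x - z = (y - z) + (x - y) by abel, inner_gram_add, inner_smul_left]
    simp only [conj_trivial]; ring
  have main : ∃ v : Vec d,
      (coeffSeq q (k + 1) + coeffSeq q k ^ 2) • (agdIter lam S k).2
        = coeffSeq q k ^ 2 • v + coeffSeq q (k + 1) • (agdIter lam S k).1 ∧
      F (agdIter lam S k).1 - F z + L * coeffSeq q k ^ 2 / 2 * ‖v - z‖ ^ 2
        ≤ rateSeq q k * (L * ‖z‖ ^ 2) := by
    induction k with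
    | zero =>
      -- The momentum point starts at `0`. Smoothness bounds the excess at `0` by `L / 2 * ‖z‖²`,
      -- and the distance term is another `L / 2 * ‖z‖²`.
      refine ⟨0, by simp [agdIter], ?_⟩
      have h0 : (agdIter lam S 0).1 = 0 := rfl
      have h1 := hup (0 - z)
      rw [h0]
      simp only [hF, rateSeq, coeffSeq, sub_self, map_zero, inner_zero_left, mul_zero, zero_sub,
        norm_neg] at h1 ⊢
      linarith
    | succ k ih =>
      obtain ⟨v, hv1, hv2⟩ := ih
      set x := (agdIter lam S k).1
      set y := (agdIter lam S k).2
      set a := coeffSeq q k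
      set α := coeffSeq q (k + 1) with hα
      have hα0 : 0 < α := (coeffSeq_spec hq0 hq1 (k + 1)).1
      have hα1 : α < 1 := coeffSeq_succ_lt_one hq0 hq1 k
      have hx' : (agdIter lam S (k + 1)).1 = y - (1 / L) • ((2 * lam) • gram S (y - z)) := rfl
      set x' := (agdIter lam S (k + 1)).1
      have hy' : (agdIter lam S (k + 1)).2
        = x' + (α * (1 - α) / (α ^ 2 + coeffSeq q (k + 2))) • (x' - x) := rfl
      refine ⟨x + (1 / α) • (x' - x), ?_, ?_⟩
      · rw [hy']
        exact nesterov_extrapolation hα0 (coeffSeq_spec hq0 hq1 (k + 2)).1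
      · set g := (2 * lam) • gram S (y - z) with hg
        have hstep := nesterov_step (F := F) (L := L) (q := q) (a := a) (α := α) (x := x) (v := v)
          (y := y) (g := g) (z := z) hL0 hα0 hα1.le hq0.le (nesterovCoeff_eq q a) hv1
          (by
            rw [hFexp (y - (1 / L) • g) y]
            have h1 := hup (y - (1 / L) • g - y)
            have h2 : y - (1 / L) • g - y = -((1 / L) • g) := by abel
            rw [h2] at h1 ⊢
            rw [norm_neg, norm_smul, mul_pow, Real.norm_eq_abs, sq_abs] at h1
            rw [← hg, inner_neg_right, inner_smul_right, real_inner_self_eq_norm_sq]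
            have h3 : L / 2 * ((1 / L) ^ 2 * ‖g‖ ^ 2) = ‖g‖ ^ 2 / (2 * L) := by field_simp
            have h4 : 1 / L * ‖g‖ ^ 2 = 2 * (‖g‖ ^ 2 / (2 * L)) := by field_simp
            rw [h3] at h1
            linarith)
          (by
            rw [hFexp x y]
            have := mul_nonneg hlam0.le
              ((sq_nonneg _).trans (norm_sq_le_inner_gram S (x - y)))
            linarith)
          (by
            rw [hFexp z y, hqL]
            have := mul_le_mul_of_nonneg_left (norm_sq_le_inner_gram S (z - y)) hlam0.le
            linarith)
        rw [← hx'] at hstep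
        refine hstep.trans ?_
        exact (mul_le_mul_of_nonneg_left hv2 (sub_nonneg.2 hα1.le)).trans_eq
          (mul_assoc _ _ _).symm
  obtain ⟨v, -, hv⟩ := main
  have h1 : F z = 0 := by simp [hF]
  have h2 : 0 ≤ L * coeffSeq q k ^ 2 / 2 * ‖v - z‖ ^ 2 := by positivity
  have h3 : F (agdIter lam S k).1 ≤ rateSeq q k * (L * ‖z‖ ^ 2) := by linarith
  exact h3

/-- The number of rounds of the accelerated method for `n` samples in dimension `d`. -/
def agdRounds (n d : ℕ) : ℕ := ⌈Real.sqrt n⌉₊ + ⌈Real.sqrt (n + 1) * Real.log d⌉₊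

/-- The first `⌈√n⌉` rounds give `4 / n` by the sublinear rate. The remaining rounds contract by `1
- 1 / √(n + 1)` each, hence by `exp (-log d)` in total. -/
lemma rateSeq_agdRounds_le {n d : ℕ} (hn : 1 ≤ n) (hd : 1 ≤ d) :
    rateSeq (1 / ((n : ℝ) + 1)) (agdRounds n d) ≤ 4 / (n * d) := by
  have hn0 : (1 : ℝ) ≤ n := by exact_mod_cast hn
  have hd0 : (1 : ℝ) ≤ d := by exact_mod_cast hd
  have hq0 : 0 < 1 / ((n : ℝ) + 1) := by positivity
  have hq1 : 1 / ((n : ℝ) + 1) < 1 := by rw [div_lt_one (by positivity)]; linarith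
  set q := 1 / ((n : ℝ) + 1) with hq
  set j := ⌈Real.sqrt (n + 1) * Real.log d⌉₊ with hj
  have h1 : rateSeq q ⌈Real.sqrt n⌉₊ ≤ 4 / n := by
    refine (rateSeq_le_sublinear hq0 hq1 _).trans ?_
    have h2 : Real.sqrt n ≤ (⌈Real.sqrt n⌉₊ : ℝ) + 2 := (Nat.le_ceil _).trans (by linarith)
    rw [div_pow, div_le_div_iff₀ (by positivity) (by positivity)]
    have h3 := pow_le_pow_left₀ (Real.sqrt_nonneg _) h2 2
    rw [Real.sq_sqrt (by positivity)] at h3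
    linarith
  have hsq : Real.sqrt q = 1 / Real.sqrt (n + 1) := by
    rw [hq, Real.sqrt_div zero_le_one, Real.sqrt_one]
  have h2 : (1 - Real.sqrt q) ^ j ≤ 1 / d := by
    have h3 : 1 - Real.sqrt q ≤ Real.exp (-Real.sqrt q) := by
      have := Real.add_one_le_exp (-Real.sqrt q); linarith
    have h4 : 0 ≤ 1 - Real.sqrt q := by
      have : Real.sqrt q ≤ 1 := Real.sqrt_le_one.2 hq1.le
      linarith
    calc (1 - Real.sqrt q) ^ j ≤ Real.exp (-Real.sqrt q) ^ j := pow_le_pow_left₀ h4 h3 j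
      _ = Real.exp (-(j * Real.sqrt q)) := by rw [← Real.exp_nat_mul]; ring_nf
      _ ≤ Real.exp (-Real.log d) := by
        refine Real.exp_le_exp.2 (neg_le_neg ?_)
        have h5 := Nat.le_ceil (Real.sqrt (n + 1) * Real.log d)
        rw [hsq, mul_one_div, le_div_iff₀ (by positivity), mul_comm]
        exact h5
      _ = 1 / d := by rw [Real.exp_neg, Real.exp_log (by positivity), one_div]
  calc _ ≤ rateSeq q ⌈Real.sqrt n⌉₊ * (1 - Real.sqrt q) ^ j := rateSeq_add_le hq0 hq1 _ _
    _ ≤ 4 / n * (1 / d) := by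
      refine mul_le_mul h1 h2 ?_ (by positivity)
      have : Real.sqrt q ≤ 1 := Real.sqrt_le_one.2 hq1.le
      exact pow_nonneg (by linarith) _
    _ = _ := by field_simp

/-- The `1 / n` in the rate cancels the `λ = 1 / n` in front of the energy, and its `1 / d` is the
accuracy demanded by `ApproxRidge`. The constant is `4` from the rate times `2 (1 + λ) ≤ 4`. -/
lemma distributedAGD_approxRidge (hM : 1 ≤ M) (hE : 1 ≤ E) (hd : 1 ≤ d) :
    (distributedAGD (agdRounds (M * E) d) M d E).ApproxRidge 16 := by
  have hrun : ∀ S : Fin M × Fin E → Vec d × ℝ,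
      (distributedAGD (agdRounds (M * E) d) M d E).run (fun m i => S (m, i))
        = (agdIter (ridgeParam M E) S (agdRounds (M * E) d)).1 := fun S =>
    congrArg Prod.fst (distributedAGD_stateAfter (agdRounds (M * E) d) hM hE S
      (agdRounds (M * E) d))
  refine ⟨?_, fun S hS => ?_⟩
  · simp_rw [hrun]
    exact (continuous_agdIter _ _).fst.measurable
  · rw [hrun]
    have hn : 1 ≤ M * E := Nat.mul_pos hM hE
    have hn0 : (1 : ℝ) ≤ ((M * E : ℕ) : ℝ) := by exact_mod_cast hn
    have hd0 : (1 : ℝ) ≤ d := by exact_mod_cast hd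
    have hlam : ridgeParam M E = 1 / ((M * E : ℕ) : ℝ) := by rw [ridgeParam]; push_cast; rfl
    set n : ℝ := ((M * E : ℕ) : ℝ) with hn'
    have h1 := agdIter_error hM hE hS (agdRounds (M * E) d)
    simp only [] at h1
    have hq : ridgeParam M E / (1 + ridgeParam M E) = 1 / (n + 1) := by
      rw [hlam]; field_simp
    rw [hq] at h1
    set X := inner ℝ (gram S ((agdIter (ridgeParam M E) S (agdRounds (M * E) d)).1 - ridge S))
      ((agdIter (ridgeParam M E) S (agdRounds (M * E) d)).1 - ridge S)
    have h2 := rateSeq_agdRounds_le hn hd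
    have h3 : 2 * (1 + ridgeParam M E) * ‖ridge S‖ ^ 2 ≤ 4 * ‖ridge S‖ ^ 2 := by
      have : ridgeParam M E ≤ 1 := by rw [hlam]; exact (div_le_one (by linarith)).2 hn0
      nlinarith [sq_nonneg ‖ridge S‖]
    have h4 : ridgeParam M E * X ≤ 4 / (n * d) * (4 * ‖ridge S‖ ^ 2) :=
      h1.trans (mul_le_mul h2 h3 (by rw [hlam]; positivity) (by positivity))
    rw [hlam] at h4
    have h5 : X * d = 1 / n * X * (n * d) := by field_simp
    have h6 : 4 / (n * d) * (4 * ‖ridge S‖ ^ 2) * (n * d) = 16 * ‖ridge S‖ ^ 2 := by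
      field_simp; ring
    rw [h5]
    have h7 := mul_le_mul_of_nonneg_right h4 (show 0 ≤ n * d by positivity)
    linarith

end Protocols

/-! ### Inverse gap weighting and sampling -/

section Arms

/-- Evaluating a measurable family at a measurable action. -/
lemma measurable_eval_arm {Ω β : Type*} [MeasurableSpace Ω] [MeasurableSpace β]
    {K : ℕ} {f : Ω → Fin K → β} {a : Ω → Fin K} (hf : ∀ b, Measurable fun ω => f ω b) (ha : Measurable a) :
    Measurable fun ω => f ω (a ω) := by
  have h : Measurable fun p : Fin K × Ω => f p.2 p.1 :=
    measurable_from_prod_countable_right hf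
  exact h.comp (ha.prodMk measurable_id)

variable {K : ℕ} [NeZero K]

/-- The second alternative is the default action for an empty set. This form shows the events behind
`argmaxArm` and `sampleArm` as finite Boolean combinations. -/
lemma firstOf_filter_eq_iff (P : Fin K → Prop) [DecidablePred P] (a : Fin K) :
    firstOf (Finset.univ.filter P) = a ↔
      (P a ∧ ∀ b < a, ¬ P b) ∨ (a = 0 ∧ ∀ b, ¬ P b) := by
  unfold firstOf
  split_ifs with h
  · rw [Finset.min'_eq_iff]
    simp only [Finset.mem_filter, Finset.mem_univ, true_and]
    obtain ⟨c, hc⟩ := h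
    simp only [Finset.mem_filter, Finset.mem_univ, true_and] at hc
    constructor
    · rintro ⟨h1, h2⟩
      exact Or.inl ⟨h1, fun b hb hPb => absurd (h2 b hPb) (not_le.2 hb)⟩
    · rintro (⟨h1, h2⟩ | ⟨-, h2⟩)
      · exact ⟨h1, fun b hb => not_lt.1 fun hlt => h2 b hlt hb⟩
      · exact absurd hc (h2 c)
  · have h' : ∀ b, ¬ P b := fun b hb => h ⟨b, by simp [hb]⟩
    simp [h', eq_comm]

lemma measurable_firstOf {Ω : Type*} [MeasurableSpace Ω] {P : Ω → Fin K → Prop}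
    [∀ ω, DecidablePred (P ω)] (h : ∀ a, MeasurableSet {ω | P ω a}) :
    Measurable fun ω => firstOf (Finset.univ.filter (P ω)) := by
  refine measurable_to_countable' fun a => ?_
  have : (fun ω => firstOf (Finset.univ.filter (P ω))) ⁻¹' {a}
      = ({ω | P ω a} ∩ ⋂ b ∈ Set.Iio a, {ω | P ω b}ᶜ) ∪
        ({_ω | a = 0} ∩ ⋂ b, {ω | P ω b}ᶜ) := by
    ext ω
    simp [firstOf_filter_eq_iff]
  rw [this]
  refine ((h a).inter (MeasurableSet.biInter (Set.to_countable _) fun b _ => (h b).compl)).union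
    ((MeasurableSet.const _).inter (MeasurableSet.iInter fun b => (h b).compl))

lemma argmaxArm_spec (f : Fin K → ℝ) (b : Fin K) : f b ≤ f (argmaxArm f) := by
  obtain ⟨c, hc⟩ := Finite.exists_max f
  have h := (firstOf_filter_eq_iff (fun a => ∀ b, f b ≤ f a) (argmaxArm f)).1 rfl
  rcases h with ⟨h, -⟩ | ⟨-, h⟩
  · exact h b
  · exact absurd hc (h c)

lemma measurable_argmaxArm : Measurable (argmaxArm : (Fin K → ℝ) → Fin K) := by
  refine measurable_firstOf fun a => ?_
  simp only [Set.ofPred_forall]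
  exact MeasurableSet.iInter fun b => measurableSet_le (measurable_pi_apply b) (measurable_pi_apply a)

lemma measurable_sampleArm {Ω : Type*} [MeasurableSpace Ω] {p : Ω → Fin K → ℝ} {u : Ω → ℝ}
    (hp : Measurable p) (hu : Measurable u) : Measurable fun ω => sampleArm (p ω) (u ω) := by
  refine measurable_firstOf fun a => measurableSet_le hu ?_
  exact Finset.measurable_fun_sum _ fun b _ => (measurable_pi_apply b).comp hp

/-- The suboptimality gap of action `a` for the rewards `f`. -/
def gap (f : Fin K → ℝ) (a : Fin K) : ℝ := f (argmaxArm f) - f a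

lemma gap_nonneg (f : Fin K → ℝ) (a : Fin K) : 0 ≤ gap f a := sub_nonneg.2 (argmaxArm_spec f a)

lemma measurable_gap (a : Fin K) : Measurable fun f : Fin K → ℝ => gap f a :=
  (measurable_eval_arm (fun b => measurable_pi_apply b) measurable_argmaxArm).sub
    (measurable_pi_apply a)

lemma measurable_igwProb (γ : ℝ) (a : Fin K) : Measurable fun f : Fin K → ℝ => igwProb γ f a := by
  unfold igwProb
  have h1 : MeasurableSet {f : Fin K → ℝ | a = argmaxArm f} :=
    measurableSet_eq_fun measurable_const measurable_argmaxArm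
  have hr : ∀ b, Measurable fun f : Fin K → ℝ => 1 / ((K : ℝ) + γ * (f (argmaxArm f) - f b)) :=
    fun b => measurable_const.div (measurable_const.add ((measurable_gap b).const_mul γ))
  refine Measurable.ite h1 ?_ (hr a)
  have h2 : (fun f : Fin K → ℝ => 1 - ∑ b ∈ Finset.univ.erase (argmaxArm f),
      1 / ((K : ℝ) + γ * (f (argmaxArm f) - f b))) = fun f : Fin K → ℝ =>
      1 - ∑ b, if b = argmaxArm f then 0 else 1 / ((K : ℝ) + γ * (f (argmaxArm f) - f b)) := by
    funext f
    congr 1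
    rw [← Finset.sum_erase (a := argmaxArm f) Finset.univ (by simp)]
    exact Finset.sum_congr rfl fun b hb => by rw [if_neg (Finset.ne_of_mem_erase hb)]
  rw [h2]
  refine measurable_const.sub (Finset.measurable_fun_sum _ fun b _ => ?_)
  exact Measurable.ite (measurableSet_eq_fun measurable_const measurable_argmaxArm)
    measurable_const (hr b)

variable {γ : ℝ} (hγ : 0 ≤ γ) (f : Fin K → ℝ)
include hγ

lemma one_le_igw_denominator (a : Fin K) : (0 : ℝ) < K + γ * gap f a := by
  have : (0 : ℝ) < K := by exact_mod_cast Nat.pos_of_ne_zero (NeZero.ne K)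
  have := mul_nonneg hγ (gap_nonneg f a)
  linarith

/-- Only the greedy action needs an argument: each of the other `K - 1` actions takes at most `1 /
K`, which leaves it at least `1 / K`. -/
lemma le_igwProb (a : Fin K) : 1 / (K + γ * gap f a) ≤ igwProb γ f a := by
  have hK : (0 : ℝ) < K := by exact_mod_cast Nat.pos_of_ne_zero (NeZero.ne K)
  unfold igwProb
  split_ifs with h
  · have h1 : ∑ b ∈ Finset.univ.erase (argmaxArm f), 1 / ((K : ℝ) + γ * (f (argmaxArm f) - f b))
        ≤ ∑ _b ∈ Finset.univ.erase (argmaxArm f), 1 / (K : ℝ) :=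
      Finset.sum_le_sum fun b _ => one_div_le_one_div_of_le hK
        (le_add_of_nonneg_right (mul_nonneg hγ (gap_nonneg f b)))
    have h2 : ∑ _b ∈ Finset.univ.erase (argmaxArm f), 1 / (K : ℝ) = 1 - 1 / K := by
      rw [Finset.sum_const, Finset.card_erase_of_mem (Finset.mem_univ _), Finset.card_univ,
        Fintype.card_fin, nsmul_eq_mul, Nat.cast_sub (Nat.one_le_iff_ne_zero.2 (NeZero.ne K))]
      field_simp
      simp
    rw [h, gap, sub_self, mul_zero, add_zero]
    linarith
  · exact le_rfl

lemma igwProb_pos (a : Fin K) : 0 < igwProb γ f a :=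
  (one_div_pos.2 (one_le_igw_denominator hγ f a)).trans_le (le_igwProb hγ f a)

omit hγ in
lemma sum_igwProb : ∑ a, igwProb γ f a = 1 := by
  rw [← Finset.add_sum_erase _ _ (Finset.mem_univ (argmaxArm f)), igwProb, if_pos rfl]
  have : ∑ b ∈ Finset.univ.erase (argmaxArm f), igwProb γ f b
      = ∑ b ∈ Finset.univ.erase (argmaxArm f), 1 / ((K : ℝ) + γ * (f (argmaxArm f) - f b)) :=
    Finset.sum_congr rfl fun b hb => by
      rw [igwProb, if_neg (Finset.ne_of_mem_erase hb)]
  rw [this]; ring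

/-- The estimated regret of inverse gap weighting. -/
lemma sum_igwProb_mul_gap_le : γ * ∑ a, igwProb γ f a * gap f a ≤ K := by
  rw [Finset.mul_sum]
  calc _ ≤ ∑ _a : Fin K, (1 : ℝ) := by
        refine Finset.sum_le_sum fun a _ => ?_
        by_cases h : a = argmaxArm f
        · rw [h, gap, sub_self]; simp
        · have h1 := one_le_igw_denominator hγ f a
          have hK : (0 : ℝ) < K := by exact_mod_cast Nat.pos_of_ne_zero (NeZero.ne K)
          rw [igwProb, if_neg h]
          change γ * (1 / (K + γ * gap f a) * gap f a) ≤ 1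
          rw [show γ * (1 / (K + γ * gap f a) * gap f a) = γ * gap f a / (K + γ * gap f a) by ring,
            div_le_one h1]
          linarith
    _ = K := by simp

end Arms

section Sampling

variable {K : ℕ} [NeZero K] {p : Fin K → ℝ}

lemma volume_sampleArm (hp : ∀ a, 0 ≤ p a) (hsum : ∑ a, p a = 1) (a : Fin K) :
    (volume.restrict (Set.Icc (0 : ℝ) 1)).real {u | sampleArm p u = a} = p a := by
  -- Dropping the null point `u = 0` makes the preimage of each action exactly a half-open interval
  -- between consecutive cumulative sums.
  rw [← restrict_Ioc_eq_restrict_Icc]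
  have hms : MeasurableSet {u : ℝ | sampleArm p u = a} :=
    measurable_sampleArm (p := fun _ => p) measurable_const measurable_id (measurableSet_singleton a)
  rw [measureReal_restrict_apply hms]
  have hle : ∀ s t : Finset (Fin K), s ⊆ t → ∑ b ∈ s, p b ≤ ∑ b ∈ t, p b := fun s t h =>
    Finset.sum_le_sum_of_subset_of_nonneg h fun b _ _ => hp b
  have hset : {u : ℝ | sampleArm p u = a} ∩ Set.Ioc 0 1
      = Set.Ioc (∑ b ∈ Finset.Iio a, p b) (∑ b ∈ Finset.Iic a, p b) := by
    ext u
    simp only [Set.mem_inter_iff, Set.mem_ofPred_eq, Set.mem_Ioc]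
    unfold sampleArm
    rw [firstOf_filter_eq_iff]
    constructor
    · rintro ⟨⟨h1, h2⟩ | ⟨-, h2⟩, h3, h4⟩
      · refine ⟨?_, h1⟩
        by_cases hne : (Finset.Iio a).Nonempty
        · set b := (Finset.Iio a).max' hne
          have hb : b < a := Finset.mem_Iio.1 (Finset.max'_mem _ hne)
          have : Finset.Iio a = Finset.Iic b := by
            ext c
            simp only [Finset.mem_Iio, Finset.mem_Iic]
            exact ⟨fun hc => Finset.le_max' _ _ (Finset.mem_Iio.2 hc), fun hc => hc.trans_lt hb⟩
          rw [this]
          exact not_le.1 (h2 b hb)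
        · rw [Finset.not_nonempty_iff_eq_empty.1 hne, Finset.sum_empty]
          exact h3
      -- The default of `firstOf` never occurs: at the largest action the cumulative sum is `1 ≥ u`.
      · obtain ⟨c, hc⟩ := Finite.exists_max (id : Fin K → Fin K)
        have : Finset.Iic c = Finset.univ := by
          ext b; simpa using hc b
        exact absurd (by rw [this, hsum]; exact h4) (h2 c)
    · rintro ⟨h1, h2⟩
      refine ⟨Or.inl ⟨h2, fun b hb => not_le.2 (lt_of_le_of_lt (hle _ _ ?_) h1)⟩, ?_, ?_⟩
      · intro c hc
        exact Finset.mem_Iio.2 ((Finset.mem_Iic.1 hc).trans_lt hb)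
      · exact lt_of_le_of_lt (Finset.sum_nonneg fun b _ => hp b) h1
      · exact h2.trans (hsum ▸ hle _ _ (Finset.subset_univ _))
  have hI : ∑ b ∈ Finset.Iic a, p b = p a + ∑ b ∈ Finset.Iio a, p b := by
    rw [← Finset.Iio_insert, Finset.sum_insert (by simp)]
  rw [hset, Real.volume_real_Ioc_of_le (by rw [hI]; linarith [hp a]), hI]
  ring

/-- An action sampled with a uniform seed has the prescribed distribution. -/
lemma integral_sampleArm (hp : ∀ a, 0 ≤ p a) (hsum : ∑ a, p a = 1) (h : Fin K → ℝ) :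
    ∫ u in Set.Icc (0 : ℝ) 1, h (sampleArm p u) = ∑ a, p a * h a := by
  have hms : ∀ a, MeasurableSet {u : ℝ | sampleArm p u = a} := fun a =>
    measurable_sampleArm (p := fun _ => p) measurable_const measurable_id (measurableSet_singleton a)
  have h1 : ∀ u, h (sampleArm p u)
      = ∑ a, Set.indicator {u | sampleArm p u = a} (fun _ => h a) u := fun u => by
    rw [Finset.sum_eq_single (sampleArm p u)]
    · simp
    · intro b _ hb
      simp [hb.symm]
    · simp
  simp_rw [h1]
  rw [integral_finsetSum _ fun a _ => (integrable_const _).indicator (hms a)]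
  refine Finset.sum_congr rfl fun a _ => ?_
  rw [integral_indicator_const _ (hms a), volume_sampleArm hp hsum, smul_eq_mul]

end Sampling

/-! ### Regret of policies with respect to true and estimated rewards -/

section Policies

variable {X : Type*} [MeasurableSpace X] {K : ℕ}

/-- Bounded measurable reward functions. -/
structure IsReward (f : X → Fin K → ℝ) : Prop where
  measurable : ∀ a, Measurable fun x => f x a
  bounded : ∃ C, ∀ x a, |f x a| ≤ C

/-- Measurable randomized policies. -/
structure IsPolicy (Q : X → Fin K → ℝ) : Prop where
  measurable : ∀ a, Measurable fun x => Q x a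
  nonneg : ∀ x a, 0 ≤ Q x a
  sum_eq_one : ∀ x, ∑ a, Q x a = 1

lemma IsPolicy.le_one {Q : X → Fin K → ℝ} (hQ : IsPolicy Q) (x : X) (a : Fin K) : Q x a ≤ 1 :=
  (Finset.single_le_sum (fun b _ => hQ.nonneg x b) (Finset.mem_univ a)).trans_eq (hQ.sum_eq_one x)

lemma IsReward.sub {f g : X → Fin K → ℝ} (hf : IsReward f) (hg : IsReward g) :
    IsReward fun x a => f x a - g x a := by
  obtain ⟨C, hC⟩ := hf.bounded
  obtain ⟨D, hD⟩ := hg.bounded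
  exact ⟨fun a => (hf.measurable a).sub (hg.measurable a), C + D, fun x a =>
    (abs_sub _ _).trans (add_le_add (hC x a) (hD x a))⟩

lemma IsReward.abs {f : X → Fin K → ℝ} (hf : IsReward f) : IsReward fun x a => |f x a| := by
  obtain ⟨C, hC⟩ := hf.bounded
  exact ⟨fun a => (hf.measurable a).abs, C, fun x a => by rw [abs_abs]; exact hC x a⟩

lemma IsReward.sq {f : X → Fin K → ℝ} (hf : IsReward f) : IsReward fun x a => f x a ^ 2 := by
  obtain ⟨C, hC⟩ := hf.bounded
  exact ⟨fun a => (hf.measurable a).pow_const 2, C ^ 2, fun x a => by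
    rw [abs_pow]; exact pow_le_pow_left₀ (abs_nonneg _) (hC x a) 2⟩

lemma IsReward.integrable {f : X → Fin K → ℝ} (hf : IsReward f) {Q : X → Fin K → ℝ}
    (hQ : IsPolicy Q) (ν : Measure X) [IsFiniteMeasure ν] :
    Integrable (fun x => ∑ a, Q x a * f x a) ν := by
  obtain ⟨C, hC⟩ := hf.bounded
  refine integrable_finsetSum _ fun a _ => Integrable.of_bound
    ((hQ.measurable a).mul (hf.measurable a)).aestronglyMeasurable C (ae_of_all _ fun x => ?_)
  rw [Real.norm_eq_abs, abs_mul, abs_of_nonneg (hQ.nonneg x a)]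
  exact (mul_le_of_le_one_left (abs_nonneg _) (hQ.le_one x a)).trans (hC x a)

/-- The mean absolute deviation of two reward functions under the policy `Q`. -/
def deviation (ν : Measure X) (f g Q : X → Fin K → ℝ) : ℝ :=
  ∫ x, ∑ a, Q x a * |f x a - g x a| ∂ν

/-- The mean squared deviation of two reward functions under the policy `Q`. -/
def sqDeviation (ν : Measure X) (f g Q : X → Fin K → ℝ) : ℝ :=
  ∫ x, ∑ a, Q x a * (f x a - g x a) ^ 2 ∂ν

lemma deviation_comm (ν : Measure X) (f g Q : X → Fin K → ℝ) : deviation ν f g Q = deviation ν g f Q := by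
  simp only [deviation, abs_sub_comm]

lemma sqDeviation_nonneg (ν : Measure X) (f g : X → Fin K → ℝ) {Q : X → Fin K → ℝ}
    (hQ : IsPolicy Q) : 0 ≤ sqDeviation ν f g Q :=
  integral_nonneg fun x => Finset.sum_nonneg fun a _ => mul_nonneg (hQ.nonneg x a) (sq_nonneg _)

variable [NeZero K]

lemma IsReward.gap {f : X → Fin K → ℝ} (hf : IsReward f) : IsReward fun x a => gap (f x) a := by
  obtain ⟨C, hC⟩ := hf.bounded
  refine ⟨fun a => (measurable_gap a).comp (measurable_pi_lambda _ hf.measurable), C + C,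
    fun x a => (abs_sub _ _).trans (add_le_add (hC x _) (hC x a))⟩

/-- The greedy policy. -/
def greedy (f : X → Fin K → ℝ) (x : X) (a : Fin K) : ℝ := if a = argmaxArm (f x) then 1 else 0

lemma isPolicy_greedy {f : X → Fin K → ℝ} (hf : IsReward f) : IsPolicy (greedy f) where
  measurable a := Measurable.ite (measurableSet_eq_fun measurable_const
    (measurable_argmaxArm.comp (measurable_pi_lambda _ hf.measurable))) measurable_const
    measurable_const
  nonneg x a := by unfold greedy; split_ifs <;> simp
  sum_eq_one x := by simp [greedy]

lemma isPolicy_igwProb {γ : ℝ} (hγ : 0 ≤ γ) {f : X → Fin K → ℝ} (hf : IsReward f) :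
    IsPolicy fun x => igwProb γ (f x) where
  measurable a := (measurable_igwProb γ a).comp (measurable_pi_lambda _ hf.measurable)
  nonneg x a := (igwProb_pos hγ (f x) a).le
  sum_eq_one x := sum_igwProb (f x)

/-- The regret of the policy `Q` for the rewards `f`. -/
def policyRegret (ν : Measure X) (f Q : X → Fin K → ℝ) : ℝ := ∫ x, ∑ a, Q x a * gap (f x) a ∂ν

/-- The regrets of all policies for the rewards `f` and `g` agree up to a factor `2` and an
additive error `B`. -/
def RegretClose (ν : Measure X) (f g : X → Fin K → ℝ) (B : ℝ) : Prop :=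
  ∀ Q, IsPolicy Q → policyRegret ν f Q ≤ 2 * policyRegret ν g Q + B ∧
    policyRegret ν g Q ≤ 2 * policyRegret ν f Q + B

lemma policyRegret_nonneg (ν : Measure X) (f : X → Fin K → ℝ) {Q : X → Fin K → ℝ}
    (hQ : IsPolicy Q) : 0 ≤ policyRegret ν f Q :=
  integral_nonneg fun x => Finset.sum_nonneg fun a _ => mul_nonneg (hQ.nonneg x a) (gap_nonneg _ _)

lemma policyRegret_greedy (ν : Measure X) (f : X → Fin K → ℝ) :
    policyRegret ν f (greedy f) = 0 := by
  simp [policyRegret, greedy, gap]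

variable {ν : Measure X} [IsFiniteMeasure ν] {f g h Q : X → Fin K → ℝ}

/-- The maximum of `g` is at least its value at the greedy action of `f`, so the two gaps differ by
at most the deviations at that action and at the played one. -/
lemma policyRegret_le_add_deviation (hf : IsReward f) (hg : IsReward g) (hQ : IsPolicy Q) :
    policyRegret ν f Q ≤ policyRegret ν g Q + deviation ν f g (greedy f) + deviation ν f g Q := by
  have hd := (hf.sub hg).abs
  have h1 := hd.integrable (isPolicy_greedy hf) ν
  have h2 := hd.integrable hQ ν
  have h3 := hg.gap.integrable hQ ν
  unfold policyRegret deviation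
  have h31 : Integrable (fun x => ∑ a, Q x a * gap (g x) a
      + ∑ a, greedy f x a * |f x a - g x a|) ν := h3.add h1
  rw [← integral_add h3 h1, ← integral_add h31 h2]
  refine integral_mono (hf.gap.integrable hQ ν) (h31.add h2) fun x => ?_
  change ∑ a, Q x a * gap (f x) a ≤ ∑ a, Q x a * gap (g x) a + ∑ a, greedy f x a * |f x a - g x a|
    + ∑ a, Q x a * |f x a - g x a|
  have e1 : ∑ a, greedy f x a * |f x a - g x a|
      = |f x (argmaxArm (f x)) - g x (argmaxArm (f x))| := by simp [greedy]
  have e2 : |f x (argmaxArm (f x)) - g x (argmaxArm (f x))|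
      = ∑ a, Q x a * |f x (argmaxArm (f x)) - g x (argmaxArm (f x))| := by
    rw [← Finset.sum_mul, hQ.sum_eq_one, one_mul]
  rw [e1, e2, ← Finset.sum_add_distrib, ← Finset.sum_add_distrib]
  refine Finset.sum_le_sum fun a _ => ?_
  rw [← mul_add, ← mul_add]
  refine mul_le_mul_of_nonneg_left ?_ (hQ.nonneg x a)
  have h4 := argmaxArm_spec (g x) (argmaxArm (f x))
  have h5 := le_abs_self (f x (argmaxArm (f x)) - g x (argmaxArm (f x)))
  have h6 := neg_abs_le (f x a - g x a)
  unfold gap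
  linarith

/-- The deviation under a policy is controlled by the squared deviation under inverse gap
weighting for the rewards `h` and the regret for `h`. -/
lemma deviation_le (hf : IsReward f) (hg : IsReward g) (hh : IsReward h) (hQ : IsPolicy Q) {γ s : ℝ}
    (hγ : 0 ≤ γ) (hs : 0 < s) :
    deviation ν f g Q ≤ (ν.real Set.univ * K + γ * policyRegret ν h Q) / (2 * s)
      + s / 2 * sqDeviation ν f g fun x => igwProb γ (h x) := by
  have hp := isPolicy_igwProb hγ hh
  have h1 := hh.gap.integrable hQ ν
  have h2 := (hf.sub hg).sq.integrable hp ν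
  have h3 : Integrable (fun x => (K : ℝ) + γ * ∑ a, Q x a * gap (h x) a) ν :=
    (integrable_const _).add (h1.const_mul _)
  have e1 : (ν.real Set.univ * K + γ * policyRegret ν h Q) / (2 * s)
      + s / 2 * sqDeviation ν f g (fun x => igwProb γ (h x))
      = ∫ x, ((K : ℝ) + γ * ∑ a, Q x a * gap (h x) a) * (1 / (2 * s))
        + s / 2 * ∑ a, igwProb γ (h x) a * (f x a - g x a) ^ 2 ∂ν := by
    rw [integral_add (h3.mul_const _) (h2.const_mul _),
      integral_mul_const, integral_add (integrable_const _) (h1.const_mul _),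
      integral_const_mul, integral_const_mul, integral_const, smul_eq_mul]
    rw [policyRegret, sqDeviation, mul_one_div]
  rw [e1]
  refine integral_mono ((hf.sub hg).abs.integrable hQ ν)
    ((h3.mul_const _).add (h2.const_mul _)) fun x => ?_
  change ∑ a, Q x a * |f x a - g x a| ≤ ((K : ℝ) + γ * ∑ a, Q x a * gap (h x) a) * (1 / (2 * s))
        + s / 2 * ∑ a, igwProb γ (h x) a * (f x a - g x a) ^ 2
  have e2 : (K : ℝ) + γ * ∑ a, Q x a * gap (h x) a = ∑ a, Q x a * (K + γ * gap (h x) a) := by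
    simp only [mul_add, Finset.sum_add_distrib, ← Finset.sum_mul, hQ.sum_eq_one, one_mul,
      Finset.mul_sum]
    congr 1
    exact Finset.sum_congr rfl fun a _ => by ring
  rw [e2, Finset.sum_mul, Finset.mul_sum, ← Finset.sum_add_distrib]
  refine Finset.sum_le_sum fun a _ => ?_
  set D := (K : ℝ) + γ * gap (h x) a with hD
  have hD0 : 0 < D := one_le_igw_denominator hγ (h x) a
  have hpD : 1 ≤ igwProb γ (h x) a * D := by
    have := mul_le_mul_of_nonneg_right (le_igwProb hγ (h x) a) hD0.le
    rwa [one_div_mul_cancel hD0.ne'] at this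
  set w := |f x a - g x a| with hw
  have hw2 : (f x a - g x a) ^ 2 = w ^ 2 := (sq_abs _).symm
  rw [hw2]
  have hq0 := hQ.nonneg x a
  have hq1 := hQ.le_one x a
  have hp0 := (igwProb_pos hγ (h x) a).le
  set P := igwProb γ (h x) a
  -- AM–GM with weight `D`, followed by `1 / D ≤ P`. Averaged over `Q`, the term `D` becomes `K`
  -- plus `γ` times the regret for `h`.
  have key : w ≤ D * (1 / (2 * s)) + s / 2 * (P * w ^ 2) := by
    have h5 : 0 ≤ 1 / (2 * s * D) * (D - s * w) ^ 2 := by positivity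
    have h6 : 1 / (2 * s * D) * (D - s * w) ^ 2
        = D * (1 / (2 * s)) - w + s / 2 * (w ^ 2 / D) := by
      field_simp; ring
    have h7 : w ^ 2 / D ≤ P * w ^ 2 := by
      rw [div_le_iff₀ hD0]
      have := mul_le_mul_of_nonneg_right hpD (sq_nonneg w)
      linarith
    have h8 := mul_le_mul_of_nonneg_left h7 (show 0 ≤ s / 2 by positivity)
    linarith
  have h9 := mul_le_mul_of_nonneg_left key hq0
  have h10 : 0 ≤ s / 2 * (P * w ^ 2) := by positivity
  -- Bounding `Q x a` by `1` in the quadratic term removes the policy from it, leaving the error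
  -- under the exploring distribution.
  have h11 := mul_le_mul_of_nonneg_right hq1 h10
  linarith

/-- Closeness of the regrets after exploring uniformly. -/
lemma regretClose_of_zero (hf : IsReward f) (hg : IsReward g) {γ s : ℝ} (hγ : 0 ≤ γ)
    (hs : 0 < s) :
    RegretClose ν f g (ν.real Set.univ * K / s
      + s * sqDeviation ν f g fun _ : X => igwProb γ (fun _ : Fin K => (0 : ℝ))) := by
  have hz : IsReward fun (_ : X) (_ : Fin K) => (0 : ℝ) :=
    ⟨fun a => measurable_const, 0, fun x a => by simp⟩
  set e := sqDeviation ν f g fun _ : X => igwProb γ (fun _ : Fin K => (0 : ℝ)) with he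
  have hdev : ∀ Q : X → Fin K → ℝ, IsPolicy Q →
      deviation ν f g Q ≤ ν.real Set.univ * K / (2 * s) + s / 2 * e := fun Q hQ => by
    have h1 := deviation_le (ν := ν) hf hg hz hQ hγ hs
    -- Zero rewards have no gaps: exploration is uniform, and no closeness hypothesis is needed to
    -- start the induction.
    have h2 : policyRegret ν (fun (_ : X) (_ : Fin K) => (0 : ℝ)) Q = 0 := by
      simp [policyRegret, gap]
    rwa [h2, mul_zero, add_zero] at h1
  have h3 : ν.real Set.univ * K / s = 2 * (ν.real Set.univ * K / (2 * s)) := by field_simp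
  intro Q hQ
  have h4 := hdev Q hQ
  have h5 := policyRegret_nonneg ν f hQ
  have h6 := policyRegret_nonneg ν g hQ
  constructor
  · have h7 := policyRegret_le_add_deviation (ν := ν) hf hg hQ
    have h8 := hdev _ (isPolicy_greedy hf)
    rw [h3]; linarith
  · have h7 := policyRegret_le_add_deviation (ν := ν) hg hf hQ
    have h8 := hdev _ (isPolicy_greedy hg)
    rw [deviation_comm ν g, deviation_comm ν g] at h7
    rw [h3]; linarith

/-- One epoch of inverse gap weighting for the estimate `h`, followed by the estimate `g`. -/
lemma RegretClose.step (hf : IsReward f) (hh : IsReward h) (hg : IsReward g) {B γ : ℝ}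
    (hγ : 0 < γ) (hc : RegretClose ν f h B) :
    RegretClose ν f g (B / 3 + ν.real Set.univ * K / (3 * γ)
      + 16 / 3 * γ * sqDeviation ν f g fun x => igwProb γ (h x)) := by
  set e := sqDeviation ν f g fun x => igwProb γ (h x) with he
  set N := ν.real Set.univ * K with hN
  set D := B / 3 + N / (3 * γ) + 16 / 3 * γ * e with hD
  have hdev : ∀ Q : X → Fin K → ℝ, IsPolicy Q → deviation ν f g Q
      ≤ N / (8 * γ) + (2 * policyRegret ν f Q + B) / 8 + 2 * γ * e := fun Q hQ => by
    -- With `s = 4 γ` the `h`-regret enters with weight `1 / 8`, so the regret for `f` has weight `1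
    -- / 4` and can be absorbed on the left.
    have h1 := deviation_le (ν := ν) hf hg hh hQ hγ.le (s := 4 * γ) (by positivity)
    have h2 := (hc Q hQ).2
    have h3 : (N + γ * policyRegret ν h Q) / (2 * (4 * γ))
        = N / (8 * γ) + policyRegret ν h Q / 8 := by field_simp; ring
    rw [h3] at h1
    linarith
  have h8 : N / (3 * γ) = 8 / 3 * (N / (8 * γ)) := by field_simp
  have hfirst : ∀ Q : X → Fin K → ℝ, IsPolicy Q →
      policyRegret ν f Q ≤ 4 / 3 * policyRegret ν g Q + D := fun Q hQ => by
    have h1 := policyRegret_le_add_deviation (ν := ν) hf hg hQ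
    have h2 := hdev _ (isPolicy_greedy hf)
    rw [policyRegret_greedy] at h2
    have h3 := hdev Q hQ
    rw [hD, h8]
    linarith
  intro Q hQ
  have h5 := policyRegret_nonneg ν f hQ
  have h6 := policyRegret_nonneg ν g hQ
  have h1 := policyRegret_le_add_deviation (ν := ν) hg hf hQ
  rw [deviation_comm ν g, deviation_comm ν g] at h1
  have h2 := hdev _ (isPolicy_greedy hg)
  -- The first inequality bounds the `f`-regret of the greedy policy of `g` by `D`. Inserted in
  -- `h2`, it adds `D / 4` to the remaining `3 / 4 * D`, for a total of `5 / 4` times the `f`-regret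
  -- plus `D`.
  have h3 := hfirst _ (isPolicy_greedy hg)
  rw [policyRegret_greedy] at h3
  have h4 := hdev Q hQ
  have h7 := hfirst Q hQ
  constructor
  · linarith
  · rw [hD, h8] at h3 ⊢
    linarith

/-- The regret of inverse gap weighting. -/
lemma RegretClose.policyRegret_igwProb_le (hh : IsReward h) {B γ : ℝ} (hγ : 0 < γ)
    (hc : RegretClose ν f h B) :
    policyRegret ν f (fun x => igwProb γ (h x)) ≤ 2 * (ν.real Set.univ * K / γ) + B := by
  have hp := isPolicy_igwProb hγ.le hh
  have h1 : policyRegret ν h (fun x => igwProb γ (h x)) ≤ ∫ _x, (K : ℝ) / γ ∂ν := by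
    refine integral_mono (hh.gap.integrable hp ν) (integrable_const _) fun x => ?_
    change ∑ a, igwProb γ (h x) a * gap (h x) a ≤ K / γ
    rw [le_div_iff₀ hγ, mul_comm]
    exact sum_igwProb_mul_gap_le hγ.le (h x)
  rw [integral_const, smul_eq_mul, ← mul_div_assoc] at h1
  linarith [(hc _ hp).1]

end Policies

/-! ### The law of the collected samples -/

section ChooseArm

variable {X : Type*} [MeasurableSpace X] {K d : ℕ} [NeZero K] {φ : X → Fin K → Vec d}

lemma measurable_chooseArm (hφ : ∀ a, Measurable fun x => φ x a) (γ : ℝ) {Ω : Type*}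
    [MeasurableSpace Ω] {θ : Ω → Vec d} {x : Ω → X} {u : Ω → ℝ} (hθ : Measurable θ)
    (hx : Measurable x) (hu : Measurable u) :
    Measurable fun ω => chooseArm φ γ (θ ω) (x ω) (u ω) := by
  refine measurable_sampleArm (measurable_pi_lambda _ fun a => ?_) hu
  exact (measurable_igwProb γ a).comp
    (measurable_pi_lambda _ fun b => hθ.inner ((hφ b).comp hx))

/-- The expectation over a uniform seed of a function of the chosen action. -/
lemma integral_chooseArm (hφ : ∀ a, Measurable fun x => φ x a) {γ : ℝ} (hγ : 0 ≤ γ) (θ : Vec d)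
    {Y : Type*} [MeasurableSpace Y] (μ : Measure (X × Y)) [IsProbabilityMeasure μ]
    {G : X × Y → Fin K → ℝ} (hG : ∀ a, Measurable fun z => G z a) {C : ℝ}
    (hC : ∀ᵐ z ∂μ, ∀ a, |G z a| ≤ C) :
    ∫ w, G w.1 (chooseArm φ γ θ w.1.1 w.2) ∂(μ.prod (volume.restrict (Set.Icc (0 : ℝ) 1)))
      = ∫ z, ∑ a, igwProb γ (fun b => inner ℝ θ (φ z.1 b)) a * G z a ∂μ := by
  have hm : Measurable fun w : (X × Y) × ℝ => G w.1 (chooseArm φ γ θ w.1.1 w.2) :=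
    measurable_eval_arm (f := fun (w : (X × Y) × ℝ) a => G w.1 a)
      (a := fun w : (X × Y) × ℝ => chooseArm φ γ θ w.1.1 w.2) (fun a => (hG a).comp measurable_fst)
      (measurable_chooseArm (θ := fun _ => θ) hφ γ measurable_const measurable_fst.fst
        measurable_snd)
  have hi : Integrable (fun w : (X × Y) × ℝ => G w.1 (chooseArm φ γ θ w.1.1 w.2))
      (μ.prod (volume.restrict (Set.Icc (0 : ℝ) 1))) := by
    refine Integrable.of_bound hm.aestronglyMeasurable C ?_
    filter_upwards [Measure.quasiMeasurePreserving_fst.ae hC] with w hw using hw _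
  rw [integral_prod _ hi]
  have h : ∀ z : X × Y, ∫ u in Set.Icc (0 : ℝ) 1, G z (chooseArm φ γ θ z.1 u)
      = ∑ a, igwProb γ (fun b => inner ℝ θ (φ z.1 b)) a * G z a := fun z =>
    integral_sampleArm (p := igwProb γ fun b => inner ℝ θ (φ z.1 b))
      (fun a => (igwProb_pos hγ _ a).le) (sum_igwProb _) (G z)
  exact integral_congr_ae (ae_of_all _ h)

end ChooseArm

/-! ### All agents combined into one contextual problem, and the law of their samples. -/

section Environment

variable {M K d : ℕ} {𝒳 : Fin M → Type*} [∀ m, MeasurableSpace (𝒳 m)]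
  (env : LinearEnv K d 𝒳)

lemma measurable_sigma_mk (m : Fin M) : Measurable (Sigma.mk m : 𝒳 m → Σ m, 𝒳 m) :=
  fun _ hs => (MeasurableSpace.measurableSet_iInf.1 hs) m

lemma measurable_of_sigma {β : Type*} [MeasurableSpace β] {f : (Σ m, 𝒳 m) → β}
    (hf : ∀ m, Measurable fun x => f ⟨m, x⟩) : Measurable f :=
  fun _ hs => MeasurableSpace.measurableSet_iInf.2 fun m => hf m hs

/-- The sum over the agents of the laws of their contexts. -/
def LinearEnv.ctxMeasure : Measure (Σ m, 𝒳 m) :=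
  ∑ m, (env.law m).map fun z => ⟨m, z.1⟩

/-- The linear reward function with parameter `θ`, as a function of agent and context. -/
def LinearEnv.linReward (θ : Vec d) (x : Σ m, 𝒳 m) (a : Fin K) : ℝ :=
  inner ℝ θ (env.feature x.1 x.2 a)

lemma LinearEnv.measurable_ctx (m : Fin M) :
    Measurable fun z : 𝒳 m × (Fin K → ℝ) => (⟨m, z.1⟩ : Σ m, 𝒳 m) :=
  (measurable_sigma_mk m).comp measurable_fst

lemma LinearEnv.isReward_linReward (θ : Vec d) : IsReward (env.linReward θ) :=
  ⟨fun a => measurable_of_sigma fun m => measurable_const.inner (env.measurable_feature m a),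
    ‖θ‖, fun _ _ => (abs_real_inner_le_norm _ _).trans
      (mul_le_of_le_one_right (norm_nonneg _) (env.norm_feature_le _ _ _))⟩

instance LinearEnv.isProbabilityMeasure_law (m : Fin M) : IsProbabilityMeasure (env.law m) :=
  env.isProb m

instance LinearEnv.isProbabilityMeasure_map (m : Fin M) :
    IsProbabilityMeasure ((env.law m).map fun z => (⟨m, z.1⟩ : Σ m, 𝒳 m)) :=
  Measure.isProbabilityMeasure_map (LinearEnv.measurable_ctx m).aemeasurable

instance LinearEnv.isFiniteMeasure_ctxMeasure : IsFiniteMeasure env.ctxMeasure := by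
  unfold LinearEnv.ctxMeasure; infer_instance

/-- Summing the agents' laws, rather than averaging them, makes `policyRegret` the total regret of
all agents in one step; the number of agents enters the analysis as this mass. -/
lemma LinearEnv.ctxMeasure_univ : env.ctxMeasure.real Set.univ = M := by
  rw [measureReal_def, LinearEnv.ctxMeasure, Measure.finsetSum_apply]
  simp

lemma LinearEnv.integral_ctxMeasure {F : (Σ m, 𝒳 m) → ℝ} (hF : Measurable F) {C : ℝ}
    (hC : ∀ x, |F x| ≤ C) :
    ∫ x, F x ∂env.ctxMeasure = ∑ m, ∫ z, F ⟨m, z.1⟩ ∂env.law m := by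
  rw [LinearEnv.ctxMeasure, integral_finsetSum_measure fun m _ =>
    Integrable.of_bound hF.aestronglyMeasurable C (ae_of_all _ hC)]
  exact Finset.sum_congr rfl fun m _ =>
    integral_map (LinearEnv.measurable_ctx m).aemeasurable hF.aestronglyMeasurable

lemma LinearEnv.integrable_reward (m : Fin M) (a : Fin K) :
    Integrable (fun z : 𝒳 m × (Fin K → ℝ) => z.2 a) (env.law m) := by
  refine Integrable.of_bound ((measurable_pi_apply a).comp measurable_snd).aestronglyMeasurable 1 ?_
  filter_upwards [env.reward_mem m] with z hz
  rw [Real.norm_eq_abs, abs_of_nonneg (hz a).1]; exact (hz a).2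

/-- The mean reward is a conditional expectation of a variable in `[0, 1]`. The norm bounds alone
would only give `[-1, 1]`. -/
lemma LinearEnv.ae_mean_mem (m : Fin M) :
    ∀ᵐ z ∂env.law m, ∀ a, env.mean m z.1 a ∈ Set.Icc (0 : ℝ) 1 := by
  rw [ae_all_iff]
  intro a
  have hle : MeasurableSpace.comap (Prod.fst : 𝒳 m × (Fin K → ℝ) → 𝒳 m) inferInstance
      ≤ (inferInstance : MeasurableSpace (𝒳 m × (Fin K → ℝ))) := measurable_fst.comap_le
  have h0 : 0 ≤ᵐ[env.law m] fun z => z.2 a := by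
    filter_upwards [env.reward_mem m] with z hz using (hz a).1
  have h1 : (fun z => z.2 a) ≤ᵐ[env.law m] fun _ => (1 : ℝ) := by
    filter_upwards [env.reward_mem m] with z hz using (hz a).2
  have h2 := condExp_mono (m := MeasurableSpace.comap Prod.fst inferInstance)
    (env.integrable_reward m a) (integrable_const 1) h1
  rw [condExp_const hle] at h2
  filter_upwards [condExp_nonneg (m := MeasurableSpace.comap Prod.fst inferInstance) h0, h2,
    env.condExp_reward m a] with z e0 e1 e2
  rw [e2] at e0 e1
  exact ⟨e0, e1⟩

lemma LinearEnv.integral_mul_noise (m : Fin M) (a : Fin K) {g : 𝒳 m → ℝ} (hg : Measurable g) {C : ℝ}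
    (hC : ∀ x, |g x| ≤ C) :
    Integrable (fun z => g z.1 * (z.2 a - env.mean m z.1 a)) (env.law m) ∧
    ∫ z, g z.1 * (z.2 a - env.mean m z.1 a) ∂env.law m = 0 := by
  have hle : MeasurableSpace.comap (Prod.fst : 𝒳 m × (Fin K → ℝ) → 𝒳 m) inferInstance
      ≤ (inferInstance : MeasurableSpace (𝒳 m × (Fin K → ℝ))) := measurable_fst.comap_le
  have hgs : StronglyMeasurable[MeasurableSpace.comap Prod.fst inferInstance]
      fun z : 𝒳 m × (Fin K → ℝ) => g z.1 :=
    Measurable.stronglyMeasurable (hg.comp (comap_measurable Prod.fst))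
  have hr := env.integrable_reward m a
  have hb : ∀ᵐ z ∂env.law m, ‖g z.1‖ ≤ C := ae_of_all _ fun z => hC z.1
  have hi1 : Integrable (fun z => g z.1 * z.2 a) (env.law m) :=
    hr.bdd_mul (hg.comp measurable_fst).aestronglyMeasurable hb
  have hmean : Integrable (fun z => env.mean m z.1 a) (env.law m) :=
    integrable_condExp.congr (env.condExp_reward m a)
  have hi2 : Integrable (fun z => g z.1 * env.mean m z.1 a) (env.law m) :=
    hmean.bdd_mul (hg.comp measurable_fst).aestronglyMeasurable hb
  have h1 := condExp_stronglyMeasurable_mul_of_bound hle hgs hr C hb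
  have h2 : ∫ z, g z.1 * z.2 a ∂env.law m = ∫ z, g z.1 * env.mean m z.1 a ∂env.law m := by
    rw [← integral_condExp hle]
    refine integral_congr_ae ?_
    filter_upwards [h1, env.condExp_reward m a] with z e1 e2
    change _ = g z.1 * inner ℝ env.trueParam (env.feature m z.1 a)
    rw [← e2]; exact e1
  simp only [mul_sub]
  exact ⟨hi1.sub hi2, by rw [integral_sub hi1 hi2, h2, sub_self]⟩

variable [NeZero K]

/-- The sample that agent `m` records for the draw `w`. -/
def LinearEnv.sample (γ : ℝ) (m : Fin M) (θ : Vec d) (w : Draw K 𝒳 m) : Vec d × ℝ :=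
  (env.feature m w.1.1 (chooseArm (env.feature m) γ θ w.1.1 w.2),
    w.1.2 (chooseArm (env.feature m) γ θ w.1.1 w.2))

/-- The law of the draws of agent `m`. -/
def LinearEnv.drawLaw (m : Fin M) : Measure (Draw K 𝒳 m) :=
  (env.law m).prod (volume.restrict (Set.Icc (0 : ℝ) 1))

/-- The law of the samples of agent `m` when the estimate `θ` is used. -/
def LinearEnv.sampleLaw (γ : ℝ) (θ : Vec d) (m : Fin M) : Measure (Vec d × ℝ) :=
  (env.drawLaw m).map (env.sample γ m θ)

lemma LinearEnv.measurable_sample (γ : ℝ) (m : Fin M) {Ω : Type*} [MeasurableSpace Ω]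
    {θ : Ω → Vec d} {w : Ω → Draw K 𝒳 m} (hθ : Measurable θ) (hw : Measurable w) :
    Measurable fun ω => env.sample γ m (θ ω) (w ω) := by
  have ha := measurable_chooseArm (φ := env.feature m) (env.measurable_feature m) γ hθ hw.fst.fst
    hw.snd
  exact (measurable_eval_arm (f := fun ω a => env.feature m (w ω).1.1 a)
      (fun a => (env.measurable_feature m a).comp hw.fst.fst) ha).prodMk
    (measurable_eval_arm (f := fun ω a => (w ω).1.2 a)
      (fun a => (measurable_pi_apply a).comp hw.fst.snd) ha)

instance LinearEnv.isProbabilityMeasure_drawLaw (m : Fin M) :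
    IsProbabilityMeasure (env.drawLaw m) := by
  have : IsProbabilityMeasure (volume.restrict (Set.Icc (0 : ℝ) 1)) := ⟨by simp⟩
  unfold LinearEnv.drawLaw; infer_instance

instance LinearEnv.isProbabilityMeasure_sampleLaw (γ : ℝ) (θ : Vec d) (m : Fin M) :
    IsProbabilityMeasure (env.sampleLaw γ θ m) :=
  Measure.isProbabilityMeasure_map
    (env.measurable_sample γ m measurable_const measurable_id).aemeasurable

/-- The action depends on the context and an independent seed only. Integrating out the seed leaves
a sum over actions of noise times a function of the context, and each term has mean zero. -/
lemma LinearEnv.isLinearSample_sampleLaw {γ : ℝ} (hγ : 0 ≤ γ) (θ : Vec d) (m : Fin M) :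
    IsLinearSample env.trueParam (env.sampleLaw γ θ m) := by
  have hs : Measurable (env.sample γ m θ) :=
    env.measurable_sample γ m measurable_const measurable_id
  constructor
  · have hmg : MeasurableSet (goodSample d) :=
      (measurableSet_le measurable_fst.norm measurable_const).inter
        (measurable_snd measurableSet_Icc)
    refine (ae_map_iff hs.aemeasurable hmg).2 ?_
    filter_upwards [Measure.quasiMeasurePreserving_fst.ae (env.reward_mem m)] with w hw
    exact ⟨env.norm_feature_le _ _ _, hw _⟩
  · rintro g hg ⟨C, hC⟩
    have hm : Measurable fun z : Vec d × ℝ => (z.2 - inner ℝ env.trueParam z.1) * g z.1 :=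
      (measurable_snd.sub (measurable_const.inner measurable_fst)).mul (hg.comp measurable_fst)
    rw [LinearEnv.sampleLaw, integral_map hs.aemeasurable hm.aestronglyMeasurable]
    have hφ := env.measurable_feature m
    have hC0 : 0 ≤ C := (abs_nonneg _).trans (hC 0)
    have h1 := integral_chooseArm (φ := env.feature m) hφ hγ θ (env.law m)
      (G := fun z a => (z.2 a - env.mean m z.1 a) * g (env.feature m z.1 a)) (C := 2 * C)
      (fun a => (((measurable_pi_apply a).comp measurable_snd).sub
        (measurable_const.inner ((hφ a).comp measurable_fst))).mul
        (hg.comp ((hφ a).comp measurable_fst)))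
      (by
        filter_upwards [env.reward_mem m] with z hz a
        rw [abs_mul]
        have h2 := abs_residual_le env.norm_trueParam_le (z := (env.feature m z.1 a, z.2 a))
          ⟨env.norm_feature_le m z.1 a, hz a⟩
        exact mul_le_mul h2 (hC _) (abs_nonneg _) (by norm_num))
    refine h1.trans ?_
    have hp := isPolicy_igwProb hγ (f := fun (x : 𝒳 m) b => (inner ℝ θ (env.feature m x b) : ℝ))
      ⟨fun a => measurable_const.inner (hφ a), ‖θ‖, fun x a => (abs_real_inner_le_norm _ _).trans
        (mul_le_of_le_one_right (norm_nonneg _) (env.norm_feature_le _ _ _))⟩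
    have h3 := fun a => env.integral_mul_noise m a
      (g := fun x => igwProb γ (fun b => inner ℝ θ (env.feature m x b)) a * g (env.feature m x a))
      ((hp.measurable a).mul (hg.comp (hφ a))) (C := C) (fun x => by
        rw [abs_mul, abs_of_nonneg (hp.nonneg x a)]
        exact (mul_le_of_le_one_left (abs_nonneg _) (hp.le_one x a)).trans (hC _))
    have h4 : ∀ z : 𝒳 m × (Fin K → ℝ),
        ∑ a, igwProb γ (fun b => inner ℝ θ (env.feature m z.1 b)) a
          * ((z.2 a - env.mean m z.1 a) * g (env.feature m z.1 a))
        = ∑ a, igwProb γ (fun b => inner ℝ θ (env.feature m z.1 b)) a * g (env.feature m z.1 a)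
          * (z.2 a - env.mean m z.1 a) := fun z =>
      Finset.sum_congr rfl fun a _ => by ring
    simp_rw [h4]
    rw [integral_finsetSum _ fun a _ => (h3 a).1]
    exact Finset.sum_eq_zero fun a _ => (h3 a).2

lemma LinearEnv.isPolicy_igw {γ : ℝ} (hγ : 0 ≤ γ) (θ : Vec d) :
    IsPolicy fun x => igwProb γ (env.linReward θ x) :=
  isPolicy_igwProb hγ (env.isReward_linReward θ)

lemma LinearEnv.integral_policy {γ : ℝ} (hγ : 0 ≤ γ) (θ : Vec d) {f : (Σ m, 𝒳 m) → Fin K → ℝ}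
    (hf : IsReward f) :
    ∫ x, ∑ a, igwProb γ (env.linReward θ x) a * f x a ∂env.ctxMeasure
      = ∑ m, ∫ w, f ⟨m, w.1.1⟩ (chooseArm (env.feature m) γ θ w.1.1 w.2) ∂env.drawLaw m := by
  have hp := env.isPolicy_igw hγ θ
  obtain ⟨C, hC⟩ := hf.bounded
  rw [env.integral_ctxMeasure (C := C)
    (F := fun x => ∑ a, igwProb γ (env.linReward θ x) a * f x a)
    (Finset.measurable_fun_sum _ fun a _ => (hp.measurable a).mul (hf.measurable a)) fun x => ?_]
  · refine Finset.sum_congr rfl fun m _ => ?_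
    exact (integral_chooseArm (φ := env.feature m) (env.measurable_feature m) hγ θ (env.law m)
      (G := fun z a => f ⟨m, z.1⟩ a)
      (fun a => (hf.measurable a).comp (LinearEnv.measurable_ctx m)) (C := C)
      (ae_of_all _ fun z a => hC _ a)).symm
  · calc _ ≤ ∑ a, |igwProb γ (env.linReward θ x) a * f x a| := Finset.abs_sum_le_sum_abs _ _
      _ ≤ ∑ a, igwProb γ (env.linReward θ x) a * C := Finset.sum_le_sum fun a _ => by
        rw [abs_mul, abs_of_nonneg (hp.nonneg x a)]
        exact mul_le_mul_of_nonneg_left (hC x a) (hp.nonneg x a)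
      _ = C := by rw [← Finset.sum_mul, hp.sum_eq_one, one_mul]

lemma LinearEnv.sqDeviation_eq {γ : ℝ} (hγ : 0 ≤ γ) (θ θ' : Vec d) :
    sqDeviation env.ctxMeasure (env.linReward env.trueParam) (env.linReward θ')
        (fun x => igwProb γ (env.linReward θ x))
      = ∑ m, ∫ z, (inner ℝ (θ' - env.trueParam) z.1 : ℝ) ^ 2 ∂env.sampleLaw γ θ m := by
  have h := env.integral_policy hγ θ
    ((env.isReward_linReward env.trueParam).sub (env.isReward_linReward θ')).sq
  refine h.trans (Finset.sum_congr rfl fun m _ => ?_)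
  have hm : Measurable fun z : Vec d × ℝ => (inner ℝ (θ' - env.trueParam) z.1 : ℝ) ^ 2 :=
    (measurable_const.inner measurable_fst).pow_const 2
  have hs : Measurable (env.sample γ m θ) :=
    env.measurable_sample γ m measurable_const measurable_id
  rw [LinearEnv.sampleLaw, integral_map hs.aemeasurable hm.aestronglyMeasurable]
  refine integral_congr_ae (ae_of_all _ fun w => ?_)
  simp only [LinearEnv.linReward, LinearEnv.sample, inner_sub_left]
  ring

/-- The expected squared deviation of the estimate computed by `P` from samples collected with the
estimate `θ`. -/
lemma LinearEnv.integral_sqDeviation_run_le (hd : 1 ≤ d) {E : ℕ} (hE : 1 ≤ E) {γ c₀ : ℝ}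
    (hγ : 0 ≤ γ) (hc₀ : 0 ≤ c₀) (θ : Vec d) {P : FLProtocol M d E} (hP : P.ApproxRidge c₀) :
    let F := fun S : Fin M × Fin E → Vec d × ℝ =>
      sqDeviation env.ctxMeasure (env.linReward env.trueParam)
        (env.linReward (P.run fun m i => S (m, i))) fun x => igwProb γ (env.linReward θ x)
    Integrable F (Measure.pi fun j : Fin M × Fin E => env.sampleLaw γ θ j.1) ∧
    ∫ S, F S ∂(Measure.pi fun j : Fin M × Fin E => env.sampleLaw γ θ j.1)
      ≤ (1224 * c₀ + 40) * d / E := by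
  intro F
  set μ := Measure.pi fun j : Fin M × Fin E => env.sampleLaw γ θ j.1 with hμ
  obtain ⟨hi, hle⟩ := sum_integral_prediction_error_le (ω := env.trueParam)
    (ρ := fun j : Fin M × Fin E => env.sampleLaw γ θ j.1)
    (fun j => env.isLinearSample_sampleLaw hγ θ j.1) env.norm_trueParam_le hd hc₀ hP.1 hP.2
  have i0 : Fin E := ⟨0, hE⟩
  have hF : F = fun S => ∑ m, ∫ z, (inner ℝ ((P.run fun m i => S (m, i)) - env.trueParam) z.1 : ℝ) ^ 2
      ∂env.sampleLaw γ θ m := by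
    funext S; exact env.sqDeviation_eq hγ θ _
  have hint : ∀ m, Integrable (fun S : Fin M × Fin E → Vec d × ℝ =>
      ∫ z, (inner ℝ ((P.run fun m i => S (m, i)) - env.trueParam) z.1 : ℝ) ^ 2
        ∂env.sampleLaw γ θ m) μ := fun m => (hi (m, i0)).integral_prod_left
  have hE0 : (0 : ℝ) < E := by exact_mod_cast hE
  rw [hF]
  refine ⟨integrable_finsetSum _ fun m _ => hint m, ?_⟩
  rw [integral_finsetSum _ fun m _ => hint m, le_div_iff₀ hE0]
  refine le_trans (le_of_eq ?_) hle
  -- The samples of one agent share their law, so the sum over all samples is `E` times the sum over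
  -- agents.
  rw [Fintype.sum_prod_type, Finset.sum_mul]
  refine Finset.sum_congr rfl fun m _ => ?_
  have h1 : ∀ i : Fin E, ∫ p, (inner ℝ ((P.run fun m i => p.1 (m, i)) - env.trueParam) p.2.1 : ℝ) ^ 2
      ∂(μ.prod (env.sampleLaw γ θ m))
      = ∫ S, ∫ z, (inner ℝ ((P.run fun m i => S (m, i)) - env.trueParam) z.1 : ℝ) ^ 2
        ∂env.sampleLaw γ θ m ∂μ := fun i => integral_prod _ (hi (m, i))
  rw [Finset.sum_congr rfl fun i _ => h1 i]
  simp [mul_comm]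

end Environment

/-! ### Epochs -/

lemma epochEnd_mono : Monotone epochEnd := by
  refine monotone_nat_of_le_succ fun l => ?_
  cases l with
  | zero => exact Nat.zero_le _
  | succ l => exact Nat.pow_le_pow_right (by norm_num) (Nat.le_succ _)

lemma epochEnd_succ (l : ℕ) : epochEnd (l + 1) = 2 ^ (l + 1) := rfl

lemma epochLength_one : epochLength 1 = 2 := rfl

lemma epochLength_add_two (l : ℕ) : epochLength (l + 2) = 2 ^ (l + 1) := by
  simp only [epochLength, epochEnd_succ, show l + 2 - 1 = l + 1 by omega]
  rw [pow_succ 2 (l + 1)]; omega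

lemma two_le_epochLength (l : ℕ) : 2 ≤ epochLength (l + 1) := by
  cases l with
  | zero => rfl
  | succ l => rw [epochLength_add_two, pow_succ]; have := Nat.one_le_two_pow (n := l); omega

lemma epochLength_le_succ (l : ℕ) : epochLength (l + 1) ≤ epochLength (l + 2) := by
  cases l with
  | zero => rw [epochLength_add_two, epochLength_one]; norm_num
  | succ l =>
    rw [epochLength_add_two, epochLength_add_two]
    exact Nat.pow_le_pow_right (by norm_num) (by omega)

lemma epochLength_succ_le (l : ℕ) : epochLength (l + 2) ≤ 2 * epochLength (l + 1) := by
  cases l with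
  | zero => rw [epochLength_add_two, epochLength_one]; norm_num
  | succ l => rw [epochLength_add_two, epochLength_add_two, pow_succ 2 (l + 1)]; omega

lemma epochEnd_le (l : ℕ) : epochEnd (l + 2) ≤ 4 * epochLength (l + 1) := by
  cases l with
  | zero => rw [epochLength_one]; decide
  | succ l => rw [epochEnd_succ, epochLength_add_two, pow_succ 2 (l + 2), pow_succ 2 (l + 1)]; omega

lemma le_epochEnd_epochOf (t : ℕ) : t ≤ epochEnd (epochOf t) := by
  have h : {l : ℕ | t ≤ epochEnd l}.Nonempty :=
    ⟨t + 1, by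
      change t ≤ 2 ^ (t + 1)
      exact (Nat.lt_two_pow_self).le.trans (Nat.pow_le_pow_right (by norm_num) (Nat.le_succ t))⟩
  exact Nat.sInf_mem h

lemma epochOf_pos {t : ℕ} (ht : 1 ≤ t) : 1 ≤ epochOf t := by
  by_contra! h
  have h1 := le_epochEnd_epochOf t
  rw [show epochOf t = 0 by omega] at h1
  simp only [epochEnd, if_true] at h1
  omega

lemma two_le_epochOf {t : ℕ} (ht : 3 ≤ t) : 2 ≤ epochOf t := by
  by_contra! h
  have h1 := (le_epochEnd_epochOf t).trans (epochEnd_mono (show epochOf t ≤ 1 by omega))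
  have : epochEnd 1 = 2 := rfl
  omega

lemma epochEnd_pred_epochOf_lt {t : ℕ} (ht : 1 ≤ t) : epochEnd (epochOf t - 1) < t := by
  have h : epochOf t - 1 < epochOf t := by have := epochOf_pos ht; omega
  exact not_le.1 fun h2 => Nat.notMem_of_lt_sInf h h2

/-! ### The estimates are functions of the past -/

section Estimate

variable {M K d : ℕ} {𝒳 : Fin M → Type*} [∀ m, MeasurableSpace (𝒳 m)]
  (env : LinearEnv K d 𝒳) [NeZero K] (γ : ℕ → ℝ) {FL : ∀ E, FLProtocol M d E}

lemma estimate_add_two (w : ∀ m : Fin M, ℕ → Draw K 𝒳 m) (l : ℕ) :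
    estimate env.feature γ FL w (l + 2) = (FL (epochLength (l + 1))).run fun m i =>
      env.sample (γ (l + 1)) m (estimate env.feature γ FL w (l + 1)) (w m (epochEnd l + 1 + i)) := by
  rw [estimate]
  rfl

/-- The recursion only reads draws up to the end of the preceding epoch; this causality gives
independence of the estimate from the current draws. -/
lemma estimate_congr {w w' : ∀ m : Fin M, ℕ → Draw K 𝒳 m} (l : ℕ)
    (h : ∀ m t, t ≤ epochEnd (l - 1) → w m t = w' m t) :
    estimate env.feature γ FL w l = estimate env.feature γ FL w' l := by
  match l with
  | 0 => rw [estimate, estimate]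
  | 1 => rw [estimate, estimate]
  | l + 2 =>
    have h1 : estimate env.feature γ FL w (l + 1) = estimate env.feature γ FL w' (l + 1) :=
      estimate_congr (l + 1) fun m t ht => h m t (ht.trans (epochEnd_mono (by omega)))
    rw [estimate_add_two, estimate_add_two, h1]
    congr 1
    funext m i
    rw [h m]
    have h2 := i.2
    have h3 := epochEnd_mono (Nat.le_succ l)
    simp only [epochLength, show l + 1 - 1 = l by omega, Nat.succ_eq_add_one] at h2 h3
    simp only [show l + 2 - 1 = l + 1 by omega]
    omega

lemma measurable_estimate {c₀ : ℝ} (hFL : ∀ E, 1 ≤ E → (FL E).ApproxRidge c₀) (l : ℕ) :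
    Measurable fun w : ∀ m : Fin M, ℕ → Draw K 𝒳 m => estimate env.feature γ FL w l := by
  match l with
  | 0 => simp only [estimate]; exact measurable_const
  | 1 => simp only [estimate]; exact measurable_const
  | l + 2 =>
    simp only [estimate_add_two]
    have hE : 1 ≤ epochLength (l + 1) := by have := two_le_epochLength l; omega
    have h1 := measurable_estimate hFL (l + 1)
    refine (hFL _ hE).1.comp (g := fun S : Fin M × Fin (epochLength (l + 1)) → Vec d × ℝ =>
      (FL (epochLength (l + 1))).run fun m i => S (m, i)) (f := fun w j =>
      env.sample (γ (l + 1)) j.1 (estimate env.feature γ FL w (l + 1))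
        (w j.1 (epochEnd l + 1 + j.2))) (measurable_pi_lambda _ fun j => ?_)
    exact env.measurable_sample _ _ h1
      ((measurable_pi_apply (epochEnd l + 1 + (j.2 : ℕ))).comp (measurable_pi_apply j.1))

variable {Ω : Type*} [MeasurableSpace Ω] {P : Measure Ω} [IsProbabilityMeasure P]
  {W : ∀ m : Fin M, ℕ → Ω → Draw K 𝒳 m}

/-- The estimate used in epoch `l` is independent of the draws in any finite set of later steps. -/
lemma indepFun_estimate (hW : IsInteraction env P W) {c₀ : ℝ}
    (hFL : ∀ E, 1 ≤ E → (FL E).ApproxRidge c₀) (l : ℕ) (T : Finset (Fin M × ℕ))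
    (hT : ∀ j ∈ T, epochEnd (l - 1) < j.2) :
    IndepFun (fun ω => estimate env.feature γ FL (fun m t => W m t ω) l)
      (fun ω (j : T) => W j.1.1 j.1.2 ω) P := by
  obtain ⟨ω₀⟩ : Nonempty Ω := nonempty_of_isProbabilityMeasure P
  set S : Finset (Fin M × ℕ) := Finset.univ ×ˢ Finset.range (epochEnd (l - 1) + 1) with hS
  have hST : Disjoint S T := by
    rw [Finset.disjoint_left]
    intro j hj hjT
    have h1 := hT j hjT
    simp only [hS, Finset.mem_product, Finset.mem_univ, true_and, Finset.mem_range] at hj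
    omega
  have hind := hW.indep.indepFun_finset S T hST fun j => hW.measurable j.1 j.2
  -- Finitely many past draws are padded to a full path with the values at a fixed outcome, which
  -- the estimate never reads.
  let ext : (∀ j : S, Draw K 𝒳 j.1.1) → ∀ m : Fin M, ℕ → Draw K 𝒳 m := fun v m t =>
    if h : (m, t) ∈ S then v ⟨(m, t), h⟩ else W m t ω₀
  have hext : Measurable ext := by
    refine measurable_pi_lambda _ fun m => measurable_pi_lambda _ fun t => ?_
    by_cases h : (m, t) ∈ S
    · simp only [ext, dif_pos h]; exact measurable_pi_apply _
    · simp only [ext, dif_neg h]; exact measurable_const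
  have h1 := hind.comp ((measurable_estimate env γ hFL l).comp hext) measurable_id
  refine h1.congr (ae_of_all _ fun ω => ?_) (ae_of_all _ fun ω => rfl)
  refine estimate_congr env γ l fun m t ht => ?_
  have h : (m, t) ∈ S := by simp [hS]; omega
  simp only [ext, dif_pos h]

omit [IsProbabilityMeasure P] in
lemma measurable_estimate_comp (hW : IsInteraction env P W) {c₀ : ℝ}
    (hFL : ∀ E, 1 ≤ E → (FL E).ApproxRidge c₀) (l : ℕ) :
    Measurable fun ω => estimate env.feature γ FL (fun m t => W m t ω) l :=
  (measurable_estimate env γ hFL l).comp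
    (measurable_pi_lambda _ fun m => measurable_pi_lambda _ fun t => hW.measurable m t)

lemma indepFun_estimate_draw (hW : IsInteraction env P W) {c₀ : ℝ}
    (hFL : ∀ E, 1 ≤ E → (FL E).ApproxRidge c₀) (m : Fin M) {t : ℕ} (ht : 1 ≤ t) :
    IndepFun (fun ω => estimate env.feature γ FL (fun m t => W m t ω) (epochOf t)) (W m t) P := by
  have h := indepFun_estimate env γ hW hFL (epochOf t) {(m, t)} fun j hj => by
    rw [Finset.mem_singleton.1 hj]; exact epochEnd_pred_epochOf_lt ht
  exact h.comp measurable_id (measurable_pi_apply (⟨(m, t), by simp⟩ : ({(m, t)} : Finset _)))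

/-- The draws of epoch `l + 1`. -/
def epochDraws (W : ∀ m : Fin M, ℕ → Ω → Draw K 𝒳 m) (l : ℕ) (ω : Ω)
    (j : Fin M × Fin (epochLength (l + 1))) : Draw K 𝒳 j.1 := W j.1 (epochEnd l + 1 + j.2) ω

lemma indepFun_estimate_epochDraws (hW : IsInteraction env P W) {c₀ : ℝ}
    (hFL : ∀ E, 1 ≤ E → (FL E).ApproxRidge c₀) (l : ℕ) :
    IndepFun (fun ω => estimate env.feature γ FL (fun m t => W m t ω) (l + 1))
      (epochDraws W l) P := by
  have h := indepFun_estimate env γ hW hFL (l + 1)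
    (Finset.univ ×ˢ Finset.Ioc (epochEnd l) (epochEnd l + epochLength (l + 1))) fun j hj => by
      simp only [Finset.mem_product, Finset.mem_Ioc] at hj
      exact hj.2.1
  have hmem : ∀ j : Fin M × Fin (epochLength (l + 1)), (j.1, epochEnd l + 1 + (j.2 : ℕ)) ∈
      (Finset.univ ×ˢ Finset.Ioc (epochEnd l) (epochEnd l + epochLength (l + 1)) :
        Finset (Fin M × ℕ)) := fun j => by
    have := j.2.2
    simp only [Finset.mem_product, Finset.mem_univ, true_and, Finset.mem_Ioc]
    omega
  exact h.comp (ψ := fun v (j : Fin M × Fin (epochLength (l + 1))) =>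
      v ⟨(j.1, epochEnd l + 1 + (j.2 : ℕ)), hmem j⟩)
    measurable_id (measurable_pi_lambda _ fun j => measurable_pi_apply _)

omit [NeZero K] in
lemma map_epochDraws (hW : IsInteraction env P W) (l : ℕ) :
    P.map (epochDraws W l) = Measure.pi fun j => env.drawLaw j.1 := by
  have hinj : Function.Injective fun j : Fin M × Fin (epochLength (l + 1)) =>
      ((j.1, epochEnd l + 1 + (j.2 : ℕ)) : Fin M × ℕ) := by
    intro a b hab
    simp only [Prod.mk.injEq] at hab
    exact Prod.ext hab.1 (Fin.ext (by omega))
  have h := hW.indep.precomp hinj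
  rw [iIndepFun_iff_map_fun_eq_pi_map fun j => (hW.measurable _ _).aemeasurable] at h
  refine h.trans ?_
  congr 1
  funext j
  exact hW.law_eq _ _

omit [NeZero K] [IsProbabilityMeasure P] in
lemma measurable_epochDraws (hW : IsInteraction env P W) (l : ℕ) : Measurable (epochDraws W l) :=
  measurable_pi_lambda _ fun _ => hW.measurable _ _

omit [NeZero K] in
lemma measurable_linReward {α : Type*} [MeasurableSpace α] {θ : α → Vec d} {x : α → Σ m, 𝒳 m}
    (hθ : Measurable θ) (hx : Measurable x) (a : Fin K) :
    Measurable fun z => env.linReward (θ z) (x z) a := by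
  have h : Measurable fun y : Σ m, 𝒳 m => env.feature y.1 y.2 a :=
    measurable_of_sigma fun m => env.measurable_feature m a
  exact hθ.inner (h.comp hx)

lemma measurable_igw_linReward (g : ℝ) {α : Type*} [MeasurableSpace α] {θ : α → Vec d}
    {x : α → Σ m, 𝒳 m} (hθ : Measurable θ) (hx : Measurable x) (a : Fin K) :
    Measurable fun z => igwProb g (env.linReward (θ z) (x z)) a :=
  (measurable_igwProb g a).comp (measurable_pi_lambda _ fun b => measurable_linReward env hθ hx b)

/-- The squared deviation of the estimate `θ'` computed from samples collected with `θ`. -/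
def LinearEnv.sqError (g : ℝ) (θ θ' : Vec d) : ℝ :=
  sqDeviation env.ctxMeasure (env.linReward env.trueParam) (env.linReward θ')
    fun x => igwProb g (env.linReward θ x)

lemma measurable_sqError (g : ℝ) {α : Type*} [MeasurableSpace α] {θ θ' : α → Vec d}
    (hθ : Measurable θ) (hθ' : Measurable θ') : Measurable fun z => env.sqError g (θ z) (θ' z) := by
  unfold LinearEnv.sqError sqDeviation
  refine StronglyMeasurable.measurable (StronglyMeasurable.integral_prod_right
    (f := fun z x => ∑ a, igwProb g (env.linReward (θ z) x) a
      * (env.linReward env.trueParam x a - env.linReward (θ' z) x a) ^ 2)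
    (Measurable.stronglyMeasurable ?_))
  refine Finset.measurable_fun_sum _ fun a _ => ?_
  exact (measurable_igw_linReward env g (hθ.comp measurable_fst) measurable_snd a).mul
    (((measurable_linReward env measurable_const measurable_snd a).sub
      (measurable_linReward env (hθ'.comp measurable_fst) measurable_snd a)).pow_const 2)

lemma sqError_nonneg {g : ℝ} (hg : 0 ≤ g) (θ θ' : Vec d) : 0 ≤ env.sqError g θ θ' :=
  sqDeviation_nonneg _ _ _ (env.isPolicy_igw hg θ)

/-- The expectation of a function of two independent random variables, the second of which has
a known law. -/
lemma integral_of_indepFun {α β : Type*} [MeasurableSpace α] [MeasurableSpace β] {X : Ω → α}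
    {Y : Ω → β} (hX : Measurable X) (hY : Measurable Y) (h : IndepFun X Y P) {κ : Measure β}
    [IsProbabilityMeasure κ] (hκ : P.map Y = κ) {H : α → β → ℝ} (hH : Measurable (Function.uncurry H))
    (h0 : ∀ x y, 0 ≤ H x y) (hi : ∀ x, Integrable (H x) κ) {C : ℝ} (hC : ∀ x, ∫ y, H x y ∂κ ≤ C) :
    Integrable (fun ω => H (X ω) (Y ω)) P ∧ Integrable (fun ω => ∫ y, H (X ω) y ∂κ) P ∧
      ∫ ω, H (X ω) (Y ω) ∂P = ∫ ω, ∫ y, H (X ω) y ∂κ ∂P := by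
  have hp := Measure.isProbabilityMeasure_map (μ := P) hX.aemeasurable
  have hmap : P.map (fun ω => (X ω, Y ω)) = (P.map X).prod κ := by
    rw [(indepFun_iff_map_prod_eq_prod_map_map hX.aemeasurable hY.aemeasurable).1 h, hκ]
  have hmeas : StronglyMeasurable fun x => ∫ y, H x y ∂κ :=
    hH.stronglyMeasurable.integral_prod_right
  have hbd : ∀ x, ‖∫ y, H x y ∂κ‖ ≤ C := fun x => by
    rw [Real.norm_eq_abs, abs_of_nonneg (integral_nonneg (h0 x))]; exact hC x
  have hint : Integrable (Function.uncurry H) ((P.map X).prod κ) := by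
    rw [integrable_prod_iff hH.aestronglyMeasurable]
    refine ⟨ae_of_all _ hi, ?_⟩
    have : (fun x => ∫ y, ‖Function.uncurry H (x, y)‖ ∂κ) = fun x => ∫ y, H x y ∂κ := by
      funext x
      refine integral_congr_ae (ae_of_all _ fun y => ?_)
      exact abs_of_nonneg (h0 x y)
    rw [this]
    exact Integrable.of_bound hmeas.aestronglyMeasurable C (ae_of_all _ hbd)
  refine ⟨?_, Integrable.of_bound (hmeas.comp_measurable hX).aestronglyMeasurable C
    (ae_of_all _ fun ω => hbd (X ω)), ?_⟩
  · rw [← hmap] at hint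
    exact hint.comp_measurable (hX.prodMk hY)
  · have h1 := integral_prod _ hint
    have h2 : ∫ z, Function.uncurry H z ∂((P.map X).prod κ) = ∫ ω, H (X ω) (Y ω) ∂P := by
      rw [← hmap, integral_map (hX.prodMk hY).aemeasurable hH.aestronglyMeasurable]
      rfl
    rw [← h2, h1]
    exact integral_map hX.aemeasurable hmeas.aestronglyMeasurable

variable {γ}

/-- The expected squared error of the estimate of epoch `l + 2`. -/
lemma integral_sqError_estimate_le (hW : IsInteraction env P W) {c₀ : ℝ} (hc₀ : 0 ≤ c₀)
    (hFL : ∀ E, 1 ≤ E → (FL E).ApproxRidge c₀) (hγ : ∀ l, 0 ≤ γ l) (hd : 1 ≤ d) (l : ℕ) :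
    let θ := fun (k : ℕ) (ω : Ω) => estimate env.feature γ FL (fun m t => W m t ω) k
    Integrable (fun ω => env.sqError (γ (l + 1)) (θ (l + 1) ω) (θ (l + 2) ω)) P ∧
    ∫ ω, env.sqError (γ (l + 1)) (θ (l + 1) ω) (θ (l + 2) ω) ∂P
      ≤ (1224 * c₀ + 40) * d / epochLength (l + 1) := by
  intro θ
  have hE : 1 ≤ epochLength (l + 1) := by have := two_le_epochLength l; omega
  set g := γ (l + 1)
  have hg : 0 ≤ g := hγ _
  have hP := hFL _ hE
  set κ := Measure.pi fun j : Fin M × Fin (epochLength (l + 1)) => env.drawLaw j.1 with hκ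
  let out : (Fin M × Fin (epochLength (l + 1)) → Vec d × ℝ) → Vec d :=
    fun S => (FL (epochLength (l + 1))).run fun m i => S (m, i)
  let H : Vec d → (∀ j : Fin M × Fin (epochLength (l + 1)), Draw K 𝒳 j.1) → ℝ := fun ϑ D =>
    env.sqError g ϑ (out fun j => env.sample g j.1 ϑ (D j))
  have hH : Measurable (Function.uncurry H) := by
    have hin : Measurable fun (z : Vec d × ∀ j : Fin M × Fin (epochLength (l + 1)),
        Draw K 𝒳 j.1) j => env.sample g j.1 z.1 (z.2 j) := measurable_pi_lambda _ fun j =>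
      env.measurable_sample g j.1 measurable_fst ((measurable_pi_apply j).comp measurable_snd)
    have hout : Measurable out := hP.1
    exact measurable_sqError env g measurable_fst (hout.comp hin)
  have hS : ∀ ϑ, Measurable fun (D : ∀ j : Fin M × Fin (epochLength (l + 1)), Draw K 𝒳 j.1) j =>
      env.sample g j.1 ϑ (D j) := fun ϑ => measurable_pi_lambda _ fun j =>
    env.measurable_sample g j.1 measurable_const (measurable_pi_apply j)
  have hmap : ∀ ϑ, κ.map (fun D j => env.sample g j.1 ϑ (D j))
      = Measure.pi fun j : Fin M × Fin (epochLength (l + 1)) => env.sampleLaw g ϑ j.1 := fun ϑ => by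
    rw [hκ]
    exact Measure.pi_map_pi fun j =>
      (env.measurable_sample g j.1 measurable_const measurable_id).aemeasurable
  -- For a frozen parameter the samples are independent, and the bound is uniform in the parameter,
  -- so it survives integration over the independent estimate.
  have hkey : ∀ ϑ, Integrable (H ϑ) κ ∧
      ∫ D, H ϑ D ∂κ ≤ (1224 * c₀ + 40) * d / epochLength (l + 1) := fun ϑ => by
    obtain ⟨h1, h2⟩ := env.integral_sqDeviation_run_le hd hE hg hc₀ ϑ hP
    rw [← hmap ϑ] at h1 h2
    refine ⟨h1.comp_measurable (hS ϑ), ?_⟩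
    rw [integral_map (hS ϑ).aemeasurable h1.aestronglyMeasurable] at h2
    exact h2
  obtain ⟨h1, h2, h3⟩ := integral_of_indepFun (P := P)
    (measurable_estimate_comp env γ hW hFL (l + 1)) (measurable_epochDraws env hW l)
    (indepFun_estimate_epochDraws env γ hW hFL l) (map_epochDraws env hW l) hH
    (fun ϑ D => sqError_nonneg env hg _ _) (fun ϑ => (hkey ϑ).1) (fun ϑ => (hkey ϑ).2)
  have heq : ∀ ω, H (θ (l + 1) ω) (epochDraws W l ω)
      = env.sqError g (θ (l + 1) ω) (θ (l + 2) ω) := fun ω => by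
    change _ = env.sqError g (θ (l + 1) ω) (estimate env.feature γ FL (fun m t => W m t ω) (l + 2))
    rw [estimate_add_two]
    rfl
  rw [funext heq] at h1 h3
  refine ⟨h1, h3.trans_le ?_⟩
  refine (integral_mono h2 (integrable_const _) fun ω => (hkey _).2).trans_eq ?_
  simp

end Estimate

/-! ### The expected regret -/

section Regret

variable {M K d : ℕ} {𝒳 : Fin M → Type*} [∀ m, MeasurableSpace (𝒳 m)]
  (env : LinearEnv K d 𝒳) [NeZero K] (γ : ℕ → ℝ)

/-- The additive error in the comparison of true and estimated regret in epoch `j + 2`, in terms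
of the squared errors of the estimates `θ`. -/
def LinearEnv.closeBound (θ : ℕ → Vec d) : ℕ → ℝ
  | 0 => M * K / γ 2 + γ 2 * env.sqError (γ 1) (θ 1) (θ 2)
  | j + 1 => LinearEnv.closeBound θ j / 3 + M * K / (3 * γ (j + 2))
      + 16 / 3 * γ (j + 2) * env.sqError (γ (j + 2)) (θ (j + 2)) (θ (j + 3))

lemma LinearEnv.regretClose_closeBound (hγ : ∀ l, 0 < γ l) {θ : ℕ → Vec d} (hθ : θ 1 = 0) (j : ℕ) :
    RegretClose env.ctxMeasure (env.linReward env.trueParam) (env.linReward (θ (j + 2)))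
      (env.closeBound γ θ j) := by
  induction j with
  | zero =>
    have h := regretClose_of_zero (ν := env.ctxMeasure) (env.isReward_linReward env.trueParam)
      (env.isReward_linReward (θ 2)) (hγ 1).le (hγ 2)
    have h0 : env.linReward 0 = fun _ _ => 0 := by
      funext x a; simp [LinearEnv.linReward]
    rw [LinearEnv.closeBound, LinearEnv.sqError, hθ, h0]
    rwa [env.ctxMeasure_univ] at h
  | succ j ih =>
    have h := ih.step (env.isReward_linReward _) (env.isReward_linReward _)
      (env.isReward_linReward (θ (j + 3))) (hγ (j + 2))
    rwa [env.ctxMeasure_univ] at h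

lemma LinearEnv.integral_closeBound_le {Ω : Type*} [MeasurableSpace Ω] {P : Measure Ω}
    [IsProbabilityMeasure P] (hγ : ∀ l, 0 < γ l) {θ : ℕ → Ω → Vec d} {A : ℝ} (hA : 0 ≤ A)
    (hstep : ∀ l, γ (l + 3) ≤ 3 / 2 * γ (l + 2))
    (he : ∀ l, Integrable (fun ω => env.sqError (γ (l + 1)) (θ (l + 1) ω) (θ (l + 2) ω)) P)
    (he0 : γ 2 * ∫ ω, env.sqError (γ 1) (θ 1 ω) (θ 2 ω) ∂P ≤ A * (M * K / γ 2))
    (hes : ∀ l, γ (l + 2) * ∫ ω, env.sqError (γ (l + 2)) (θ (l + 2) ω) (θ (l + 3) ω) ∂P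
      ≤ A * (M * K / γ (l + 2))) (j : ℕ) :
    Integrable (fun ω => env.closeBound γ (fun k => θ k ω) j) P ∧
    ∫ ω, env.closeBound γ (fun k => θ k ω) j ∂P ≤ (16 * A + 1) * (M * K / γ (j + 2)) := by
  have hMK : ∀ l, 0 ≤ (M : ℝ) * K / γ l := fun l => div_nonneg (by positivity) (hγ l).le
  induction j with
  | zero =>
    simp only [LinearEnv.closeBound]
    have h1 := (he 0).const_mul (γ 2)
    refine ⟨(integrable_const _).add h1, ?_⟩
    rw [integral_add (integrable_const _) h1, integral_const_mul]
    simp only [integral_const, probReal_univ, one_smul]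
    have := mul_nonneg hA (hMK 2)
    linarith
  | succ j ih =>
    obtain ⟨h1, h2⟩ := ih
    simp only [LinearEnv.closeBound]
    have h3 := (he (j + 1)).const_mul (16 / 3 * γ (j + 2))
    have h4 : Integrable (fun ω => env.closeBound γ (fun k => θ k ω) j / 3
        + M * K / (3 * γ (j + 2))) P := (h1.div_const 3).add (integrable_const _)
    refine ⟨h4.add h3, ?_⟩
    rw [integral_add h4 h3, integral_add (h1.div_const 3) (integrable_const _), integral_div,
      integral_const_mul]
    simp only [integral_const, probReal_univ, one_smul]
    have h5 := hes j
    have h6 : (M : ℝ) * K / (3 * γ (j + 2)) = M * K / γ (j + 2) / 3 := by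
      rw [div_div, mul_comm 3]
    have h7 : (M : ℝ) * K / γ (j + 2) ≤ 3 / 2 * (M * K / γ (j + 3)) := by
      rw [mul_div_assoc', div_le_div_iff₀ (hγ _) (hγ _)]
      have := mul_le_mul_of_nonneg_left (hstep j) (show 0 ≤ (M : ℝ) * K by positivity)
      linarith
    rw [h6]
    -- The constant is a fixed point: `((16 A + 1) / 3 + 1 / 3 + 16 A / 3) * (3 / 2) = 16 A + 1`.
    -- Growth of the rate by at most `3 / 2` is beaten by the contraction `1 / 3`.
    have h8 := mul_le_mul_of_nonneg_left h7 (show 0 ≤ (32 * A + 2) / 3 by positivity)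
    nlinarith [hMK (j + 2), hMK (j + 3)]

variable {FL : ∀ E, FLProtocol M d E}
  {Ω : Type*} [MeasurableSpace Ω] {P : Measure Ω} [IsProbabilityMeasure P]
  {W : ∀ m : Fin M, ℕ → Ω → Draw K 𝒳 m}

omit [NeZero K] in
lemma LinearEnv.abs_mean_le (m : Fin M) (x : 𝒳 m) (a : Fin K) : |env.mean m x a| ≤ 1 :=
  (abs_real_inner_le_norm _ _).trans
    (mul_le_one₀ env.norm_trueParam_le (norm_nonneg _) (env.norm_feature_le _ _ _))

lemma LinearEnv.gap_mean_le (m : Fin M) (x : 𝒳 m) (a : Fin K) : gap (env.mean m x) a ≤ 2 := by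
  have h1 := abs_le.1 (env.abs_mean_le m x a)
  have h2 := abs_le.1 (env.abs_mean_le m x (argmaxArm (env.mean m x)))
  unfold gap
  linarith [h1.1, h2.2]

lemma LinearEnv.measurable_gap_mean (g : ℝ) (m : Fin M) {α : Type*} [MeasurableSpace α]
    {θ : α → Vec d} {w : α → Draw K 𝒳 m} (hθ : Measurable θ) (hw : Measurable w) :
    Measurable fun z => gap (env.mean m (w z).1.1)
      (chooseArm (env.feature m) g (θ z) (w z).1.1 (w z).2) := by
  refine measurable_eval_arm (f := fun z a => gap (env.mean m (w z).1.1) a) (fun a => ?_)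
    (measurable_chooseArm (env.measurable_feature m) g hθ hw.fst.fst hw.snd)
  exact (measurable_gap a).comp (measurable_pi_lambda _ fun b =>
    measurable_const.inner ((env.measurable_feature m b).comp hw.fst.fst))

/-- The regret of agent `m` at time `t`. -/
def LinearEnv.stepRegret (FL : ∀ E, FLProtocol M d E) (W : ∀ m : Fin M, ℕ → Ω → Draw K 𝒳 m)
    (m : Fin M) (t : ℕ) (ω : Ω) : ℝ :=
  gap (env.mean m (W m t ω).1.1) (action env.feature γ FL (fun m t => W m t ω) m t)

lemma LinearEnv.integrable_stepRegret (hW : IsInteraction env P W) {c₀ : ℝ}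
    (hFL : ∀ E, 1 ≤ E → (FL E).ApproxRidge c₀) (m : Fin M) (t : ℕ) :
    Integrable (env.stepRegret γ FL W m t) P := by
  have hm : Measurable (env.stepRegret γ FL W m t) :=
    env.measurable_gap_mean (γ (epochOf t)) m
      (measurable_estimate_comp env γ hW hFL (epochOf t)) (hW.measurable m t)
  refine Integrable.of_bound hm.aestronglyMeasurable 2 (ae_of_all _ fun ω => ?_)
  rw [Real.norm_eq_abs, LinearEnv.stepRegret, abs_of_nonneg (gap_nonneg _ _)]
  exact env.gap_mean_le _ _ _

lemma LinearEnv.integral_stepRegret_le_one (hW : IsInteraction env P W) {c₀ : ℝ}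
    (hFL : ∀ E, 1 ≤ E → (FL E).ApproxRidge c₀) (m : Fin M) (t : ℕ) :
    ∫ ω, env.stepRegret γ FL W m t ω ∂P ≤ 1 := by
  have h1 : ∀ᵐ w ∂(env.drawLaw m), ∀ a, env.mean m w.1.1 a ∈ Set.Icc (0 : ℝ) 1 :=
    Measure.quasiMeasurePreserving_fst.ae (env.ae_mean_mem m)
  have h2 : ∀ᵐ ω ∂P, ∀ a, env.mean m (W m t ω).1.1 a ∈ Set.Icc (0 : ℝ) 1 := by
    rw [LinearEnv.drawLaw, ← hW.law_eq m t] at h1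
    exact ae_of_ae_map (hW.measurable m t).aemeasurable h1
  have h3 : ∫ ω, env.stepRegret γ FL W m t ω ∂P ≤ ∫ _ω, (1 : ℝ) ∂P := by
    refine integral_mono_ae (env.integrable_stepRegret γ hW hFL m t) (integrable_const _) ?_
    filter_upwards [h2] with ω h
    unfold LinearEnv.stepRegret gap
    linarith [(h (argmaxArm (env.mean m (W m t ω).1.1))).2,
      (h (action env.feature γ FL (fun m t => W m t ω) m t)).1]
  simpa using h3

variable {γ}

/-- The expected regret of all agents in one step. -/
lemma LinearEnv.sum_integral_stepRegret (hW : IsInteraction env P W) {c₀ : ℝ}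
    (hFL : ∀ E, 1 ≤ E → (FL E).ApproxRidge c₀) (hγ : ∀ l, 0 < γ l) {t : ℕ} (ht : 1 ≤ t) :
    let R := fun ω => policyRegret env.ctxMeasure (env.linReward env.trueParam) fun x =>
      igwProb (γ (epochOf t)) (env.linReward
        (estimate env.feature γ FL (fun m t => W m t ω) (epochOf t)) x)
    Integrable R P ∧ ∑ m, ∫ ω, env.stepRegret γ FL W m t ω ∂P = ∫ ω, R ω ∂P := by
  intro R
  set g := γ (epochOf t)
  let H : ∀ m, Vec d → Draw K 𝒳 m → ℝ := fun m ϑ w =>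
    gap (env.mean m w.1.1) (chooseArm (env.feature m) g ϑ w.1.1 w.2)
  have hH : ∀ m, Measurable (Function.uncurry (H m)) := fun m =>
    env.measurable_gap_mean g m measurable_fst measurable_snd
  have hb : ∀ m ϑ w, H m ϑ w ≤ 2 := fun m ϑ w => env.gap_mean_le _ _ _
  have hi : ∀ m ϑ, Integrable (H m ϑ) (env.drawLaw m) := fun m ϑ =>
    Integrable.of_bound ((hH m).comp measurable_prodMk_left).aestronglyMeasurable 2
      (ae_of_all _ fun w => by
        rw [Real.norm_eq_abs, abs_of_nonneg (gap_nonneg _ _)]; exact hb m ϑ w)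
  have hC : ∀ m ϑ, ∫ w, H m ϑ w ∂(env.drawLaw m) ≤ 2 := fun m ϑ => by
    have := integral_mono (hi m ϑ) (integrable_const (2 : ℝ)) fun w => hb m ϑ w
    simpa using this
  have key := fun m => integral_of_indepFun (P := P)
    (measurable_estimate_comp env γ hW hFL (epochOf t)) (hW.measurable m t)
    (indepFun_estimate_draw env γ hW hFL m ht) (κ := env.drawLaw m) (hW.law_eq m t) (hH m)
    (fun ϑ w => gap_nonneg _ _) (hi m) (hC m)
  have hR : R = fun ω => ∑ m, ∫ w, H m (estimate env.feature γ FL (fun m t => W m t ω) (epochOf t)) w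
      ∂(env.drawLaw m) := by
    funext ω
    exact env.integral_policy (hγ _).le _ (env.isReward_linReward env.trueParam).gap
  rw [hR]
  refine ⟨integrable_finsetSum _ fun m _ => (key m).2.1, ?_⟩
  rw [integral_finsetSum _ fun m _ => (key m).2.1]
  exact Finset.sum_congr rfl fun m _ => (key m).2.2

end Regret

/-! ### The learning rates -/

section LearningRate

variable {M K d : ℕ} [NeZero K]

omit [NeZero K] in
-- The choice `c = 1`, `p = 0` makes the rate balance the exploration cost `M K / γ` against `γ`
-- times the statistical error `d / E`.
lemma learningRate_sq (hM : 1 ≤ M) (hd : 1 ≤ d) (l : ℕ) :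
    learningRate 1 0 M K d (l + 2) ^ 2 = K * (M * epochLength (l + 1)) / d := by
  have hE : (0 : ℝ) < epochLength (l + 1) := by
    have := two_le_epochLength l; exact_mod_cast (by omega : 0 < epochLength (l + 1))
  have hM0 : (0 : ℝ) < M := by exact_mod_cast hM
  have hd0 : (0 : ℝ) < d := by exact_mod_cast hd
  rw [learningRate, if_neg (by omega)]
  simp only [show l + 2 - 1 = l + 1 by omega]
  rw [Real.sq_sqrt (by positivity)]
  field_simp

lemma learningRate_pos (hM : 1 ≤ M) (hd : 1 ≤ d) (l : ℕ) : 0 < learningRate 1 0 M K d l := by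
  match l with
  | 0 => simp [learningRate]
  | 1 => simp [learningRate]
  | l + 2 =>
    have hE : (0 : ℝ) < epochLength (l + 1) := by
      have := two_le_epochLength l; exact_mod_cast (by omega : 0 < epochLength (l + 1))
    have hM0 : (0 : ℝ) < M := by exact_mod_cast hM
    have hd0 : (0 : ℝ) < d := by exact_mod_cast hd
    have hK : (0 : ℝ) < K := by exact_mod_cast Nat.pos_of_ne_zero (NeZero.ne K)
    have h := learningRate_sq (K := K) hM hd l
    have h2 : 0 < learningRate 1 0 M K d (l + 2) ^ 2 := by rw [h]; positivity
    have h3 : 0 ≤ learningRate 1 0 M K d (l + 2) := by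
      rw [learningRate, if_neg (by omega)]; exact Real.sqrt_nonneg _
    exact lt_of_le_of_ne h3 fun h0 => by rw [← h0] at h2; simp at h2

lemma learningRate_succ_le (hM : 1 ≤ M) (hd : 1 ≤ d) (l : ℕ) :
    learningRate 1 0 M K d (l + 3) ≤ 3 / 2 * learningRate 1 0 M K d (l + 2) := by
  have hd0 : (0 : ℝ) < d := by exact_mod_cast hd
  refine le_of_sq_le_sq ?_ (by have := learningRate_pos (K := K) hM hd (l + 2); positivity)
  rw [mul_pow, learningRate_sq hM hd, learningRate_sq hM hd, mul_div_assoc',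
    div_le_div_iff_of_pos_right hd0]
  have h : (epochLength (l + 2) : ℝ) ≤ 2 * epochLength (l + 1) := by
    exact_mod_cast epochLength_succ_le l
  have h2 := mul_le_mul_of_nonneg_left h (show 0 ≤ (K : ℝ) * M by positivity)
  have h3 : 0 ≤ (K : ℝ) * M * epochLength (l + 1) := by positivity
  nlinarith

/-- The free length `E` covers two uses: errors from the epoch to which the rate is tuned, and
errors from the next, at least as long, epoch. -/
lemma learningRate_mul_le (hM : 1 ≤ M) (hd : 1 ≤ d) (l : ℕ) {A E x : ℝ} (hA : 0 ≤ A)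
    (hE : (epochLength (l + 1) : ℝ) ≤ E) (hx : x ≤ A * d / E) :
    learningRate 1 0 M K d (l + 2) * x ≤ A * (M * K / learningRate 1 0 M K d (l + 2)) := by
  have hg := learningRate_pos (K := K) hM hd (l + 2)
  have hs := learningRate_sq (K := K) hM hd l
  set g := learningRate 1 0 M K d (l + 2)
  have hE0 : (0 : ℝ) < epochLength (l + 1) := by
    have := two_le_epochLength l; exact_mod_cast (by omega : 0 < epochLength (l + 1))
  have hd0 : (0 : ℝ) < d := by exact_mod_cast hd
  have h1 : x ≤ A * d / epochLength (l + 1) :=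
    hx.trans (div_le_div_of_nonneg_left (by positivity) hE0 hE)
  rw [mul_div_assoc', le_div_iff₀ hg]
  calc g * x * g = g ^ 2 * x := by ring
    _ ≤ g ^ 2 * (A * d / epochLength (l + 1)) := mul_le_mul_of_nonneg_left h1 (sq_nonneg _)
    _ = A * (M * K) := by rw [hs]; field_simp

/-- The square of the left side is `M K d` divided by the length of epoch `l + 1`, and `t` is at
most four times that length. -/
lemma div_learningRate_le (hM : 1 ≤ M) (hd : 1 ≤ d) {t l : ℕ} (ht : 1 ≤ t)
    (h : t ≤ epochEnd (l + 2)) :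
    (M : ℝ) * K / learningRate 1 0 M K d (l + 2)
      ≤ 2 * Real.sqrt (M * K * d) * (1 / Real.sqrt t) := by
  have hg := learningRate_pos (K := K) hM hd (l + 2)
  have hs := learningRate_sq (K := K) hM hd l
  set g := learningRate 1 0 M K d (l + 2)
  have hE0 : (0 : ℝ) < epochLength (l + 1) := by
    have := two_le_epochLength l; exact_mod_cast (by omega : 0 < epochLength (l + 1))
  have hd0 : (0 : ℝ) < d := by exact_mod_cast hd
  have hM0 : (0 : ℝ) < M := by exact_mod_cast hM
  have hK : (0 : ℝ) < K := by exact_mod_cast Nat.pos_of_ne_zero (NeZero.ne K)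
  have ht0 : (0 : ℝ) < t := by exact_mod_cast ht
  have htE : (t : ℝ) ≤ 4 * epochLength (l + 1) := by exact_mod_cast h.trans (epochEnd_le l)
  refine le_of_sq_le_sq ?_ (by positivity)
  rw [mul_pow, mul_pow, div_pow, div_pow, Real.sq_sqrt (by positivity), Real.sq_sqrt ht0.le, hs,
    one_pow, mul_one_div, div_le_div_iff₀ (by positivity) ht0]
  have h2 : 2 ^ 2 * ((M : ℝ) * K * d) * (K * (M * epochLength (l + 1)) / d)
      = (M * K) ^ 2 * (4 * epochLength (l + 1)) := by field_simp; ring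
  rw [h2]
  exact mul_le_mul_of_nonneg_left htE (by positivity)

end LearningRate

/-- Each term is bounded by an increment of `2 √t`. -/
lemma sum_one_div_sqrt_le (T : ℕ) : ∑ t ∈ Finset.Icc 1 T, 1 / Real.sqrt t ≤ 2 * Real.sqrt T := by
  induction T with
  | zero => simp
  | succ T ih =>
    rw [Finset.sum_Icc_succ_top (by omega)]
    have h1 : (0 : ℝ) < ((T + 1 : ℕ) : ℝ) := by positivity
    have h2 := Real.sqrt_pos.2 h1
    have h3 : 1 / Real.sqrt ((T + 1 : ℕ) : ℝ)
        ≤ 2 * Real.sqrt ((T + 1 : ℕ) : ℝ) - 2 * Real.sqrt T := by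
      rw [div_le_iff₀ h2]
      have h4 := Real.sq_sqrt h1.le
      have h5 := Real.sq_sqrt (Nat.cast_nonneg (α := ℝ) T)
      push_cast at h4 ⊢
      push_cast at h2
      nlinarith [sq_nonneg (Real.sqrt ((T : ℝ) + 1) - Real.sqrt T)]
    linarith

/-- The expected regret of FedIGW with an approximate ridge regression protocol. -/
theorem integral_pathRegret_le {M K d : ℕ} {𝒳 : Fin M → Type*} [∀ m, MeasurableSpace (𝒳 m)]
    (env : LinearEnv K d 𝒳) [NeZero K] (hM : 1 ≤ M) (hd : 1 ≤ d) {FL : ∀ E, FLProtocol M d E}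
    {Ω : Type*} [MeasurableSpace Ω] {P : Measure Ω} [IsProbabilityMeasure P]
    {W : ∀ m : Fin M, ℕ → Ω → Draw K 𝒳 m} (hW : IsInteraction env P W) {c₀ : ℝ} (hc₀ : 0 ≤ c₀)
    (hFL : ∀ E, 1 ≤ E → (FL E).ApproxRidge c₀) (T : ℕ) :
    let R := fun ω => pathRegret env (learningRate 1 0 M K d) FL T fun m t => W m t ω
    Integrable R P ∧
    ∫ ω, R ω ∂P ≤ 2 * M + (78336 * c₀ + 2572) * Real.sqrt ((M : ℝ) * K * d * T) := by
  have hγ := learningRate_pos (K := K) hM hd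
  have hγs := learningRate_succ_le (K := K) hM hd
  have hγm := fun l => @learningRate_mul_le M K d _ hM hd l
  have hγd := fun t l => @div_learningRate_le M K d _ hM hd t l
  -- Only the four properties just recorded matter from here on.
  generalize learningRate 1 0 M K d = γ at hγ hγs hγm hγd ⊢
  intro R
  have hR : R = fun ω => ∑ m, ∑ t ∈ Finset.Icc 1 T, env.stepRegret γ FL W m t ω := rfl
  have hi := env.integrable_stepRegret γ hW hFL
  have hsum : ∫ ω, R ω ∂P = ∑ t ∈ Finset.Icc 1 T, ∑ m, ∫ ω, env.stepRegret γ FL W m t ω ∂P := by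
    rw [hR, integral_finsetSum _ fun m _ => integrable_finsetSum _ fun t _ => hi m t,
      Finset.sum_comm]
    exact Finset.sum_congr rfl fun m _ => integral_finsetSum _ fun t _ => hi m t
  refine ⟨by rw [hR]; exact integrable_finsetSum _ fun m _ => integrable_finsetSum _ fun t _ => hi m t,
    ?_⟩
  set A := 1224 * c₀ + 40 with hA
  have hA0 : 0 ≤ A := by positivity
  have hlate : ∀ t, 3 ≤ t → ∑ m, ∫ ω, env.stepRegret γ FL W m t ω ∂P
      ≤ (16 * A + 3) * (2 * Real.sqrt (M * K * d) * (1 / Real.sqrt t)) := fun t ht => by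
    obtain ⟨j, hj⟩ : ∃ j, epochOf t = j + 2 := ⟨epochOf t - 2, by have := two_le_epochOf ht; omega⟩
    have hreg := env.sum_integral_stepRegret hW hFL hγ (show 1 ≤ t by omega)
    have he := integral_sqError_estimate_le env hW hc₀ hFL (fun l => (hγ l).le) hd
    have hθ1 : ∀ ω, estimate env.feature γ FL (fun m t => W m t ω) 1 = 0 := fun ω => by rw [estimate]
    dsimp only at hreg he
    rw [hj] at hreg
    generalize hθ : (fun (k : ℕ) (ω : Ω) => estimate env.feature γ FL (fun m t => W m t ω) k) = θ
    have hθ' : ∀ k ω, estimate env.feature γ FL (fun m t => W m t ω) k = θ k ω := fun k ω => by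
      rw [← hθ]
    simp only [hθ'] at hreg he hθ1
    clear hθ hθ'
    obtain ⟨h1, h2⟩ := hreg
    rw [h2]
    have he0 := hγm 0 (A := A) (E := epochLength 1) (x := ∫ ω, env.sqError (γ 1) (θ 1 ω) (θ 2 ω) ∂P)
      hA0 le_rfl (he 0).2
    have hes : ∀ l, γ (l + 2) * ∫ ω, env.sqError (γ (l + 2)) (θ (l + 2) ω) (θ (l + 3) ω) ∂P
        ≤ A * (M * K / γ (l + 2)) := fun l =>
      hγm l (E := epochLength (l + 2)) hA0 (by exact_mod_cast epochLength_le_succ l) (he (l + 1)).2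
    obtain ⟨h3, h4⟩ := env.integral_closeBound_le γ hγ hA0 hγs (fun l => (he l).1) he0 hes j
    have h5 : ∀ ω, policyRegret env.ctxMeasure (env.linReward env.trueParam) (fun x =>
        igwProb (γ (j + 2)) (env.linReward (θ (j + 2) ω) x))
        ≤ 2 * (M * K / γ (j + 2)) + env.closeBound γ (fun k => θ k ω) j := fun ω => by
      have h6 := (env.regretClose_closeBound γ hγ (θ := fun k => θ k ω)
        (hθ1 ω) j).policyRegret_igwProb_le (env.isReward_linReward _) (hγ (j + 2))
      rwa [env.ctxMeasure_univ] at h6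
    have h34 : Integrable (fun ω => 2 * ((M : ℝ) * K / γ (j + 2))
        + env.closeBound γ (fun k => θ k ω) j) P := (integrable_const _).add h3
    have h6 := integral_mono h1 h34 h5
    rw [integral_add (integrable_const _) h3] at h6
    simp only [integral_const, probReal_univ, one_smul] at h6
    have h7 := hγd t j (show 1 ≤ t by omega) (by rw [← hj]; exact le_epochEnd_epochOf t)
    have h8 := mul_le_mul_of_nonneg_left h7 (show 0 ≤ 16 * A + 3 by positivity)
    linarith
  have hone : ∀ t, ∑ m, ∫ ω, env.stepRegret γ FL W m t ω ∂P ≤ M := fun t => by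
    calc _ ≤ ∑ _m : Fin M, (1 : ℝ) :=
          Finset.sum_le_sum fun m _ => env.integral_stepRegret_le_one γ hW hFL m t
      _ = M := by simp
  -- The two steps of the first epoch cost at most `1` per agent, which is the term `2 M`; the
  -- induction over epochs handles `t ≥ 3`.
  have hstep : ∀ t ∈ Finset.Icc 1 T, ∑ m, ∫ ω, env.stepRegret γ FL W m t ω ∂P
      ≤ (if t ≤ 2 then (M : ℝ) else 0)
        + (16 * A + 3) * (2 * Real.sqrt (M * K * d)) * (1 / Real.sqrt t) := fun t _ => by
    split_ifs with h
    · have : 0 ≤ (16 * A + 3) * (2 * Real.sqrt (M * K * d)) * (1 / Real.sqrt t) := by positivity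
      linarith [hone t]
    · have := hlate t (by omega)
      linarith
  rw [hsum]
  refine (Finset.sum_le_sum hstep).trans ?_
  rw [Finset.sum_add_distrib, ← Finset.mul_sum, ← Finset.sum_filter, Finset.sum_const, nsmul_eq_mul]
  have h1 : ((Finset.Icc 1 T).filter fun t => t ≤ 2).card ≤ 2 := by
    calc _ ≤ (Finset.Icc 1 2).card := Finset.card_le_card fun t ht => by
          simp only [Finset.mem_filter, Finset.mem_Icc] at ht ⊢; omega
      _ = 2 := rfl
  have h2 : (((Finset.Icc 1 T).filter fun t => t ≤ 2).card : ℝ) ≤ 2 := by exact_mod_cast h1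
  have h3 := mul_le_mul_of_nonneg_right h2 (Nat.cast_nonneg (α := ℝ) M)
  have h4 := mul_le_mul_of_nonneg_left (sum_one_div_sqrt_le T)
    (show 0 ≤ (16 * A + 3) * (2 * Real.sqrt (M * K * d)) by positivity)
  have h5 : Real.sqrt ((M : ℝ) * K * d * T) = Real.sqrt (M * K * d) * Real.sqrt T :=
    Real.sqrt_mul (by positivity) _
  rw [h5]
  have h6 : (16 * A + 3) * (2 * Real.sqrt (M * K * d)) * (2 * Real.sqrt T)
      = (78336 * c₀ + 2572) * (Real.sqrt (M * K * d) * Real.sqrt T) := by rw [hA]; ring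
  linarith

/-! ### Communication -/

lemma completedEpochs_subset {T : ℕ} :
    ((Finset.Icc 1 T).filter fun l => epochEnd l ≤ T) ⊆ Finset.Icc 1 (Nat.log 2 T) := fun l hl => by
  simp only [Finset.mem_filter, Finset.mem_Icc] at hl ⊢
  refine ⟨hl.1.1, Nat.le_log_of_pow_le (by norm_num) ?_⟩
  have h := hl.2
  rwa [epochEnd, if_neg (by omega)] at h

lemma realsCommunicated_directMethod (M d E : ℕ) :
    (directMethod M d E).realsCommunicated = M * (d ^ 2 + d) + M * d := by
  change 1 * (M * (Fintype.card Empty + Fintype.card ((Fin d × Fin d) ⊕ Fin d))) + M * d = _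
  simp [sq]

lemma realsCommunicated_distributedAGD (ρ M d E : ℕ) :
    (distributedAGD ρ M d E).realsCommunicated = ρ * (M * (d + d)) + M * d := by
  change ρ * (M * (Fintype.card (Fin d) + Fintype.card (Fin d))) + M * d = _
  simp

lemma half_le_log_two : (1 / 2 : ℝ) ≤ Real.log 2 := by
  linarith [Real.log_two_gt_d9]

lemma natLog_two_le (T : ℕ) : (Nat.log 2 T : ℝ) ≤ 2 * Real.log T := by
  rcases Nat.eq_zero_or_pos T with rfl | hT
  · simp
  have h1 : ((2 ^ Nat.log 2 T : ℕ) : ℝ) ≤ T := by exact_mod_cast Nat.pow_log_le_self 2 hT.ne'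
  have h2 := Real.log_le_log (by positivity) h1
  rw [Nat.cast_pow, Real.log_pow, Nat.cast_ofNat] at h2
  nlinarith [half_le_log_two, Nat.cast_nonneg (α := ℝ) (Nat.log 2 T)]

/-- The communication cost of FedIGW with the direct method. -/
theorem totalRealsCommunicated_directMethod_le {M d : ℕ} (hd : 1 ≤ d) (T : ℕ) :
    (totalRealsCommunicated (fun E => directMethod M d E) T : ℝ)
      ≤ 6 * (M * d ^ 2 * Real.log T) := by
  have hd' : (1 : ℝ) ≤ d := by exact_mod_cast hd
  have h1 : (totalRealsCommunicated (fun E => directMethod M d E) T : ℝ)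
      ≤ Nat.log 2 T * (M * (d ^ 2 + d) + M * d) := by
    rw [totalRealsCommunicated]
    simp only [realsCommunicated_directMethod, Finset.sum_const, smul_eq_mul]
    have h2 := Finset.card_le_card (completedEpochs_subset (T := T))
    rw [Nat.card_Icc, Nat.add_sub_cancel] at h2
    exact_mod_cast Nat.mul_le_mul_right _ h2
  have h3 : (M : ℝ) * (d ^ 2 + d) + M * d ≤ 3 * (M * d ^ 2) := by
    have : (M : ℝ) * d ≤ M * d ^ 2 := mul_le_mul_of_nonneg_left (by nlinarith) (by positivity)
    linarith
  calc _ ≤ (Nat.log 2 T : ℝ) * (M * (d ^ 2 + d) + M * d) := h1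
    _ ≤ (2 * Real.log T) * (3 * (M * d ^ 2)) :=
        mul_le_mul (natLog_two_le T) h3 (by positivity) (by positivity)
    _ = _ := by ring

/-- Since `√n ≥ 1` and `log (d + 1) ≥ 1 / 2`, the product on the right absorbs the roundings and the
`log`-free term, also for `d = 1`. -/
lemma agdRounds_le {n d : ℕ} (hn : 1 ≤ n) (hd : 1 ≤ d) :
    (agdRounds n d : ℝ) ≤ 9 * (Real.sqrt n * Real.log (d + 1)) := by
  have hn' : (1 : ℝ) ≤ n := by exact_mod_cast hn
  have hd' : (1 : ℝ) ≤ d := by exact_mod_cast hd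
  have hs : 1 ≤ Real.sqrt n := Real.one_le_sqrt.2 hn'
  have hl : 1 / 2 ≤ Real.log (d + 1) :=
    half_le_log_two.trans (Real.log_le_log (by norm_num) (by linarith))
  have hl0 : 0 ≤ Real.log d := Real.log_nonneg hd'
  have hl1 : Real.log d ≤ Real.log (d + 1) := Real.log_le_log (by linarith) (by linarith)
  have hs2 : Real.sqrt (n + 1) ≤ 2 * Real.sqrt n := by
    rw [Real.sqrt_le_left (by positivity), mul_pow, Real.sq_sqrt (by positivity)]
    linarith
  have h1 := Nat.ceil_lt_add_one (Real.sqrt_nonneg (n : ℝ))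
  have h2 := Nat.ceil_lt_add_one (mul_nonneg (Real.sqrt_nonneg ((n : ℝ) + 1)) hl0)
  have h3 : Real.sqrt (n + 1) * Real.log d ≤ 2 * Real.sqrt n * Real.log (d + 1) :=
    mul_le_mul hs2 hl1 hl0 (by positivity)
  rw [agdRounds]
  push_cast
  nlinarith

/-- A geometric sum; the induction closes because `4 + √2 ≤ 4 √2`. -/
lemma sum_sqrt_two_pow_le (L : ℕ) :
    ∑ l ∈ Finset.Icc 1 L, Real.sqrt (2 ^ l) ≤ 4 * Real.sqrt (2 ^ L) := by
  induction L with
  | zero => simp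
  | succ L ih =>
    rw [Finset.sum_Icc_succ_top (by omega), pow_succ, Real.sqrt_mul (by positivity)]
    have h1 : (4 / 3 : ℝ) ≤ Real.sqrt 2 := Real.le_sqrt_of_sq_le (by norm_num)
    nlinarith [Real.sqrt_nonneg ((2 : ℝ) ^ L)]

/-- The communication cost of FedIGW with distributed accelerated gradient descent. -/
theorem totalRealsCommunicated_distributedAGD_le {M d T : ℕ} (hM : 1 ≤ M) (hd : 1 ≤ d)
    (hT : 1 ≤ T) :
    (totalRealsCommunicated (fun E => distributedAGD (agdRounds (M * E) d) M d E) T : ℝ)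
      ≤ 80 * (d * Real.log (d + 1) * Real.sqrt ((M : ℝ) ^ 3 * T)) := by
  have hl : 1 / 2 ≤ Real.log ((d : ℝ) + 1) := by
    have : (1 : ℝ) ≤ d := by exact_mod_cast hd
    exact half_le_log_two.trans (Real.log_le_log (by norm_num) (by linarith))
  have hM' : 1 ≤ Real.sqrt M := Real.one_le_sqrt.2 (by exact_mod_cast hM)
  have hcost : ∀ l ∈ Finset.Icc 1 (Nat.log 2 T),
      ((distributedAGD (agdRounds (M * epochLength l) d) M d (epochLength l)).realsCommunicated : ℝ)
        ≤ 20 * (M * d * Real.log (d + 1) * Real.sqrt M) * Real.sqrt (2 ^ l) := fun l h => by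
    obtain ⟨k, rfl⟩ : ∃ k, l = k + 1 := ⟨l - 1, by have := (Finset.mem_Icc.1 h).1; omega⟩
    have hE := two_le_epochLength k
    have h1 := agdRounds_le (n := M * epochLength (k + 1)) (d := d)
      (Nat.one_le_iff_ne_zero.2 (by positivity)) hd
    have h2 : Real.sqrt ((M * epochLength (k + 1) : ℕ) : ℝ)
        ≤ Real.sqrt M * Real.sqrt (2 ^ (k + 1)) := by
      rw [← Real.sqrt_mul (by positivity)]
      refine Real.sqrt_le_sqrt ?_
      have : epochLength (k + 1) ≤ 2 ^ (k + 1) := by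
        rw [epochLength, epochEnd, if_neg (by omega)]
        exact Nat.sub_le _ _
      exact_mod_cast Nat.mul_le_mul_left M this
    have h3 : 1 ≤ Real.sqrt (2 ^ (k + 1)) :=
      Real.one_le_sqrt.2 (one_le_pow₀ (by norm_num))
    have h4 : (agdRounds (M * epochLength (k + 1)) d : ℝ)
        ≤ 9 * (Real.sqrt M * Real.sqrt (2 ^ (k + 1)) * Real.log (d + 1)) := by
      have := mul_le_mul_of_nonneg_right h2 (show 0 ≤ Real.log ((d : ℝ) + 1) by linarith)
      linarith
    -- This absorbs the final broadcast of `M d` reals at the cost of `2`; with `9 · 2` from the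
    -- rounds it makes `20`.
    have h5 : 1 / 2 ≤ Real.sqrt M * Real.sqrt (2 ^ (k + 1)) * Real.log (d + 1) := by
      have h6 := one_le_mul_of_one_le_of_one_le hM' h3
      nlinarith
    rw [realsCommunicated_distributedAGD]
    push_cast
    have h7 := mul_le_mul_of_nonneg_right h4 (show 0 ≤ (M : ℝ) * (d + d) by positivity)
    have h8 := mul_le_mul_of_nonneg_right h5 (show 0 ≤ (M : ℝ) * d by positivity)
    linarith
  have hpow : Real.sqrt (2 ^ Nat.log 2 T) ≤ Real.sqrt T :=
    Real.sqrt_le_sqrt (by exact_mod_cast Nat.pow_log_le_self 2 (by omega))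
  have hsqrt : Real.sqrt ((M : ℝ) ^ 3 * T) = M * Real.sqrt M * Real.sqrt T := by
    rw [Real.sqrt_mul (by positivity), pow_succ, Real.sqrt_mul (by positivity),
      Real.sqrt_sq (by positivity)]
  have hc : 0 ≤ 20 * ((M : ℝ) * d * Real.log (d + 1) * Real.sqrt M) :=
    mul_nonneg (by norm_num) (mul_nonneg (mul_nonneg (by positivity) (by linarith)) (by positivity))
  rw [totalRealsCommunicated, Nat.cast_sum]
  refine (Finset.sum_le_sum_of_subset_of_nonneg completedEpochs_subset
    fun _ _ _ => Nat.cast_nonneg _).trans ((Finset.sum_le_sum hcost).trans ?_)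
  rw [← Finset.mul_sum, hsqrt]
  have h := mul_le_mul_of_nonneg_left ((sum_sqrt_two_pow_le (Nat.log 2 T)).trans
    (mul_le_mul_of_nonneg_left hpow (by norm_num))) hc
  linarith

end FedIGW

end

/-! ### Assembly of the communication and regret bounds. -/

theorem mainTheorem4 :
    ∃ (C c : ℝ) (p q : ℕ) (ρ : ℕ → ℕ → ℕ), 0 < C ∧ 0 < c ∧
      ∀ (M K d T : ℕ) [NeZero K], 1 ≤ M → 1 ≤ d → 1 ≤ T →
        -- communication of the direct method
        (FedIGW.totalRealsCommunicated (fun E => FedIGW.directMethod M d E) T : ℝ) ≤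
          C * (M * d ^ 2 * Real.log T) ∧
        -- communication of distributed AGD, with a number of rounds depending on `n` and `d`
        (FedIGW.totalRealsCommunicated (fun E => FedIGW.distributedAGD (ρ (M * E) d) M d E) T : ℝ) ≤
          C * (d * Real.log (d + 1) * Real.sqrt ((M : ℝ) ^ 3 * T)) ∧
        -- regret with either protocol
        ∀ (𝒳 : Fin M → Type*) [∀ m, MeasurableSpace (𝒳 m)] (env : FedIGW.LinearEnv K d 𝒳)
          (Ω : Type*) [MeasurableSpace Ω] (P : MeasureTheory.Measure Ω)
          [MeasureTheory.IsProbabilityMeasure P]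
          (W : ∀ m : Fin M, ℕ → Ω → FedIGW.Draw K 𝒳 m), FedIGW.IsInteraction env P W →
          ∀ FL : ∀ E, FedIGW.FLProtocol M d E,
            (FL = (fun E => FedIGW.directMethod M d E) ∨
              FL = fun E => FedIGW.distributedAGD (ρ (M * E) d) M d E) →
            MeasureTheory.Integrable (fun ω => FedIGW.pathRegret env
              (FedIGW.learningRate c p M K d) FL T fun m t => W m t ω) P ∧
            ∫ ω, FedIGW.pathRegret env (FedIGW.learningRate c p M K d) FL T
                (fun m t => W m t ω) ∂P ≤
              2 * M + C * (Real.sqrt ((M : ℝ) * K * d * T) * (1 + Real.log ((M : ℝ) * T)) ^ q) := by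
  -- The largest constant needed is `78336 * 16 + 2572 = 1255948`, from the regret with optimization
  -- accuracy `16`; communication needs only `6` and `80`.
  refine ⟨2000000, 1, 0, 0, FedIGW.agdRounds, by norm_num, by norm_num, ?_⟩
  intro M K d T _ hM hd hT
  have hd' : (1 : ℝ) ≤ d := by exact_mod_cast hd
  have hlog : 0 ≤ Real.log ((d : ℝ) + 1) := Real.log_nonneg (by linarith)
  refine ⟨?_, ?_, ?_⟩
  · refine (FedIGW.totalRealsCommunicated_directMethod_le hd T).trans
      (mul_le_mul_of_nonneg_right (by norm_num) (by positivity))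
  · refine (FedIGW.totalRealsCommunicated_distributedAGD_le hM hd hT).trans
      (mul_le_mul_of_nonneg_right (by norm_num) (by positivity))
  · intro 𝒳 _ env Ω _ P _ W hW FL hFL
    have happrox : ∀ E, 1 ≤ E → (FL E).ApproxRidge 16 := fun E hE => by
      rcases hFL with rfl | rfl
      · exact FedIGW.directMethod_approxRidge hM hE (by norm_num)
      · exact FedIGW.distributedAGD_approxRidge hM hE hd
    obtain ⟨hint, hle⟩ := FedIGW.integral_pathRegret_le env hM hd hW (by norm_num) happrox T
    refine ⟨hint, hle.trans ?_⟩
    rw [pow_zero, mul_one]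
    have h := Real.sqrt_nonneg ((M : ℝ) * K * d * T)
    linarith
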